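/- **Setting.** Let $\mathcal D$ be a complex manifold, $E\to\mathcal D$ a holomorphic vector bundle of rank $\ell$, $p\ge 1$, and $k_1,\dots,k_p\ge 1$ integers. Let $\lambda_1,\dots,\lambda_p$ be holomorphic functions on $\mathcal D$ that are distinct at every point; put $q(x)=\prod_i (x-\lambda_i)^{k_i}$ and $x_i=x-\lambda_i$. A *meromorphic $q$-connection* on the pull-back of $E$ to $\mathcal D\times\mathbb{CP}^1$ is a connection $\nabla$ given in holomorphic frames of $E$ by $$\nabla=\mathrm d+\Omega-A\,\mathrm dx,\qquad A=\frac{Q}{q},\qquad \Omega=\frac{R}{q},$$ where $Q$ and the 1-form $R$ on $\mathcal D$ are polynomial in $x$, with matrix coefficients holomorphic on $\mathcal D$, $\deg Q\le\deg q-2$, $\deg R\le \deg q$, such that $q\,\Omega|_{x=\lambda_i}=Q(\lambda_i)\,\mathrm d\lambda_i$ for each $i$. It is assumed that $Q(\lambda_i)$ has distinct nonzero eigenvalues for each $i$. Under a change of frame $g$ (independent of $x$), $A\mapsto g^{-1}Ag$ and $\Omega\mapsto g^{-1}\Omega g+g^{-1}\mathrm dg$. The connection $\nabla$ is a *solution of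 the (Jimbo–Miwa–Ueno) deformation problem* if it is flat. Write $\Omega_\infty=\Omega|_{x=\infty}$ and $\nabla_\infty=\mathrm d+\Omega_\infty$ (a connection on $E$). Let $V\to\mathcal D$ be the bundle whose fibre at $t$ is the space of holomorphic maps $u$ from a neighbourhood of $\{\lambda_1,\dots,\lambda_p\}$ to $E_t$, modulo multiples of $q$ (truncated jets at the poles), trivialized, in a frame of $E$, by the first $k_i$ coefficients of the expansion of $u$ in powers of $x_i$ for each $i$. It contains $E$ as the subbundle of constant maps. Define endomorphisms $a,b$ of $V$ and a 1-form $\alpha$ on $\mathcal D$ with values in the endomorphisms of $V$ by $$au=xu,\qquad bu=\sum_i\frac1{2\pi \mathrm i}\oint_{\lambda_i}A\,u\,\mathrm dx\in E\subset V,\qquad \alpha u=A^{-1}\Omega\,u .$$ A holomorphic connection $D=\mathrm d+\beta$ on $V$ is *induced by* $\nabla$ if it coincides with $\nabla_\infty$ on $E\subset V$ and $$Da=[b,\alpha]+\alpha .$$ **Proposition.** Let $\nabla$ be a meromorphic $q$-connection. There is at most one induced connection $D$; it exists if and only if $\alpha$ commutes with multiplication by $Q$ on $V$, and this is the case whenever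 $\nabla$ is a solution of the deformation problem. If $D=\mathrm d+\beta$ is the induced connection, then $\nabla$ is a solution of the deformation problem if and only if $$D^2=\mathrm d\beta+\beta\wedge\beta=0,\qquad Db=\mathrm db+[\beta,b]=0,\qquad D\alpha=\mathrm d\alpha+\beta\wedge\alpha+\alpha\wedge\beta=0 .$$ -/

import Mathlib

open scoped Manifold ContDiff Topology

noncomputable section

namespace Isomonodromy

/-! ### One complex variable: Taylor coefficients and residues -/

/-- The coefficient of `(x - c) ^ m` in the Taylor expansion of `h` at `c`. -/
def taylorCoeff {W : Type*} [NormedAddCommGroup W] [NormedSpace ℂ W]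
    (h : ℂ → W) (c : ℂ) (m : ℕ) : W :=
  ((m.factorial : ℂ))⁻¹ • iteratedDeriv m h c

/-- The residue of `f` at `c`: the integral of `f dx / (2 π i)` around `c` over all sufficiently
small circles (for `f` holomorphic in a punctured neighbourhood of `c`, the integral does not
depend on the small radius, so that this is an eventually constant limit). -/
def residue {W : Type*} [NormedAddCommGroup W] [NormedSpace ℂ W] (f : ℂ → W) (c : ℂ) : W :=
  Filter.limUnder (𝓝[>] (0 : ℝ)) fun r => (2 * (Real.pi : ℂ) * Complex.I)⁻¹ • ∮ x in C(c, r), f x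

/-- The polynomial `q(x) = ∏ (x - λᵢ) ^ kᵢ`. -/
def qPoly {p : ℕ} (k : Fin p → ℕ) (lam : Fin p → ℂ) (x : ℂ) : ℂ :=
  ∏ i, (x - lam i) ^ k i

/-- The value at `x` of the polynomial with coefficients `c n`. -/
def polyEval {W : Type*} [AddCommGroup W] [Module ℂ W] {d : ℕ} (c : Fin d → W) (x : ℂ) : W :=
  ∑ n : Fin d, x ^ (n : ℕ) • c n

/-- The degree of `q`. -/
def qDeg {p : ℕ} (k : Fin p → ℕ) : ℕ := ∑ i, k i

/-! ### Truncated jets at the poles -/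

section Jets

variable {p : ℕ} (k : Fin p → ℕ) (F : Type*) [NormedAddCommGroup F] [NormedSpace ℂ F]

/-- The space of truncated jets: a `p`-tuple of polynomials `uᵢ` of degree at most `kᵢ - 1` in the
variables `xᵢ = x - λᵢ`, with coefficients in `F`; `u i m` is the coefficient of `xᵢ ^ m`.
Equivalently, `F`-valued holomorphic functions near the points `λᵢ` modulo multiples of `q`. -/
abbrev Jet : Type _ := (i : Fin p) → Fin (k i) → F

variable {F}

/-- The projection `u ↦ u i m`. -/
def jetProj (i : Fin p) (m : Fin (k i)) : Jet k F →L[ℂ] F :=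
  (ContinuousLinearMap.proj m).comp
    (ContinuousLinearMap.proj (R := ℂ) (φ := fun j : Fin p => Fin (k j) → F) i)

/-- Multiplication of jets by a function `h`, holomorphic near the points `λᵢ`, with values in the
endomorphisms of `F`: the coefficient of `xᵢ ^ m` in `h u` is `∑_{j ≤ m} h_{i, m - j} u_{i, j}`. -/
def jetMul (lam : Fin p → ℂ) (h : ℂ → F →L[ℂ] F) : Jet k F →L[ℂ] Jet k F :=
  ContinuousLinearMap.pi fun i => ContinuousLinearMap.pi fun m =>
    ∑ j : Fin (k i), if j ≤ m then
      (taylorCoeff h (lam i) ((m : ℕ) - (j : ℕ))).comp (jetProj k i j) else 0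

/-- The inclusion of `F` into the jets, as the constant functions. -/
def jetConst : F →L[ℂ] Jet k F :=
  ContinuousLinearMap.pi fun _ => ContinuousLinearMap.pi fun m =>
    if (m : ℕ) = 0 then ContinuousLinearMap.id ℂ F else 0

/-- The endomorphism of the jets induced by a constant endomorphism of `F`: it acts on every
coefficient. -/
def jetMap (g : F →L[ℂ] F) : Jet k F →L[ℂ] Jet k F :=
  ContinuousLinearMap.pi fun i => ContinuousLinearMap.pi fun m => g.comp (jetProj k i m)

/-- `u ↦ ∑ᵢ (1 / 2πi) ∮ A u dx`, the integral of the `i`-th term being taken around `λᵢ`. -/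
def jetResidue (lam : Fin p → ℂ) (A : ℂ → F →L[ℂ] F) : Jet k F →L[ℂ] F :=
  ∑ i, ∑ m : Fin (k i),
    (residue (fun x => (x - lam i) ^ (m : ℕ) • A x) (lam i)).comp (jetProj k i m)

theorem continuous_jetMap : Continuous (jetMap (F := F) k) := by
  have h : ∀ g : F →L[ℂ] F, jetMap k g =
      ∑ i, ∑ m : Fin (k i), (ContinuousLinearMap.single ℂ (fun j : Fin p => Fin (k j) → F) i).comp
        ((ContinuousLinearMap.single ℂ (fun _ : Fin (k i) => F) m).comp
          (g.comp (jetProj k i m))) := by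
    intro g
    ext u i m
    simp only [jetMap, ContinuousLinearMap.coe_pi', ContinuousLinearMap.comp_apply,
      _root_.sum_apply, Finset.sum_apply, ContinuousLinearMap.single_apply]
    rw [Finset.sum_eq_single i, Finset.sum_eq_single m]
    · simp
    · intro b _ hb
      simp [Pi.single_eq_of_ne (Ne.symm hb)]
    · simp
    · intro b _ hb
      simp [Pi.single_eq_of_ne (Ne.symm hb)]
    · simp
  rw [show jetMap (F := F) k = _ from funext h]
  fun_prop

end Jets

/-! ### Holomorphic bundles and connections

A holomorphic vector bundle with fibre `F` over a complex manifold `M` is given by its transition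
functions, that is, by a `VectorBundleCore`. -/

section Bundles

variable {T : Type*} [NormedAddCommGroup T] [NormedSpace ℂ T]
variable {M : Type*} [TopologicalSpace M] [ChartedSpace T M]
variable {F : Type*} [NormedAddCommGroup F] [NormedSpace ℂ F]
variable {ι : Type*}

/-- The bundle of truncated jets with values in the bundle `E`, trivialized over the same open
sets by the use of the coordinates `xᵢ = x - λᵢ`. -/
def jetCore {p : ℕ} (k : Fin p → ℕ) (E : VectorBundleCore ℂ M F ι) :
    VectorBundleCore ℂ M (Jet k F) ι where
  baseSet := E.baseSet
  isOpen_baseSet := E.isOpen_baseSet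
  indexAt := E.indexAt
  mem_baseSet_at := E.mem_baseSet_at
  coordChange i j t := jetMap k (E.coordChange i j t)
  coordChange_self i t ht u := by
    ext a m
    simp [jetMap, jetProj, E.coordChange_self i t ht]
  continuousOn_coordChange i j :=
    (continuous_jetMap k).comp_continuousOn (E.continuousOn_coordChange i j)
  coordChange_comp i j l t ht u := by
    ext a m
    simp [jetMap, jetProj, E.coordChange_comp i j l t ht]

/-- The differential at `t` of a vector-valued function on `M`. -/
def diff {W : Type*} [NormedAddCommGroup W] [NormedSpace ℂ W] (f : M → W) (t : M) :
    TangentSpace 𝓘(ℂ, T) t →L[ℂ] W :=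
  mfderiv 𝓘(ℂ, T) 𝓘(ℂ, W) f t

/-- The representation, in a chart `φ` of `M`, of a vector-valued 1-form on `M`. -/
def pull {W : Type*} [NormedAddCommGroup W] [NormedSpace ℂ W] (φ : OpenPartialHomeomorph M T)
    (θ : (t : M) → TangentSpace 𝓘(ℂ, T) t →L[ℂ] W) (s : T) : T →L[ℂ] W :=
  (θ (φ.symm s)).comp (mfderiv 𝓘(ℂ, T) 𝓘(ℂ, T) φ.symm s)

/-- The part of the image of the chart `φ` over which the `i`-th frame of `E` is defined. -/
def chartDom (E : VectorBundleCore ℂ M F ι) (φ : OpenPartialHomeomorph M T) (i : ι) : Set T :=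
  φ.target ∩ φ.symm ⁻¹' E.baseSet i

/-- A vector-valued 1-form on an open subset of `M` is holomorphic if it is in every chart. -/
def HolomorphicForm {W : Type*} [NormedAddCommGroup W] [NormedSpace ℂ W]
    (θ : (t : M) → TangentSpace 𝓘(ℂ, T) t →L[ℂ] W) (U : Set M) : Prop :=
  ∀ φ ∈ atlas T M, ContDiffOn ℂ ω (pull φ θ) (φ.target ∩ φ.symm ⁻¹' U)

/-- The exterior derivative at `s`, on the pair of vectors `X`, `Y`, of a 1-form on an open subset
of the vector space `S` (the form is written `s ↦ X ↦ θ s X`). -/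
def extD {S : Type*} [NormedAddCommGroup S] [NormedSpace ℂ S]
    {W : Type*} [NormedAddCommGroup W] [NormedSpace ℂ W]
    (θ : S → S → W) (s X Y : S) : W :=
  fderiv ℂ (fun s' => θ s' Y) s X - fderiv ℂ (fun s' => θ s' X) s Y

/-- The wedge product of two 1-forms with values in the endomorphisms of `F`. -/
def wedge {S : Type*} (θ η : S → S → F →L[ℂ] F) (s X Y : S) : F →L[ℂ] F :=
  θ s X * η s Y - θ s Y * η s X

/-- The curvature `dθ + θ ∧ θ` of the connection `d + θ` on a trivial bundle with fibre `F`. -/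
def curvature {S : Type*} [NormedAddCommGroup S] [NormedSpace ℂ S]
    (θ : S → S → F →L[ℂ] F) (s X Y : S) : F →L[ℂ] F :=
  extD θ s X Y + wedge θ θ s X Y

/-- A holomorphic connection on the bundle `E`: in the `i`-th frame it is `d + form i`, and the
connection forms are related by the gauge transformations that the changes of frame determine. -/
structure HolConnection (T : Type*) [NormedAddCommGroup T] [NormedSpace ℂ T]
    {M : Type*} [TopologicalSpace M] [ChartedSpace T M]
    {F : Type*} [NormedAddCommGroup F] [NormedSpace ℂ F]
    {ι : Type*} (E : VectorBundleCore ℂ M F ι) where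
  form : ι → (t : M) → TangentSpace 𝓘(ℂ, T) t →L[ℂ] (F →L[ℂ] F)
  holomorphic : ∀ i, HolomorphicForm (form i) (E.baseSet i)
  gauge : ∀ i j, ∀ t ∈ E.baseSet i ∩ E.baseSet j, ∀ X,
    form j t X * E.coordChange i j t =
      E.coordChange i j t * form i t X - diff (T := T) (E.coordChange i j) t X

namespace HolConnection

variable {E : VectorBundleCore ℂ M F ι}

/-- Two connections on `E` are the same (values of the connection forms outside the domains of the
frames are irrelevant). -/
def Same (D D' : HolConnection T E) : Prop :=
  ∀ i, ∀ t ∈ E.baseSet i, D.form i t = D'.form i t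

/-- The representation of the connection form in a frame and a chart. -/
def loc (D : HolConnection T E) (φ : OpenPartialHomeomorph M T) (i : ι) (s X : T) : F →L[ℂ] F :=
  pull φ (D.form i) s X

/-- `D² = 0`. -/
def IsFlat (D : HolConnection T E) : Prop :=
  ∀ φ ∈ atlas T M, ∀ i, ∀ s ∈ chartDom E φ i, ∀ X Y : T, curvature (D.loc φ i) s X Y = 0

/-- The covariant derivative `df + [β, f]` of an endomorphism `f` of `E`, written in the `i`-th
frame, in a chart. -/
def covDeriv (D : HolConnection T E) (φ : OpenPartialHomeomorph M T) (i : ι)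
    (f : M → F →L[ℂ] F) (s X : T) : F →L[ℂ] F :=
  fderiv ℂ (fun s' => f (φ.symm s')) s X + (D.loc φ i s X * f (φ.symm s) -
    f (φ.symm s) * D.loc φ i s X)

/-- The covariant exterior derivative `dθ + β ∧ θ + θ ∧ β` of a 1-form `θ` with values in the
endomorphisms of `E`, written in the `i`-th frame and in a chart. -/
def covExtD (D : HolConnection T E) (φ : OpenPartialHomeomorph M T) (i : ι)
    (θ : T → T → F →L[ℂ] F) (s X Y : T) : F →L[ℂ] F :=
  extD θ s X Y + wedge (D.loc φ i) θ s X Y + wedge θ (D.loc φ i) s X Y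

end HolConnection

end Bundles

/-! ### Meromorphic `q`-connections -/

/-- A meromorphic `q`-connection `d + Ω - A dx` on the pull-back of the bundle `E` to `M × ℂℙ¹`.
In the `i`-th frame `A = Q / q` and `Ω = R / q`, where `q = ∏ (x - λⱼ) ^ kⱼ`, and where `Q`, `R`
are polynomials in `x` with coefficients `Qc i n`, `Rc i n`, of degrees at most `deg q - 2`
and `deg q` respectively (so that there is no singularity at `x = ∞`). -/
structure QConnection (T : Type*) [NormedAddCommGroup T] [NormedSpace ℂ T]
    {M : Type*} [TopologicalSpace M] [ChartedSpace T M] {ℓ : ℕ} {ι : Type*}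
    (E : VectorBundleCore ℂ M (Fin ℓ → ℂ) ι) {p : ℕ} (k : Fin p → ℕ) where
  /-- The positions of the poles. -/
  lam : Fin p → M → ℂ
  lam_holomorphic : ∀ j, ContMDiff 𝓘(ℂ, T) 𝓘(ℂ, ℂ) ω (lam j)
  lam_injective : ∀ t, Function.Injective fun j => lam j t
  Qc : ι → Fin (qDeg k - 1) → M → (Fin ℓ → ℂ) →L[ℂ] (Fin ℓ → ℂ)
  Rc : ι → Fin (qDeg k + 1) → (t : M) →
    TangentSpace 𝓘(ℂ, T) t →L[ℂ] ((Fin ℓ → ℂ) →L[ℂ] (Fin ℓ → ℂ))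
  Qc_holomorphic : ∀ i n, ContMDiffOn 𝓘(ℂ, T) 𝓘(ℂ, (Fin ℓ → ℂ) →L[ℂ] (Fin ℓ → ℂ)) ω
    (Qc i n) (E.baseSet i)
  Rc_holomorphic : ∀ i n, HolomorphicForm (Rc i n) (E.baseSet i)
  /-- `A` takes values in the endomorphisms of `E`. -/
  Q_gauge : ∀ i j, ∀ t ∈ E.baseSet i ∩ E.baseSet j, ∀ n,
    Qc j n t * E.coordChange i j t = E.coordChange i j t * Qc i n t
  /-- `d + Ω` is a connection for every fixed `x`: `g` being the change of frame,
  `Ωⱼ g = g Ωᵢ - dg`, where both sides are multiplied by `q`. -/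
  R_gauge : ∀ i j, ∀ t ∈ E.baseSet i ∩ E.baseSet j, ∀ X, ∀ x : ℂ,
    polyEval (fun n => Rc j n t X) x * E.coordChange i j t =
      E.coordChange i j t * polyEval (fun n => Rc i n t X) x -
        qPoly k (fun j => lam j t) x • diff (T := T) (E.coordChange i j) t X
  /-- `q Ω = Q dλⱼ` at `x = λⱼ`. -/
  leading : ∀ i, ∀ t ∈ E.baseSet i, ∀ j, ∀ X,
    polyEval (fun n => Rc i n t X) (lam j t) =
      diff (T := T) (lam j) t X • polyEval (fun n => Qc i n t) (lam j t)
  /-- The eigenvalues of `Q` at `x = λⱼ` are distinct and nonzero. -/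
  eigenvalues : ∀ i, ∀ t ∈ E.baseSet i, ∀ j,
    (LinearMap.charpoly (polyEval (fun n => Qc i n t) (lam j t)).toLinearMap).roots.Nodup ∧
    0 ∉ (LinearMap.charpoly (polyEval (fun n => Qc i n t) (lam j t)).toLinearMap).roots

namespace QConnection

variable {T : Type*} [NormedAddCommGroup T] [NormedSpace ℂ T]
  {M : Type*} [TopologicalSpace M] [ChartedSpace T M] {ℓ : ℕ} {ι : Type*}
  {E : VectorBundleCore ℂ M (Fin ℓ → ℂ) ι} {p : ℕ} {k : Fin p → ℕ}

/-- The poles at `t`. -/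
def poles (C : QConnection T E k) (t : M) (j : Fin p) : ℂ := C.lam j t

/-- `q(x)`, at the point `t`. -/
def q (C : QConnection T E k) (t : M) (x : ℂ) : ℂ := qPoly k (C.poles t) x

/-- `Q(x)`, at the point `t`, in the `i`-th frame. -/
def Q (C : QConnection T E k) (i : ι) (t : M) (x : ℂ) : (Fin ℓ → ℂ) →L[ℂ] (Fin ℓ → ℂ) :=
  polyEval (fun n => C.Qc i n t) x

/-- `R(x) = q(x) Ω(x)`, at the point `t`, in the `i`-th frame. -/
def R (C : QConnection T E k) (i : ι) (x : ℂ) (t : M) :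
    TangentSpace 𝓘(ℂ, T) t →L[ℂ] ((Fin ℓ → ℂ) →L[ℂ] (Fin ℓ → ℂ)) :=
  polyEval (fun n => C.Rc i n t) x

/-- `A = Q / q`. -/
def A (C : QConnection T E k) (i : ι) (t : M) (x : ℂ) : (Fin ℓ → ℂ) →L[ℂ] (Fin ℓ → ℂ) :=
  (C.q t x)⁻¹ • C.Q i t x

/-- `Ω = R / q`. -/
def Omega (C : QConnection T E k) (i : ι) (x : ℂ) (t : M) :
    TangentSpace 𝓘(ℂ, T) t →L[ℂ] ((Fin ℓ → ℂ) →L[ℂ] (Fin ℓ → ℂ)) :=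
  (C.q t x)⁻¹ • C.R i x t

/-- The value of `Ω` at `x = ∞`: as `q` is monic, it is the coefficient of `x ^ (deg q)` in `R`. -/
def OmegaInf (C : QConnection T E k) (i : ι) (t : M) :
    TangentSpace 𝓘(ℂ, T) t →L[ℂ] ((Fin ℓ → ℂ) →L[ℂ] (Fin ℓ → ℂ)) :=
  C.Rc i (Fin.last _) t

/-- The connection form `Ω - A dx` in a chart and a frame, at the point `z = (s, x)`, on the tangent
vector `Z = (X, ξ)`. -/
def form (C : QConnection T E k) (φ : OpenPartialHomeomorph M T) (i : ι) (z Z : T × ℂ) :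
    (Fin ℓ → ℂ) →L[ℂ] (Fin ℓ → ℂ) :=
  pull φ (C.Omega i z.2) z.1 Z.1 - Z.2 • C.A i (φ.symm z.1) z.2

/-- The meromorphic `q`-connection is a solution of the deformation problem: it is flat (as a
connection over the complement of the poles in the product of the base and the `x`-line). -/
def IsSolution (C : QConnection T E k) : Prop :=
  ∀ φ ∈ atlas T M, ∀ i, ∀ s ∈ chartDom E φ i, ∀ x : ℂ, C.q (φ.symm s) x ≠ 0 →
    ∀ Z Z' : T × ℂ, curvature (C.form φ i) (s, x) Z Z' = 0

/-- The endomorphism `a : u ↦ x u` of the jet bundle. -/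
def a (C : QConnection T E k) (t : M) : Jet k (Fin ℓ → ℂ) →L[ℂ] Jet k (Fin ℓ → ℂ) :=
  jetMul k (C.poles t) fun x => x • ContinuousLinearMap.id ℂ (Fin ℓ → ℂ)

/-- The endomorphism `b` of the jet bundle, in the `i`-th frame: `b u` is the constant jet
`∑ⱼ (1 / 2πi) ∮ A u dx`, the integrals being taken around the poles `λⱼ`. -/
def b (C : QConnection T E k) (i : ι) (t : M) :
    Jet k (Fin ℓ → ℂ) →L[ℂ] Jet k (Fin ℓ → ℂ) :=
  (jetConst k).comp (jetResidue k (C.poles t) (C.A i t))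

/-- The 1-form `α` with values in the endomorphisms of the jet bundle, in the `i`-th frame:
multiplication by the Taylor expansions of `A⁻¹ Ω` at the poles. The removable singularities of
`A⁻¹ Ω` at the poles are removed by writing it as `Q⁻¹ R`. -/
def alpha (C : QConnection T E k) (i : ι) (t : M) (X : TangentSpace 𝓘(ℂ, T) t) :
    Jet k (Fin ℓ → ℂ) →L[ℂ] Jet k (Fin ℓ → ℂ) :=
  jetMul k (C.poles t) fun x => Ring.inverse (C.Q i t x) * C.R i x t X

/-- The representation of `α` in a frame and a chart. -/
def alphaLoc (C : QConnection T E k) (φ : OpenPartialHomeomorph M T) (i : ι) (s X : T) :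
    Jet k (Fin ℓ → ℂ) →L[ℂ] Jet k (Fin ℓ → ℂ) :=
  C.alpha i (φ.symm s) (mfderiv 𝓘(ℂ, T) 𝓘(ℂ, T) φ.symm s X)

/-- `α` commutes with (multiplication of jets by) `Q`. -/
def AlphaCommutes (C : QConnection T E k) : Prop :=
  ∀ i, ∀ t ∈ E.baseSet i, ∀ X : TangentSpace 𝓘(ℂ, T) t,
    Commute (C.alpha i t X) (jetMul k (C.poles t) (C.Q i t))

/-- `D` is the connection induced on the jet bundle: it coincides with `∇_∞ = d + Ω_∞` on
the subbundle `E` of constant jets, and `D a = [b, α] + α`. -/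
def IsInduced (C : QConnection T E k) (D : HolConnection T (jetCore k E)) : Prop :=
  (∀ i, ∀ t ∈ E.baseSet i, ∀ X : TangentSpace 𝓘(ℂ, T) t, ∀ v : Fin ℓ → ℂ,
    D.form i t X (jetConst k v) = jetConst k (C.OmegaInf i t X v)) ∧
  ∀ φ ∈ atlas T M, ∀ i, ∀ s ∈ chartDom E φ i, ∀ X : T,
    D.covDeriv φ i C.a s X =
      (C.b i (φ.symm s) * C.alphaLoc φ i s X - C.alphaLoc φ i s X * C.b i (φ.symm s)) +
        C.alphaLoc φ i s X

/-- `D b = 0`. -/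
def BParallel (C : QConnection T E k) (D : HolConnection T (jetCore k E)) : Prop :=
  ∀ φ ∈ atlas T M, ∀ i, ∀ s ∈ chartDom E φ i, ∀ X : T, D.covDeriv φ i (C.b i) s X = 0

/-- `D α = 0`. -/
def AlphaClosed (C : QConnection T E k) (D : HolConnection T (jetCore k E)) : Prop :=
  ∀ φ ∈ atlas T M, ∀ i, ∀ s ∈ chartDom E φ i, ∀ X Y : T,
    D.covExtD φ i (C.alphaLoc φ i) s X Y = 0

end QConnection

end Isomonodromy

end

/-! Fix a point of the base. Since `q` is monic of degree `N = deg q`, division with remainder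
identifies the jet space `V` with `F ⊗ ℂ[x]/q`. Thus `V` is generated over `ℂ[a]` by the constant
jets `ι F`, with `q(a) = 0`. The functional `ρ u = ∑ res (u/q)` reads the coefficient of `x ^ (N -
1)`. This is the content of `CyclicTriple` and `cyclicTriple_jet`. With `Q̂`, `R̂` denoting
multiplication by `Q`, `R`, one has `b = ι ρ Q̂` and `α = Q̂⁻¹ R̂`.

Uniqueness: the difference of two induced connections commutes with `a` and kills `ι F`, hence
vanishes (`eq_of_commute`).

Existence: one needs `β` with `[β, a] = K`, where `K = [b, α] + α - da`, and with given restriction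
to `ι F`. Differentiating `q(a) = 0` along `[β, ·]` shows that the derivative `polyDiff a q K` of
`q` at `a` in the direction `K` must vanish. This derivative is linear over the commutant of `a`, it
takes `ι ρ` to `1`, and it takes `α - da` to `q'(a) (α - da) = 0` because `α` has the value `dλᵢ` at
`λᵢ`. So the obstruction is exactly `[Q̂, α]` (`polyDiff_commutator`). When it vanishes,
`CyclicTriple.extend` gives `β` by an explicit formula, holomorphic in all its ingredients.
Uniqueness makes the forms in different frames fit together.

Flat connections satisfy the condition: the component `dA + ∂Ω/∂x + [Ω, A] = 0`, multiplied by `q²`,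
shows that `[R, Q]` is divisible by `q`, the apparent poles cancelling by the condition on `q Ω` at
`x = λⱼ`. Hence `R̂` and `Q̂` commute (`IsSolution.alphaCommutes`).

Flatness: let `ψ = (z - a)⁻¹ ι v` for `q(z) ≠ 0`. Then `b ψ = ι A(z) v` and `b α ψ = ι (Ω(z) - Ω_∞)
v`, so `A` and `Ω` are generating functions for `b` and `b α`. Differentiation gives `(Db) ψ = ι (dA
+ ∂Ω/∂x + [Ω, A]) v` (`Db_psi`). If `Db = 0`, it also gives `b (Dα) ψ = ι (curv Ω(z) - curv Ω_∞) v`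
(`b_Dal_psi`), `[D², a] = [b, Dα] + Dα` (`curv_commutator`), and `D² = curv Ω_∞` on `ι F`. The
second formula needs the `α_X` to commute among themselves. They do, since near each pole they lie
in the commutant of a series whose leading term has distinct eigenvalues
(`commute_of_commute_jetPoly`). As the vectors `ψ` determine an endomorphism and `ψ → 0` for `z →
∞`, these identities can be read in both directions (`flat_iff`). -/

noncomputable section

namespace Isomonodromy

/-! ### Taylor series and their action on jets -/

section TaylorSeries

variable {A : Type*} [NormedRing A] [NormedAlgebra ℂ A]

/-- The Taylor series of `h` at `c`, as a formal power series. -/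
def taylorSeries (h : ℂ → A) (c : ℂ) : PowerSeries A := PowerSeries.mk (taylorCoeff h c)

@[simp] theorem coeff_taylorSeries (h : ℂ → A) (c : ℂ) (m : ℕ) :
    PowerSeries.coeff m (taylorSeries h c) = taylorCoeff h c m := PowerSeries.coeff_mk _ _

theorem taylorSeries_congr {h g : ℂ → A} {c : ℂ} (hg : h =ᶠ[𝓝 c] g) :
    taylorSeries h c = taylorSeries g c := by
  ext m
  simp only [coeff_taylorSeries, taylorCoeff]
  rw [hg.iteratedDeriv_eq]

theorem taylorSeries_const (r : A) (c : ℂ) :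
    taylorSeries (fun _ => r) c = PowerSeries.C r := by
  ext m
  simp only [coeff_taylorSeries, taylorCoeff, iteratedDeriv_const, PowerSeries.coeff_C]
  split_ifs with h
  · simp [h]
  · simp

theorem taylorSeries_id (c : ℂ) :
    taylorSeries (fun x => x • (1 : A)) c = PowerSeries.C (c • (1 : A)) + PowerSeries.X := by
  ext m
  simp only [coeff_taylorSeries, taylorCoeff, map_add, PowerSeries.coeff_C, PowerSeries.coeff_X]
  have h1 : deriv (fun x : ℂ => x • (1 : A)) = fun _ => 1 := by
    funext x
    simpa using ((hasDerivAt_id x).smul_const (1 : A)).deriv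
  rcases m with _ | _ | m
  · simp
  · simp [h1]
  · rw [iteratedDeriv_succ', h1, iteratedDeriv_const]
    simp

variable [CompleteSpace A]

theorem taylorSeries_mul {h g : ℂ → A} {c : ℂ} (hh : AnalyticAt ℂ h c) (hg : AnalyticAt ℂ g c) :
    taylorSeries (fun x => h x * g x) c = taylorSeries h c * taylorSeries g c := by
  ext m
  rw [PowerSeries.coeff_mul, Finset.Nat.sum_antidiagonal_eq_sum_range_succ_mk]
  simp only [coeff_taylorSeries, taylorCoeff]
  rw [iteratedDeriv_fun_mul hh.contDiffAt hg.contDiffAt, Finset.smul_sum]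
  refine Finset.sum_congr rfl fun i hi => ?_
  have hi' : i ≤ m := Nat.lt_succ_iff.1 (Finset.mem_range.1 hi)
  rw [smul_mul_smul_comm, ← nsmul_eq_mul, smul_mul_assoc, ← Nat.cast_smul_eq_nsmul ℂ, smul_smul]
  congr 1
  rw [Nat.cast_choose ℂ hi']
  have h1 : (m.factorial : ℂ) ≠ 0 := by exact_mod_cast m.factorial_ne_zero
  field_simp

theorem taylorSeries_add {h g : ℂ → A} {c : ℂ} (hh : AnalyticAt ℂ h c) (hg : AnalyticAt ℂ g c) :
    taylorSeries (fun x => h x + g x) c = taylorSeries h c + taylorSeries g c := by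
  ext m
  simp only [coeff_taylorSeries, taylorCoeff, map_add]
  rw [iteratedDeriv_fun_add hh.contDiffAt hg.contDiffAt, smul_add]

end TaylorSeries

/-! ### Power series acting on truncated jets. -/

section JetAct

variable {p : ℕ} (k : Fin p → ℕ) {F : Type*} [NormedAddCommGroup F]

/-- The coefficients of a jet, extended by zero to all degrees. -/
def jetExt (u : Jet k F) (i : Fin p) (m : ℕ) : F := if h : m < k i then u i ⟨m, h⟩ else 0

theorem jet_ext {u v : Jet k F} (h : ∀ i m, m < k i → jetExt k u i m = jetExt k v i m) :
    u = v := by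
  ext i m
  simpa [jetExt] using h i m m.2

variable [NormedSpace ℂ F]

/-- The action on jets of a family of power series, one for every pole. -/
def jetActFun (H : Fin p → PowerSeries (F →L[ℂ] F)) : Jet k F →L[ℂ] Jet k F :=
  ContinuousLinearMap.pi fun i => ContinuousLinearMap.pi fun m =>
    ∑ j : Fin (k i), if j ≤ m then
      (PowerSeries.coeff ((m : ℕ) - (j : ℕ)) (H i)).comp (jetProj k i j) else 0

theorem jetExt_jetActFun (H : Fin p → PowerSeries (F →L[ℂ] F)) (u : Jet k F) (i : Fin p) {m : ℕ}
    (hm : m < k i) : jetExt k (jetActFun k H u) i m =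
      ∑ x ∈ Finset.HasAntidiagonal.antidiagonal m,
        PowerSeries.coeff x.1 (H i) (jetExt k u i x.2) := by
  have h1 : jetExt k (jetActFun k H u) i m = ∑ j : Fin (k i),
      if (j : ℕ) ≤ m then PowerSeries.coeff (m - j) (H i) (jetExt k u i j) else 0 := by
    rw [jetExt, dif_pos hm]
    simp only [jetActFun, ContinuousLinearMap.coe_pi', _root_.sum_apply]
    refine Finset.sum_congr rfl fun j _ => ?_
    by_cases h : (j : ℕ) ≤ m
    · rw [if_pos h, if_pos (by exact h)]
      simp [jetExt, jetProj]
    · rw [if_neg h, if_neg (by exact h)]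
      rfl
  rw [h1, Fin.sum_univ_eq_sum_range
      (fun j => if j ≤ m then PowerSeries.coeff (m - j) (H i) (jetExt k u i j) else 0),
    ← Finset.Nat.sum_antidiagonal_swap, Finset.Nat.sum_antidiagonal_eq_sum_range_succ_mk,
    ← Finset.sum_filter]
  refine Finset.sum_congr ?_ fun j _ => rfl
  ext j
  simp only [Finset.mem_filter, Finset.mem_range]
  omega

/-- Convolution is associative, and truncation does no harm: the coefficient of degree `m` of a
product only involves coefficients of degree at most `m` of the jet. -/
theorem jetActFun_mul (H H' : Fin p → PowerSeries (F →L[ℂ] F)) :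
    jetActFun k (H * H') = jetActFun k H * jetActFun k H' := by
  refine ContinuousLinearMap.ext fun u => jet_ext k fun i m hm => ?_
  rw [mul_apply_eq_comp, jetExt_jetActFun k _ _ _ hm, jetExt_jetActFun k _ _ _ hm]
  have h : ∀ x ∈ Finset.HasAntidiagonal.antidiagonal m, PowerSeries.coeff x.1 (H i)
      (jetExt k (jetActFun k H' u) i x.2) =
        ∑ y ∈ Finset.HasAntidiagonal.antidiagonal x.2, PowerSeries.coeff x.1 (H i)
          (PowerSeries.coeff y.1 (H' i) (jetExt k u i y.2)) := by
    intro x hx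
    rw [jetExt_jetActFun k _ _ _ (lt_of_le_of_lt (Finset.HasAntidiagonal.antidiagonal.snd_le hx) hm), map_sum]
  rw [Finset.sum_congr rfl h]
  simp only [Pi.mul_apply, PowerSeries.coeff_mul, _root_.sum_apply, mul_apply_eq_comp,
    Finset.sum_sigma']
  apply Finset.sum_nbij' (fun ⟨⟨_i, j⟩, ⟨k, l⟩⟩ ↦ ⟨(k, l + j), (l, j)⟩)
    (fun ⟨⟨i, _j⟩, ⟨k, l⟩⟩ ↦ ⟨(i + k, l), (i, k)⟩) <;>
    (rintro ⟨⟨a, b⟩, ⟨c, d⟩⟩ h; simp at h ⊢) <;> grind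

variable (F) in
/-- The action on jets of families of power series, as a homomorphism of algebras. -/
def jetAct : (Fin p → PowerSeries (F →L[ℂ] F)) →ₐ[ℂ] (Jet k F →L[ℂ] Jet k F) :=
  AlgHom.ofLinearMap
    { toFun := jetActFun k
      map_add' := fun H H' => by
        refine ContinuousLinearMap.ext fun u => jet_ext k fun i m hm => ?_
        have : jetExt k ((jetActFun k H + jetActFun k H') u) i m =
          jetExt k (jetActFun k H u) i m + jetExt k (jetActFun k H' u) i m := by
          simp [jetExt, hm]
        rw [this]
        simp only [jetExt_jetActFun k _ _ _ hm, Pi.add_apply, map_add,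
          add_apply, Finset.sum_add_distrib]
      map_smul' := fun c H => by
        refine ContinuousLinearMap.ext fun u => jet_ext k fun i m hm => ?_
        have : jetExt k ((c • jetActFun k H) u) i m = c • jetExt k (jetActFun k H u) i m := by
          simp [jetExt, hm]
        rw [RingHom.id_apply, this]
        simp only [jetExt_jetActFun k _ _ _ hm, Pi.smul_apply, Finset.smul_sum]
        refine Finset.sum_congr rfl fun x _ => ?_
        rfl }
    (by
      refine ContinuousLinearMap.ext fun u => jet_ext k fun i m hm => ?_
      change jetExt k (jetActFun k 1 u) i m = jetExt k u i m
      rw [jetExt_jetActFun k _ _ _ hm, Finset.sum_eq_single (0, m)]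
      · simp
      · rintro ⟨a, b⟩ hx hne
        have : a ≠ 0 := by
          rintro rfl
          simp at hx
          exact hne (by rw [hx])
        simp [PowerSeries.coeff_one, this]
      · simp)
    (jetActFun_mul k)

theorem jetExt_jetAct (H : Fin p → PowerSeries (F →L[ℂ] F)) (u : Jet k F) (i : Fin p) {m : ℕ}
    (hm : m < k i) : jetExt k (jetAct k F H u) i m =
      ∑ x ∈ Finset.HasAntidiagonal.antidiagonal m,
        PowerSeries.coeff x.1 (H i) (jetExt k u i x.2) :=
  jetExt_jetActFun k H u i hm

theorem jetMul_eq_jetAct (lam : Fin p → ℂ) (h : ℂ → F →L[ℂ] F) :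
    jetMul k lam h = jetAct k F fun i => taylorSeries h (lam i) := by
  change jetMul k lam h = jetActFun k _
  simp only [jetMul, jetActFun, coeff_taylorSeries]

theorem jetAct_eq_zero {H : Fin p → PowerSeries (F →L[ℂ] F)}
    (h : ∀ i, ∀ m < k i, PowerSeries.coeff m (H i) = 0) : jetAct k F H = 0 := by
  refine ContinuousLinearMap.ext fun u => jet_ext k fun i m hm => ?_
  rw [jetExt_jetAct k _ _ _ hm, Finset.sum_eq_zero]
  · simp [jetExt]
  · intro x hx
    rw [h i x.1 (lt_of_le_of_lt (Finset.HasAntidiagonal.antidiagonal.fst_le hx) hm)]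
    rfl

theorem jetExt_jetConst (v : F) (i : Fin p) {m : ℕ} (hm : m < k i) :
    jetExt k (jetConst k v) i m = if m = 0 then v else 0 := by
  rw [jetExt, dif_pos hm]
  simp only [jetConst, ContinuousLinearMap.coe_pi']
  split_ifs <;> rfl

theorem jetExt_jetAct_jetConst (H : Fin p → PowerSeries (F →L[ℂ] F)) (v : F) (i : Fin p) {m : ℕ}
    (hm : m < k i) : jetExt k (jetAct k F H (jetConst k v)) i m = PowerSeries.coeff m (H i) v := by
  rw [jetExt_jetAct k _ _ _ hm, Finset.sum_eq_single (m, 0)]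
  · rw [jetExt_jetConst k _ _ (by omega), if_pos rfl]
  · rintro ⟨a, b⟩ hx hne
    rw [Finset.HasAntidiagonal.mem_antidiagonal] at hx
    simp only at hx ⊢
    rw [jetExt_jetConst k _ _ (by omega), if_neg, map_zero]
    rintro rfl
    exact hne (by simp [← hx])
  · simp

/-- The action on constant jets recovers the coefficients, so the action is faithful up to the order
of truncation. Identities of operators on jets thus become congruences of power series. -/
theorem coeff_eq_zero_of_jetAct_eq_zero {H : Fin p → PowerSeries (F →L[ℂ] F)}
    (h : jetAct k F H = 0) (i : Fin p) {m : ℕ} (hm : m < k i) : PowerSeries.coeff m (H i) = 0 := by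
  ext1 v
  rw [← jetExt_jetAct_jetConst k H v i hm, h]
  simp [jetExt]

end JetAct

/-! ### Multiplication operators on jets -/

section JetMul

variable {p : ℕ} (k : Fin p → ℕ) {F : Type*} [NormedAddCommGroup F] [NormedSpace ℂ F]
  (lam : Fin p → ℂ)

theorem jetMul_congr {h g : ℂ → F →L[ℂ] F} (hg : ∀ i, h =ᶠ[𝓝 (lam i)] g) :
    jetMul k lam h = jetMul k lam g := by
  simp only [jetMul_eq_jetAct, taylorSeries_congr (hg _)]

theorem jetMul_const (g : F →L[ℂ] F) : jetMul k lam (fun _ => g) = jetMap k g := by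
  rw [jetMul_eq_jetAct]
  refine ContinuousLinearMap.ext fun u => jet_ext k fun i m hm => ?_
  rw [jetExt_jetAct k _ _ _ hm, Finset.sum_eq_single (0, m)]
  · rw [taylorSeries_const]
    simp [jetExt, hm, jetMap, jetProj]
  · rintro ⟨a, b⟩ hx hne
    have : a ≠ 0 := by
      rintro rfl
      simp at hx
      exact hne (by rw [hx])
    simp [taylorSeries_const, PowerSeries.coeff_C, this]
  · simp

theorem jetMap_comp_jetConst (g : F →L[ℂ] F) :
    (jetMap k g).comp (jetConst k) = (jetConst k).comp g := by
  ext v i m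
  by_cases h : (m : ℕ) = 0 <;> simp [jetMap, jetConst, jetProj, h]

variable (F) in
/-- Multiplication of jets by the coordinate `x`. -/
def jetX : Jet k F →L[ℂ] Jet k F := jetMul k lam fun x => x • ContinuousLinearMap.id ℂ F

theorem jetX_eq_jetAct : jetX k F lam =
    jetAct k F fun i => PowerSeries.C (lam i • (1 : F →L[ℂ] F)) + PowerSeries.X := by
  rw [jetX, jetMul_eq_jetAct]
  congr 1
  funext i
  exact taylorSeries_id (A := F →L[ℂ] F) (lam i)

theorem aeval_jetX (P : Polynomial ℂ) : Polynomial.aeval (jetX k F lam) P =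
    jetAct k F fun i =>
      Polynomial.aeval (PowerSeries.C (lam i • (1 : F →L[ℂ] F)) + PowerSeries.X) P := by
  rw [jetX_eq_jetAct, Polynomial.aeval_algHom_apply]
  congr 1
  funext i
  exact (Polynomial.aeval_algHom_apply
    (Pi.evalAlgHom ℂ (fun _ : Fin p => PowerSeries (F →L[ℂ] F)) i) _ P).symm

theorem coeff_aeval_X {A : Type*} [Ring A] [Algebra ℂ A] (P : Polynomial ℂ) (m : ℕ) :
    PowerSeries.coeff m (Polynomial.aeval (PowerSeries.X : PowerSeries A) P) =
      P.coeff m • (1 : A) := by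
  induction P using Polynomial.induction_on' with
  | add p q hp hq => simp [hp, hq, add_smul]
  | monomial n c =>
    rw [Polynomial.aeval_monomial, ← Algebra.smul_def, Polynomial.coeff_monomial]
    change c • PowerSeries.coeff m (PowerSeries.X ^ n : PowerSeries A) = _
    rw [PowerSeries.coeff_X_pow]
    by_cases h : m = n <;> simp [h, eq_comm]

/-- In the local coordinate at `c` the variable is `c + X`, so substitution is the Taylor shift of
the polynomial. -/
theorem coeff_aeval_C_add_X {A : Type*} [Ring A] [Algebra ℂ A] (c : ℂ) (P : Polynomial ℂ) (m : ℕ) :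
    PowerSeries.coeff m (Polynomial.aeval
      (PowerSeries.C (c • (1 : A)) + PowerSeries.X : PowerSeries A) P) =
      (Polynomial.taylor c P).coeff m • (1 : A) := by
  rw [← coeff_aeval_X, Polynomial.taylor_apply, Polynomial.aeval_comp]
  congr 3
  simp only [map_add, Polynomial.aeval_X, Polynomial.aeval_C]
  rw [add_comm, Algebra.algebraMap_eq_smul_one, add_right_inj]
  ext n
  change _ = c • PowerSeries.coeff n (1 : PowerSeries A)
  rw [PowerSeries.coeff_C, PowerSeries.coeff_one]
  split_ifs <;> simp

theorem coeff_aeval_eq_zero_of_dvd {A : Type*} [Ring A] [Algebra ℂ A] {c : ℂ} {n : ℕ}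
    {P : Polynomial ℂ} (h : (Polynomial.X - Polynomial.C c) ^ n ∣ P) {m : ℕ} (hm : m < n) :
    PowerSeries.coeff m (Polynomial.aeval
      (PowerSeries.C (c • (1 : A)) + PowerSeries.X : PowerSeries A) P) = 0 := by
  obtain ⟨R, rfl⟩ := h
  rw [coeff_aeval_C_add_X, Polynomial.taylor_mul, Polynomial.taylor_pow]
  simp [Polynomial.coeff_X_pow_mul', Nat.not_le.2 hm]

theorem aeval_jetX_eq_zero_of_dvd {P : Polynomial ℂ}
    (h : ∀ i, (Polynomial.X - Polynomial.C (lam i)) ^ k i ∣ P) :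
    Polynomial.aeval (jetX k F lam) P = 0 := by
  rw [aeval_jetX]
  exact jetAct_eq_zero k fun i m hm => coeff_aeval_eq_zero_of_dvd (h i) hm

/-- The polynomial `q`. -/
def qPolynomial : Polynomial ℂ := ∏ i, (Polynomial.X - Polynomial.C (lam i)) ^ k i

theorem eval_qPolynomial (x : ℂ) : (qPolynomial k lam).eval x = qPoly k lam x := by
  simp [qPolynomial, qPoly, Polynomial.eval_prod]

theorem qPolynomial_monic : (qPolynomial k lam).Monic :=
  Polynomial.monic_prod_of_monic _ _ fun _ _ => (Polynomial.monic_X_sub_C _).pow _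

theorem natDegree_qPolynomial : (qPolynomial k lam).natDegree = qDeg k := by
  rw [qPolynomial, Polynomial.natDegree_prod_of_monic _ _
    fun _ _ => (Polynomial.monic_X_sub_C _).pow _]
  simp [qDeg]

theorem aeval_jetX_qPolynomial : Polynomial.aeval (jetX k F lam) (qPolynomial k lam) = 0 :=
  aeval_jetX_eq_zero_of_dvd k lam fun i => Finset.dvd_prod_of_mem _ (Finset.mem_univ i)

variable [CompleteSpace F]

theorem jetMul_mul {h g : ℂ → F →L[ℂ] F} (hh : ∀ i, AnalyticAt ℂ h (lam i))
    (hg : ∀ i, AnalyticAt ℂ g (lam i)) :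
    jetMul k lam (fun x => h x * g x) = jetMul k lam h * jetMul k lam g := by
  simp only [jetMul_eq_jetAct, ← map_mul]
  congr 1
  funext i
  exact taylorSeries_mul (hh i) (hg i)

theorem jetMul_add {h g : ℂ → F →L[ℂ] F} (hh : ∀ i, AnalyticAt ℂ h (lam i))
    (hg : ∀ i, AnalyticAt ℂ g (lam i)) :
    jetMul k lam (fun x => h x + g x) = jetMul k lam h + jetMul k lam g := by
  simp only [jetMul_eq_jetAct, ← map_add]
  congr 1
  funext i
  exact taylorSeries_add (hh i) (hg i)

theorem jetMul_polyEval {d : ℕ} (c : Fin d → F →L[ℂ] F) :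
    jetMul k lam (polyEval c) = ∑ n : Fin d, jetMap k (c n) * jetX k F lam ^ (n : ℕ) := by
  have hpow : ∀ n : ℕ, ∀ i, AnalyticAt ℂ (fun x : ℂ => x ^ n • (1 : F →L[ℂ] F)) (lam i) :=
    fun n i => (analyticAt_id.pow n).smul analyticAt_const
  have hid : ∀ i, AnalyticAt ℂ (fun x : ℂ => x • ContinuousLinearMap.id ℂ F) (lam i) :=
    fun i => analyticAt_id.smul analyticAt_const
  have h1 : ∀ n : ℕ, jetMul k lam (fun x => x ^ n • (1 : F →L[ℂ] F)) = jetX k F lam ^ n := by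
    intro n
    induction n with
    | zero =>
      simp only [pow_zero, one_smul, jetMul_const]
      rfl
    | succ n ih =>
      rw [pow_succ, ← ih, jetX, ← jetMul_mul k lam (hpow n) hid]
      congr 1
      funext x
      change _ = x ^ n • (1 : F →L[ℂ] F) * x • (1 : F →L[ℂ] F)
      rw [smul_mul_smul_comm, one_mul, pow_succ]
  have h2 : ∀ s : Finset (Fin d), jetMul k lam (fun x => ∑ n ∈ s, x ^ (n : ℕ) • c n) =
      ∑ n ∈ s, jetMap k (c n) * jetX k F lam ^ (n : ℕ) := by
    intro s
    induction s using Finset.induction_on with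
    | empty =>
      simp only [Finset.sum_empty, jetMul_const]
      rfl
    | insert n s hn ih =>
      simp only [Finset.sum_insert hn]
      rw [jetMul_add, ih, ← h1, ← jetMul_const k lam (c n), ← jetMul_mul k lam
        (fun i => analyticAt_const) (hpow n)]
      · congr 3
        funext x
        simp
      · exact fun i => (analyticAt_id.pow _).smul analyticAt_const
      · exact fun i => Finset.analyticAt_fun_sum _ fun m _ =>
          (analyticAt_id.pow _).smul analyticAt_const
  exact h2 Finset.univ

theorem analyticAt_polyEval {W : Type*} [NormedAddCommGroup W] [NormedSpace ℂ W] {d : ℕ}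
    (c : Fin d → W) (x : ℂ) : AnalyticAt ℂ (polyEval c) x :=
  Finset.analyticAt_fun_sum _ fun _ _ => (analyticAt_id.pow _).smul analyticAt_const

end JetMul

/-! ### Residues -/

section Residues

/-- Cauchy's formula for derivatives: the integral over every small circle already equals the Taylor
coefficient, so the limit defining the residue is that of an eventually constant function. -/
theorem residue_eq_taylorCoeff {W : Type*} [NormedAddCommGroup W] [NormedSpace ℂ W]
    [CompleteSpace W] {f h : ℂ → W} {c : ℂ} {n : ℕ} (hh : AnalyticAt ℂ h c)
    (hf : ∀ᶠ x in 𝓝[≠] c, f x = (1 / (x - c) ^ (n + 1)) • h x) :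
    residue f c = taylorCoeff h c n := by
  refine Filter.Tendsto.limUnder_eq (Filter.EventuallyEq.tendsto ?_)
  obtain ⟨ε, hε, h1⟩ := Metric.eventually_nhds_iff.1 hh.eventually_analyticAt
  obtain ⟨δ, hδ, h2⟩ := Metric.eventually_nhds_iff.1 (eventually_nhdsWithin_iff.1 hf)
  filter_upwards [Ioo_mem_nhdsGT (lt_min hε hδ)] with r hr
  have hr1 := lt_of_lt_of_le hr.2 (min_le_left _ _)
  have hr2 := lt_of_lt_of_le hr.2 (min_le_right _ _)
  have h3 : (∮ x in C(c, r), f x) = ∮ x in C(c, r), (1 / (x - c) ^ (n + 1)) • h x := by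
    refine circleIntegral.integral_congr hr.1.le fun x hx => ?_
    refine h2 (by rw [mem_sphere_iff_norm] at hx; rw [dist_eq_norm, hx]; exact hr2) ?_
    rintro rfl
    simp at hx
    exact hr.1.ne hx
  rw [h3, DifferentiableOn.circleIntegral_one_div_sub_center_pow_smul hr.1 n]
  · rw [smul_smul, taylorCoeff]
    congr 1
    have := Complex.two_pi_I_ne_zero
    field_simp
  · intro x hx
    exact (h1 (lt_of_le_of_lt (Metric.mem_closedBall.1 hx) hr1)).differentiableAt.differentiableWithinAt

end Residues

/-! ### The residue pairing -/

section Pairing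

variable {p : ℕ} (k : Fin p → ℕ) {F : Type*} [NormedAddCommGroup F] [NormedSpace ℂ F]
  (lam : Fin p → ℂ)

theorem jetExt_jetAct_congr {H H' : Fin p → PowerSeries (F →L[ℂ] F)} (u : Jet k F) {i : Fin p}
    (h : H i = H' i) {m : ℕ} (hm : m < k i) :
    jetExt k (jetAct k F H u) i m = jetExt k (jetAct k F H' u) i m := by
  rw [jetExt_jetAct k _ _ _ hm, jetExt_jetAct k _ _ _ hm, h]

/-- The polynomial `q / (x - λᵢ) ^ kᵢ`. -/
def qCofactor (i : Fin p) : Polynomial ℂ :=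
  ∏ j ∈ Finset.univ.erase i, (Polynomial.X - Polynomial.C (lam j)) ^ k j

theorem qCofactor_mul (i : Fin p) :
    (Polynomial.X - Polynomial.C (lam i)) ^ k i * qCofactor k lam i = qPolynomial k lam :=
  Finset.mul_prod_erase Finset.univ
    (fun j => (Polynomial.X - Polynomial.C (lam j)) ^ k j) (Finset.mem_univ i)

theorem qCofactor_monic (i : Fin p) : (qCofactor k lam i).Monic :=
  Polynomial.monic_prod_of_monic _ _ fun _ _ => (Polynomial.monic_X_sub_C _).pow _

theorem natDegree_qCofactor (i : Fin p) :
    k i + (qCofactor k lam i).natDegree = qDeg k := by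
  rw [← natDegree_qPolynomial k lam, ← qCofactor_mul k lam i,
    ((Polynomial.monic_X_sub_C (lam i)).pow _).natDegree_mul (qCofactor_monic k lam i)]
  simp

theorem eval_qCofactor_ne_zero (hlam : Function.Injective lam) (i : Fin p) :
    (qCofactor k lam i).eval (lam i) ≠ 0 := by
  rw [qCofactor, Polynomial.eval_prod, Finset.prod_ne_zero_iff]
  intro j hj
  simp only [Polynomial.eval_pow, Polynomial.eval_sub, Polynomial.eval_X, Polynomial.eval_C]
  exact pow_ne_zero _ (sub_ne_zero.2 (hlam.ne (Finset.ne_of_mem_erase hj).symm))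

theorem analyticAt_inv_qCofactor (hlam : Function.Injective lam) (i : Fin p) :
    AnalyticAt ℂ (fun x => ((qCofactor k lam i).eval x)⁻¹) (lam i) :=
  AnalyticAt.inv (AnalyticOnNhd.eval_polynomial (qCofactor k lam i) (lam i) trivial)
    (eval_qCofactor_ne_zero k lam hlam i)

theorem analyticAt_inv_qCofactor_smul (hlam : Function.Injective lam) {i : Fin p}
    {Q : ℂ → F →L[ℂ] F} (hQ : AnalyticAt ℂ Q (lam i)) :
    AnalyticAt ℂ (fun x => ((qCofactor k lam i).eval x)⁻¹ • Q x) (lam i) :=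
  (analyticAt_inv_qCofactor k lam hlam i).smul hQ

variable [CompleteSpace F]

/-- Near `λᵢ`, `1/q` is `xᵢ ^ (-kᵢ)` times the holomorphic inverse of the cofactor. The residue of
`Q u / q` is therefore the coefficient of degree `kᵢ - 1` of a product acting on the jet. -/
theorem jetResidue_apply (hlam : Function.Injective lam) {Q : ℂ → F →L[ℂ] F}
    (hQ : ∀ i, AnalyticAt ℂ Q (lam i)) (u : Jet k F) :
    jetResidue k lam (fun x => (qPoly k lam x)⁻¹ • Q x) u = ∑ i, jetExt k (jetAct k F
      (fun _ => taylorSeries (fun x => ((qCofactor k lam i).eval x)⁻¹ • Q x) (lam i)) u)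
        i (k i - 1) := by
  simp only [jetResidue, _root_.sum_apply]
  refine Finset.sum_congr rfl fun i _ => ?_
  by_cases hk : k i = 0
  · have : IsEmpty (Fin (k i)) := by rw [hk]; infer_instance
    rw [Finset.univ_eq_empty, Finset.sum_empty, jetExt, dif_neg (by omega)]
  rw [jetExt, dif_pos (by omega)]
  change _ = jetActFun k _ u i _
  simp only [jetActFun, ContinuousLinearMap.coe_pi', _root_.sum_apply]
  refine Finset.sum_congr rfl fun m _ => ?_
  have hm := m.2
  rw [if_pos (Fin.mk_le_mk.2 (by omega)), coeff_taylorSeries]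
  congr 2
  refine residue_eq_taylorCoeff (analyticAt_inv_qCofactor_smul k lam hlam (hQ i)) ?_
  filter_upwards [self_mem_nhdsWithin] with x hx
  have hx' : x - lam i ≠ 0 := sub_ne_zero.2 hx
  rw [smul_smul, smul_smul]
  congr 1
  rw [← eval_qPolynomial, ← qCofactor_mul k lam i, Polynomial.eval_mul]
  simp only [Polynomial.eval_pow, Polynomial.eval_sub, Polynomial.eval_X, Polynomial.eval_C]
  rw [mul_inv, ← mul_assoc]
  congr 1
  -- The factor `xᵢ ^ m` of the `m`-th term of the jet leaves a pole of order `kᵢ - m`, hence the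
  -- Taylor coefficient of index `kᵢ - 1 - m`.
  have h1 : (x - lam i) ^ k i = (x - lam i) ^ (m : ℕ) * (x - lam i) ^ (k i - 1 - m + 1) := by
    rw [← pow_add]
    congr 1
    omega
  rw [h1]
  field_simp

variable (F) in
/-- The functional `u ↦ ∑ᵢ (1 / 2πi) ∮ u / q dx`. -/
def jetRho : Jet k F →L[ℂ] F :=
  jetResidue k lam fun x => (qPoly k lam x)⁻¹ • (1 : F →L[ℂ] F)

theorem jetRho_apply (hlam : Function.Injective lam) (u : Jet k F) :
    jetRho k F lam u = ∑ i, jetExt k (jetAct k F (fun _ => taylorSeries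
      (fun x => ((qCofactor k lam i).eval x)⁻¹ • (1 : F →L[ℂ] F)) (lam i)) u) i (k i - 1) :=
  jetResidue_apply k lam hlam (fun _ => analyticAt_const) u

theorem jetResidue_eq_jetRho (hk : ∀ i, 0 < k i) (hlam : Function.Injective lam)
    {Q : ℂ → F →L[ℂ] F} (hQ : ∀ i, AnalyticAt ℂ Q (lam i)) :
    jetResidue k lam (fun x => (qPoly k lam x)⁻¹ • Q x) =
      (jetRho k F lam).comp (jetMul k lam Q) := by
  refine ContinuousLinearMap.ext fun u => ?_
  rw [ContinuousLinearMap.comp_apply, jetResidue_apply k lam hlam hQ, jetRho_apply k lam hlam]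
  refine Finset.sum_congr rfl fun i _ => ?_
  rw [jetMul_eq_jetAct, ← mul_apply_eq_comp, ← map_mul]
  refine jetExt_jetAct_congr k u ?_ (Nat.sub_lt (hk i) one_pos)
  rw [Pi.mul_apply, ← taylorSeries_mul
    (analyticAt_inv_qCofactor_smul k lam hlam analyticAt_const) (hQ i)]
  simp

/-- The weight `1/q` is scalar, so it commutes with constant endomorphisms. -/
theorem jetRho_comp_jetMap (hlam : Function.Injective lam) (g : F →L[ℂ] F) :
    (jetRho k F lam).comp (jetMap k g) = g.comp (jetRho k F lam) := by
  refine ContinuousLinearMap.ext fun u => ?_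
  simp only [ContinuousLinearMap.comp_apply]
  rw [jetRho_apply k lam hlam, jetRho_apply k lam hlam, map_sum]
  refine Finset.sum_congr rfl fun i _ => ?_
  by_cases hm : k i - 1 < k i
  · rw [jetExt_jetAct k _ _ _ hm, jetExt_jetAct k _ _ _ hm, map_sum]
    refine Finset.sum_congr rfl fun x _ => ?_
    have h1 : ∀ m, jetExt k (jetMap k g u) i m = g (jetExt k u i m) := by
      intro m
      simp only [jetExt]
      split_ifs
      · simp [jetMap, jetProj]
      · simp
    have h2 : taylorSeries (fun x => ((qCofactor k lam i).eval x)⁻¹ • (1 : F →L[ℂ] F)) (lam i) *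
        PowerSeries.C g = PowerSeries.C g * taylorSeries
          (fun x => ((qCofactor k lam i).eval x)⁻¹ • (1 : F →L[ℂ] F)) (lam i) := by
      have h3 := analyticAt_inv_qCofactor_smul k lam hlam (i := i)
        (analyticAt_const (v := (1 : F →L[ℂ] F)))
      rw [← taylorSeries_const g (lam i), ← taylorSeries_mul h3 analyticAt_const,
        ← taylorSeries_mul analyticAt_const h3]
      congr 1
      funext x
      simp
    rw [h1]
    have h4 := congrArg (PowerSeries.coeff x.1) h2
    rw [PowerSeries.coeff_mul_C, PowerSeries.coeff_C_mul] at h4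
    exact congrArg (fun T : F →L[ℂ] F => T (jetExt k u i x.2)) h4
  · simp [jetExt, hm]

theorem natDegree_le_pred_of_degree_lt {P : Polynomial ℂ} {n : ℕ} (hn : 0 < n)
    (hP : P.degree < n) : P.natDegree ≤ n - 1 := by
  rw [Polynomial.natDegree_le_iff_degree_le]
  by_contra h
  push Not at h
  have h0 : P ≠ 0 := by
    rintro rfl
    simp at h
  rw [Polynomial.degree_eq_natDegree h0, Nat.cast_lt] at h hP
  omega

theorem coeff_taylor_of_natDegree_le {P : Polynomial ℂ} {n : ℕ} (hP : P.natDegree ≤ n) (c : ℂ) :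
    (Polynomial.taylor c P).coeff n = P.coeff n := by
  rcases hP.eq_or_lt with rfl | h
  · rw [Polynomial.coeff_taylor_natDegree, Polynomial.coeff_natDegree]
  · rw [Polynomial.coeff_eq_zero_of_natDegree_lt h, Polynomial.coeff_eq_zero_of_natDegree_lt]
    rwa [Polynomial.natDegree_taylor]

/-- The Taylor series of `1 / (q / (x - λᵢ) ^ kᵢ)` is inverse to that of the polynomial. -/
theorem taylorSeries_inv_qCofactor_mul (hlam : Function.Injective lam) (i : Fin p) :
    taylorSeries (fun x => ((qCofactor k lam i).eval x)⁻¹ • (1 : F →L[ℂ] F)) (lam i) *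
      Polynomial.aeval (PowerSeries.C (lam i • (1 : F →L[ℂ] F)) + PowerSeries.X)
        (qCofactor k lam i) = 1 := by
  have h1 : ∀ P : Polynomial ℂ, AnalyticAt ℂ (fun x => P.eval x • (1 : F →L[ℂ] F)) (lam i) :=
    fun P => (AnalyticOnNhd.eval_polynomial P (lam i) trivial).smul analyticAt_const
  have h2 : ∀ P : Polynomial ℂ, Polynomial.aeval (PowerSeries.C (lam i • (1 : F →L[ℂ] F)) +
      PowerSeries.X) P = taylorSeries (fun x => P.eval x • (1 : F →L[ℂ] F)) (lam i) := by
    intro P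
    induction P using Polynomial.induction_on with
    | C c =>
      simp only [Polynomial.aeval_C, Polynomial.eval_C, taylorSeries_const]
      rw [Algebra.algebraMap_eq_smul_one]
      ext n : 1
      change c • PowerSeries.coeff n (1 : PowerSeries (F →L[ℂ] F)) = _
      rw [PowerSeries.coeff_C, PowerSeries.coeff_one]
      split_ifs <;> simp
    | add P Q hP hQ =>
      rw [map_add, hP, hQ, ← taylorSeries_add (h1 P) (h1 Q)]
      congr 1
      funext x
      simp [add_smul]
    | monomial n c ih =>
      rw [pow_succ, ← mul_assoc, map_mul, ih, Polynomial.aeval_X, ← taylorSeries_id,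
        ← taylorSeries_mul (h1 _) (by simpa using h1 Polynomial.X)]
      congr 1
      funext x
      simp only [Polynomial.eval_mul, Polynomial.eval_pow, Polynomial.eval_X]
      rw [smul_mul_smul_comm, mul_one, mul_assoc]
  rw [h2, ← taylorSeries_mul (analyticAt_inv_qCofactor_smul k lam hlam analyticAt_const) (h1 _),
    ← map_one (PowerSeries.C (R := F →L[ℂ] F)), ← taylorSeries_const _ (lam i)]
  refine taylorSeries_congr ?_
  have h3 : ∀ᶠ x in 𝓝 (lam i), (qCofactor k lam i).eval x ≠ 0 :=
    (qCofactor k lam i).continuous.continuousAt.eventually_ne (eval_qCofactor_ne_zero k lam hlam i)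
  filter_upwards [h3] with x hx
  rw [smul_mul_smul_comm, inv_mul_cancel₀ hx, one_smul, one_mul]

/-- The residues of `P/q` at the finite poles add up to minus the residue at infinity, which is the
coefficient of `x ^ (deg q - 1)` in `P`. The proof is algebraic, by partial fractions. -/
theorem jetRho_aeval_jetX (hk : ∀ i, 0 < k i) (hlam : Function.Injective lam)
    {P : Polynomial ℂ} (hP : P.degree < qDeg k) (v : F) :
    jetRho k F lam (Polynomial.aeval (jetX k F lam) P (jetConst k v)) =
      P.coeff (qDeg k - 1) • v := by
  classical
  obtain ⟨Q, r, hr, hPr⟩ := Polynomial.eq_quo_mul_prod_add_sum_rem_mul_prod (s := Finset.univ) P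
    (g := fun i => (Polynomial.X - Polynomial.C (lam i)) ^ k i)
    (fun i _ => (Polynomial.monic_X_sub_C _).pow _)
    (fun i _ j _ hij => (Polynomial.isCoprime_X_sub_C_of_isUnit_sub
      (sub_ne_zero.2 (hlam.ne hij)).isUnit).pow)
  change P = Q * qPolynomial k lam + ∑ i, r i * qCofactor k lam i at hPr
  have hdeg : ∀ i, (r i).degree < k i := fun i => by simpa using hr i (Finset.mem_univ i)
  have hterm : ∀ i, (r i * qCofactor k lam i).degree < qDeg k := by
    intro i
    rw [(qCofactor_monic k lam i).degree_mul, Polynomial.degree_eq_natDegree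
      (qCofactor_monic k lam i).ne_zero, ← natDegree_qCofactor k lam i, Nat.cast_add]
    exact WithBot.add_lt_add_right (WithBot.natCast_ne_bot _) (hdeg i)
  -- All the other terms have degree less than `deg q`, while a nonzero multiple of `q` does not.
  have hQ : Q = 0 := by
    by_contra hQ
    have h1 : (Q * qPolynomial k lam).degree < qDeg k := by
      rw [show Q * qPolynomial k lam = P - ∑ i, r i * qCofactor k lam i by rw [hPr]; ring]
      refine lt_of_le_of_lt (Polynomial.degree_sub_le _ _) (max_lt hP ?_)
      refine lt_of_le_of_lt (Polynomial.degree_sum_le _ _) ?_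
      rw [Finset.sup_lt_iff (WithBot.bot_lt_coe _)]
      exact fun i _ => hterm i
    rw [(qPolynomial_monic k lam).degree_mul, Polynomial.degree_eq_natDegree hQ,
      Polynomial.degree_eq_natDegree (qPolynomial_monic k lam).ne_zero,
      natDegree_qPolynomial, ← Nat.cast_add, Nat.cast_lt] at h1
    omega
  rw [hQ, zero_mul, zero_add] at hPr
  rw [jetRho_apply k lam hlam]
  have hcoeff : P.coeff (qDeg k - 1) = ∑ i, (r i).coeff (k i - 1) := by
    rw [hPr, Polynomial.finsetSum_coeff]
    refine Finset.sum_congr rfl fun i _ => ?_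
    have h1 : qDeg k - 1 = (k i - 1) + (qCofactor k lam i).natDegree := by
      have := natDegree_qCofactor k lam i
      have := hk i
      omega
    rw [h1, Polynomial.coeff_mul_add_eq_of_natDegree_le _ le_rfl,
      (qCofactor_monic k lam i).coeff_natDegree, mul_one]
    exact natDegree_le_pred_of_degree_lt (hk i) (hdeg i)
  rw [hcoeff, Finset.sum_smul]
  refine Finset.sum_congr rfl fun i _ => ?_
  rw [aeval_jetX, ← mul_apply_eq_comp, ← map_mul,
    jetExt_jetAct_jetConst k _ _ _ (Nat.sub_lt (hk i) one_pos), Pi.mul_apply]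
  set S := taylorSeries (fun x => ((qCofactor k lam i).eval x)⁻¹ • (1 : F →L[ℂ] F)) (lam i)
  set Y : PowerSeries (F →L[ℂ] F) := PowerSeries.C (lam i • (1 : F →L[ℂ] F)) + PowerSeries.X
  -- The partial fractions at the other poles are holomorphic at `λᵢ`: their numerators over `q`
  -- contain the factor `(x - λᵢ) ^ kᵢ`.
  have h1 : ∀ j ∈ Finset.univ.erase i, ∀ m < k i,
      PowerSeries.coeff m (S * Polynomial.aeval Y (r j * qCofactor k lam j)) = 0 := by
    intro j hj m hm
    rw [PowerSeries.coeff_mul, Finset.sum_eq_zero]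
    intro x hx
    rw [coeff_aeval_eq_zero_of_dvd (n := k i), mul_zero]
    · exact Dvd.dvd.mul_left (Finset.dvd_prod_of_mem
        (fun j => (Polynomial.X - Polynomial.C (lam j)) ^ k j)
        (Finset.mem_erase.2 ⟨(Finset.ne_of_mem_erase hj).symm, Finset.mem_univ i⟩)) _
    · exact lt_of_le_of_lt (Finset.HasAntidiagonal.antidiagonal.snd_le hx) hm
  have h2 : S * Polynomial.aeval Y (r i * qCofactor k lam i) = Polynomial.aeval Y (r i) := by
    rw [mul_comm (r i), map_mul, ← mul_assoc, taylorSeries_inv_qCofactor_mul k lam hlam i, one_mul]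
  rw [hPr, map_sum, Finset.mul_sum, map_sum, ← Finset.add_sum_erase _ _ (Finset.mem_univ i),
    Finset.sum_eq_zero fun j hj => h1 j hj _ (Nat.sub_lt (hk i) one_pos), add_zero, h2,
    coeff_aeval_C_add_X, coeff_taylor_of_natDegree_le
      (natDegree_le_pred_of_degree_lt (hk i) (hdeg i))]
  rfl

end Pairing

/-! ### Divided differences of polynomials at an element of an algebra -/

section DivDiff

variable {R : Type*} [Ring R] (a : R)

/-- The derivative of `a ↦ a ^ n` in the direction `K`. -/
def powDiff (K : R) (n : ℕ) : R := ∑ r ∈ Finset.range n, a ^ r * K * a ^ (n - 1 - r)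

theorem powDiff_succ (K : R) (n : ℕ) : powDiff a K (n + 1) = a * powDiff a K n + K * a ^ n := by
  rw [powDiff, Finset.sum_range_succ', powDiff, Finset.mul_sum]
  congr 1
  · refine Finset.sum_congr rfl fun r hr => ?_
    rw [pow_succ', mul_assoc, mul_assoc, mul_assoc, show n + 1 - 1 - (r + 1) = n - 1 - r by omega]
  · simp

theorem powDiff_succ' (K : R) (n : ℕ) : powDiff a K (n + 1) = powDiff a K n * a + a ^ n * K := by
  rw [powDiff, Finset.sum_range_succ, powDiff, Finset.sum_mul]
  congr 1
  · refine Finset.sum_congr rfl fun r hr => ?_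
    rw [mul_assoc (a ^ r * K), ← pow_succ,
      show n - 1 - r + 1 = n + 1 - 1 - r by have := Finset.mem_range.1 hr; omega]
  · simp

theorem mul_powDiff_sub (K : R) (n : ℕ) :
    a * powDiff a K n - powDiff a K n * a = a ^ n * K - K * a ^ n := by
  have h := (powDiff_succ a K n).symm.trans (powDiff_succ' a K n)
  rw [sub_eq_sub_iff_add_eq_add, h]
  abel

/-- The commutator with `β` is a derivation that takes `a` to `K`. -/
theorem commutator_pow {β K : R} (h : β * a - a * β = K) (n : ℕ) :
    β * a ^ n - a ^ n * β = powDiff a K n := by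
  induction n with
  | zero => simp [powDiff]
  | succ n ih =>
    rw [powDiff_succ', ← ih, ← h, pow_succ]
    noncomm_ring

theorem powDiff_add (K K' : R) (n : ℕ) : powDiff a (K + K') n = powDiff a K n + powDiff a K' n := by
  simp only [powDiff, mul_add, add_mul, Finset.sum_add_distrib]

theorem powDiff_mul_right {c : R} (hc : Commute c a) (K : R) (n : ℕ) :
    powDiff a (K * c) n = powDiff a K n * c := by
  rw [powDiff, powDiff, Finset.sum_mul]
  refine Finset.sum_congr rfl fun r _ => ?_
  rw [mul_assoc, mul_assoc, mul_assoc, mul_assoc, (hc.pow_right _).eq]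

theorem powDiff_mul_left {c : R} (hc : Commute c a) (K : R) (n : ℕ) :
    powDiff a (c * K) n = c * powDiff a K n := by
  rw [powDiff, powDiff, Finset.mul_sum]
  refine Finset.sum_congr rfl fun r _ => ?_
  rw [← mul_assoc, ← mul_assoc, ← mul_assoc, (hc.pow_right _).eq]

variable [Algebra ℂ R]

/-- The derivative of `a ↦ q(a)` in the direction `K`. -/
def polyDiff (q : Polynomial ℂ) (K : R) : R :=
  ∑ n ∈ Finset.range (q.natDegree + 1), q.coeff n • powDiff a K n

theorem aeval_eq_sum (q : Polynomial ℂ) :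
    Polynomial.aeval a q = ∑ n ∈ Finset.range (q.natDegree + 1), q.coeff n • a ^ n := by
  rw [Polynomial.aeval_eq_sum_range]

theorem mul_polyDiff_sub (q : Polynomial ℂ) (K : R) :
    a * polyDiff a q K - polyDiff a q K * a =
      Polynomial.aeval a q * K - K * Polynomial.aeval a q := by
  rw [aeval_eq_sum, polyDiff, Finset.mul_sum, Finset.sum_mul, Finset.sum_mul, Finset.mul_sum,
    ← Finset.sum_sub_distrib, ← Finset.sum_sub_distrib]
  refine Finset.sum_congr rfl fun n _ => ?_
  rw [mul_smul_comm, smul_mul_assoc, smul_mul_assoc, mul_smul_comm, ← smul_sub, ← smul_sub,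
    mul_powDiff_sub]

theorem commutator_aeval {β K : R} (h : β * a - a * β = K) (q : Polynomial ℂ) :
    β * Polynomial.aeval a q - Polynomial.aeval a q * β = polyDiff a q K := by
  rw [aeval_eq_sum, polyDiff, Finset.mul_sum, Finset.sum_mul, ← Finset.sum_sub_distrib]
  refine Finset.sum_congr rfl fun n _ => ?_
  rw [mul_smul_comm, smul_mul_assoc, ← smul_sub, commutator_pow a h]

theorem polyDiff_add (q : Polynomial ℂ) (K K' : R) :
    polyDiff a q (K + K') = polyDiff a q K + polyDiff a q K' := by
  simp only [polyDiff, powDiff_add, smul_add, Finset.sum_add_distrib]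

/-- Together with `polyDiff_mul_left`, this is linearity over the commutant of `a` on both sides. It
reduces the obstruction to the single value `polyDiff a q (ι ρ)`. -/
theorem polyDiff_mul_right {c : R} (hc : Commute c a) (q : Polynomial ℂ) (K : R) :
    polyDiff a q (K * c) = polyDiff a q K * c := by
  simp only [polyDiff, powDiff_mul_right a hc, Finset.sum_mul, smul_mul_assoc]

theorem polyDiff_mul_left {c : R} (hc : Commute c a) (q : Polynomial ℂ) (K : R) :
    polyDiff a q (c * K) = c * polyDiff a q K := by
  simp only [polyDiff, powDiff_mul_left a hc, Finset.mul_sum, mul_smul_comm]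

theorem polyDiff_of_commute {K : R} (hK : Commute K a) (q : Polynomial ℂ) :
    polyDiff a q K = Polynomial.aeval a (Polynomial.derivative q) * K := by
  have h1 : ∀ n, powDiff a (1 : R) n = (n : ℂ) • a ^ (n - 1) := by
    intro n
    rw [powDiff, Finset.sum_congr rfl (g := fun _ => a ^ (n - 1)), Finset.sum_const,
      Finset.card_range, Nat.cast_smul_eq_nsmul]
    intro r hr
    rw [mul_one, ← pow_add]
    congr 1
    have := Finset.mem_range.1 hr
    omega
  rw [← one_mul K, polyDiff_mul_right a hK, one_mul]
  congr 1
  conv_rhs => rw [q.as_sum_range]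
  simp only [polyDiff, h1, map_sum, Polynomial.derivative_monomial, Polynomial.aeval_monomial,
    ← Algebra.smul_def, smul_smul]

end DivDiff

/-! ### Cyclic endomorphisms with a residue functional -/

section Cyclic

variable {V F : Type*} [NormedAddCommGroup V] [NormedSpace ℂ V]
  [NormedAddCommGroup F] [NormedSpace ℂ F]

/-- An endomorphism `a` of `V` such that `V` is generated by the image of `ι : F → V` as a module
over `ℂ[a] = ℂ[x] / q`, with the functional `ρ` that takes the leading coefficient of
the representatives of degree less than `deg q`. -/
structure CyclicTriple (a : V →L[ℂ] V) (iota : F →L[ℂ] V) (rho : V →L[ℂ] F)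
    (q : Polynomial ℂ) : Prop where
  monic : q.Monic
  natDegree_pos : 0 < q.natDegree
  aeval_eq_zero : Polynomial.aeval a q = 0
  moment : ∀ P : Polynomial ℂ, P.degree < q.natDegree → ∀ v,
    rho (Polynomial.aeval a P (iota v)) = P.coeff (q.natDegree - 1) • v
  span : ∀ T : V →L[ℂ] V, (∀ n, (T * a ^ n).comp iota = 0) → T = 0

namespace CyclicTriple

variable {a : V →L[ℂ] V} {iota : F →L[ℂ] V} {rho : V →L[ℂ] F} {q : Polynomial ℂ}

theorem rho_pow (h : CyclicTriple a iota rho q) {n : ℕ} (hn : n < q.natDegree) (v : F) :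
    rho ((a ^ n) (iota v)) = if n + 1 = q.natDegree then v else 0 := by
  have h1 := h.moment (Polynomial.X ^ n) (by rw [Polynomial.degree_X_pow]; exact_mod_cast hn) v
  rw [map_pow, Polynomial.aeval_X, Polynomial.coeff_X_pow] at h1
  rw [h1]
  by_cases h2 : n + 1 = q.natDegree
  · rw [if_pos h2, if_pos (by omega), one_smul]
  · rw [if_neg h2, if_neg (by omega), zero_smul]

theorem iota_injective (h : CyclicTriple a iota rho q) : Function.Injective iota := by
  intro v w hvw
  have h1 : q.natDegree - 1 < q.natDegree := Nat.sub_lt h.natDegree_pos one_pos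
  have h2 := h.rho_pow h1 v
  rw [hvw, h.rho_pow h1 w, if_pos (by omega), if_pos (by omega)] at h2
  exact h2.symm

/-- An endomorphism commuting with `a` is determined by its values on the generators `ι F`. -/
theorem eq_of_commute (h : CyclicTriple a iota rho q) {T T' : V →L[ℂ] V}
    (h1 : Commute (T - T') a) (h2 : T.comp iota = T'.comp iota) : T = T' := by
  refine sub_eq_zero.1 (h.span _ fun n => ?_)
  rw [(h1.pow_right n).eq, ContinuousLinearMap.mul_def, ContinuousLinearMap.comp_assoc,
    ContinuousLinearMap.sub_comp, h2, sub_self, ContinuousLinearMap.comp_zero]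

/-- The left side commutes with `a` because `q(a) = 0`, so it suffices to test it on `ι v`. There `ρ
(a ^ m ι v)` vanishes for `m < N - 1`, and only the term `n = N`, `r = 0` survives, with coefficient
`1`. -/
theorem polyDiff_iota_rho (h : CyclicTriple a iota rho q) : polyDiff a q (iota.comp rho) = 1 := by
  refine h.eq_of_commute ?_ ?_
  · have h1 := mul_polyDiff_sub a q (iota.comp rho)
    rw [h.aeval_eq_zero, zero_mul, mul_zero, sub_zero, sub_eq_zero] at h1
    rw [Commute, SemiconjBy, sub_mul, mul_sub, h1, one_mul, mul_one]
  · ext v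
    have hN := h.natDegree_pos
    simp only [polyDiff, powDiff, ContinuousLinearMap.comp_apply, _root_.sum_apply, smul_apply,
      mul_apply_eq_comp, one_apply_eq_self]
    rw [Finset.sum_range_succ, Finset.sum_eq_zero, zero_add, h.monic.coeff_natDegree, one_smul]
    · rw [Finset.sum_eq_single 0]
      · rw [h.rho_pow (by omega), if_pos (by omega), pow_zero, one_apply_eq_self]
      · intro r hr hr0
        have := Finset.mem_range.1 hr
        rw [h.rho_pow (by omega), if_neg (by omega), map_zero, map_zero]
      · intro h0
        exact absurd (Finset.mem_range.2 hN) h0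
    · intro n hn
      have := Finset.mem_range.1 hn
      rw [Finset.sum_eq_zero, smul_zero]
      intro r hr
      have := Finset.mem_range.1 hr
      rw [h.rho_pow (by omega), if_neg (by omega), map_zero, map_zero]

/-- The identity `1 = ∑ qₙ a ^ r ι ρ a ^ (n - 1 - r)` expresses `w` through the moments `ρ (a ^ n
w)`. -/
theorem eq_zero_of_rho_pow (h : CyclicTriple a iota rho q) {w : V} (hw : ∀ n, rho ((a ^ n) w) = 0) :
    w = 0 := by
  have h1 := congrArg (fun T : V →L[ℂ] V => T w) h.polyDiff_iota_rho
  simp only [polyDiff, powDiff, ContinuousLinearMap.comp_apply, _root_.sum_apply, smul_apply,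
      mul_apply_eq_comp, one_apply_eq_self, hw, map_zero, Finset.sum_const_zero,
      smul_zero] at h1
  exact h1.symm

/-- The obstruction to the existence of an endomorphism with given commutator with `a`. -/
theorem polyDiff_commutator (h : CyclicTriple a iota rho q) {Qh al da : V →L[ℂ] V}
    (hQ : Commute Qh a) (hal : Commute al a) (hda : Commute da a)
    (hq : Polynomial.aeval a (Polynomial.derivative q) * (al - da) = 0) :
    polyDiff a q ((iota.comp rho * Qh * al - al * (iota.comp rho * Qh)) + al - da) =
      Qh * al - al * Qh := by
  have h1 : (iota.comp rho * Qh * al - al * (iota.comp rho * Qh)) + al - da =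
      iota.comp rho * (Qh * al) + (-al) * ((iota.comp rho) * Qh) + (al - da) := by
    noncomm_ring
  rw [h1, polyDiff_add, polyDiff_add, polyDiff_mul_right a (hQ.mul_left hal),
    polyDiff_mul_left a hal.neg_left, polyDiff_mul_right a hQ, h.polyDiff_iota_rho,
    polyDiff_of_commute a (hal.sub_left hda), hq]
  noncomm_ring

/-- The endomorphism with the commutator `K` with `a` and with the restriction `ι O` to `F`. -/
def extend (a : V →L[ℂ] V) (iota : F →L[ℂ] V) (rho : V →L[ℂ] F) (q : Polynomial ℂ)
    (O : F →L[ℂ] F) (K : V →L[ℂ] V) : V →L[ℂ] V :=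
  -- This is `β` multiplied on the right by the expansion of `1 = polyDiff a q (ι ρ)`, with `β a ^ r
  -- ι` replaced by the value forced on it: `a ^ r ι O` plus the commutator `[β, a ^ r] ι`.
  ∑ n ∈ Finset.range (q.natDegree + 1), q.coeff n • ∑ r ∈ Finset.range n,
    ((a ^ r).comp (iota.comp O) + (powDiff a K r).comp iota).comp (rho.comp (a ^ (n - 1 - r)))

theorem extend_comp_iota (h : CyclicTriple a iota rho q) (O : F →L[ℂ] F) (K : V →L[ℂ] V) :
    (extend a iota rho q O K).comp iota = iota.comp O := by
  ext v
  have hN := h.natDegree_pos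
  simp only [extend, ContinuousLinearMap.comp_apply, _root_.sum_apply, smul_apply]
  rw [Finset.sum_range_succ, Finset.sum_eq_zero, zero_add, h.monic.coeff_natDegree, one_smul]
  · rw [Finset.sum_eq_single 0]
    · rw [h.rho_pow (by omega), if_pos (by omega)]
      simp [powDiff]
    · intro r hr hr0
      have := Finset.mem_range.1 hr
      rw [h.rho_pow (by omega), if_neg (by omega), map_zero]
    · intro h0
      exact absurd (Finset.mem_range.2 hN) h0
  · intro n hn
    have := Finset.mem_range.1 hn
    rw [Finset.sum_eq_zero, smul_zero]
    intro r hr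
    have := Finset.mem_range.1 hr
    rw [h.rho_pow (by omega), if_neg (by omega), map_zero]

/-- With `S r` standing for the prospective `β a ^ r ι ρ`, the recursion `S (r + 1) = a S r + K a ^
r ι ρ` makes the commutator telescope to `S 0 q(a) - ∑ qₙ Sₙ + K polyDiff a q (ι ρ)`. The first term
vanishes by `q(a) = 0`, the second by this and the hypothesis on `K`, and the last is `K`. -/
theorem extend_commutator (h : CyclicTriple a iota rho q) (O : F →L[ℂ] F) {K : V →L[ℂ] V}
    (hK : polyDiff a q K = 0) :
    extend a iota rho q O K * a - a * extend a iota rho q O K = K := by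
  set S : ℕ → V →L[ℂ] V := fun r => (a ^ r).comp ((iota.comp O).comp rho) +
    powDiff a K r * (iota.comp rho) with hS
  have hSr : ∀ r, S (r + 1) = a * S r + K * (a ^ r * (iota.comp rho)) := by
    intro r
    simp only [hS, powDiff_succ, pow_succ', ← ContinuousLinearMap.mul_def]
    noncomm_ring
  have h1 : extend a iota rho q O K = ∑ n ∈ Finset.range (q.natDegree + 1), q.coeff n •
      ∑ r ∈ Finset.range n, S r * a ^ (n - 1 - r) := by
    simp only [extend, hS]
    refine Finset.sum_congr rfl fun n _ => ?_
    congr 1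
  have h2 : ∀ n, (∑ r ∈ Finset.range n, S r * a ^ (n - 1 - r)) * a -
      a * (∑ r ∈ Finset.range n, S r * a ^ (n - 1 - r)) =
        S 0 * a ^ n - S n + K * powDiff a (iota.comp rho) n := by
    intro n
    have h3 := Finset.sum_range_succ (fun r => S r * a ^ (n - r)) n
    have h4 := Finset.sum_range_succ' (fun r => S r * a ^ (n - r)) n
    have h5 : (∑ r ∈ Finset.range n, S r * a ^ (n - 1 - r)) * a =
        ∑ r ∈ Finset.range n, S r * a ^ (n - r) := by
      rw [Finset.sum_mul]
      refine Finset.sum_congr rfl fun r hr => ?_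
      rw [mul_assoc, ← pow_succ]
      have := Finset.mem_range.1 hr
      congr 2
      omega
    have h6 : a * (∑ r ∈ Finset.range n, S r * a ^ (n - 1 - r)) =
        ∑ r ∈ Finset.range n, S (r + 1) * a ^ (n - (r + 1)) - K * powDiff a (iota.comp rho) n := by
      rw [powDiff, Finset.mul_sum, Finset.mul_sum, ← Finset.sum_sub_distrib]
      refine Finset.sum_congr rfl fun r _ => ?_
      rw [hSr, show n - (r + 1) = n - 1 - r by omega]
      noncomm_ring
    rw [h5, h6, eq_sub_of_add_eq h3.symm, h4]
    simp
    abel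
  have h3 : extend a iota rho q O K * a - a * extend a iota rho q O K =
      S 0 * Polynomial.aeval a q - ∑ n ∈ Finset.range (q.natDegree + 1), q.coeff n • S n +
        K * polyDiff a q (iota.comp rho) := by
    rw [h1, aeval_eq_sum, polyDiff, Finset.sum_mul, Finset.mul_sum, Finset.mul_sum, Finset.mul_sum,
      ← Finset.sum_sub_distrib, ← Finset.sum_sub_distrib, ← Finset.sum_add_distrib]
    refine Finset.sum_congr rfl fun n _ => ?_
    rw [smul_mul_assoc, mul_smul_comm, ← smul_sub, h2, mul_smul_comm, mul_smul_comm, smul_add,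
      smul_sub]
  have h4 : ∑ n ∈ Finset.range (q.natDegree + 1), q.coeff n • S n = 0 := by
    have : ∀ n, q.coeff n • S n = (q.coeff n • a ^ n) * ((iota.comp O).comp rho) +
        (q.coeff n • powDiff a K n) * (iota.comp rho) := by
      intro n
      simp only [hS, smul_add, ← ContinuousLinearMap.mul_def, smul_mul_assoc]
    simp only [this]
    rw [Finset.sum_add_distrib, ← Finset.sum_mul, ← Finset.sum_mul, ← aeval_eq_sum]
    change _ + polyDiff a q K * _ = 0
    rw [h.aeval_eq_zero, hK]
    simp
  rw [h3, h4, h.aeval_eq_zero, h.polyDiff_iota_rho]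
  simp

end CyclicTriple

end Cyclic

namespace CyclicTriple

variable {V F : Type*} [NormedAddCommGroup V] [NormedSpace ℂ V]
  [NormedAddCommGroup F] [NormedSpace ℂ F]
variable {a : V →L[ℂ] V} {iota : F →L[ℂ] V} {rho : V →L[ℂ] F} {q : Polynomial ℂ}

/-! ### The resolvent -/

theorem mem_resolventSet (h : CyclicTriple a iota rho q) {z : ℂ} (hz : q.eval z ≠ 0) :
    z ∈ resolventSet ℂ a := by
  rcases subsingleton_or_nontrivial (V →L[ℂ] V) with hs | hs
  · exact isUnit_of_subsingleton _
  · by_contra hz'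
    have h1 := spectrum.subset_polynomial_aeval a q (Set.mem_image_of_mem (q.eval ·) hz')
    rw [h.aeval_eq_zero, spectrum.zero_eq] at h1
    exact hz h1

theorem sub_mul_resolvent (h : CyclicTriple a iota rho q) {z : ℂ} (hz : q.eval z ≠ 0) :
    (z • (1 : V →L[ℂ] V) - a) * resolvent a z = 1 := by
  rw [← Algebra.algebraMap_eq_smul_one]
  exact Ring.mul_inverse_cancel _ (h.mem_resolventSet hz)

theorem resolvent_mul_sub (h : CyclicTriple a iota rho q) {z : ℂ} (hz : q.eval z ≠ 0) :
    resolvent a z * (z • (1 : V →L[ℂ] V) - a) = 1 := by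
  rw [← Algebra.algebraMap_eq_smul_one]
  exact Ring.inverse_mul_cancel _ (h.mem_resolventSet hz)

theorem commute_resolvent {c : V →L[ℂ] V} (hc : Commute c a) (z : ℂ) :
    Commute c (resolvent a z) := by
  have h1 : Commute c (algebraMap ℂ (V →L[ℂ] V) z - a) :=
    (Algebra.commute_algebraMap_right z c).sub_right hc
  by_cases hu : IsUnit (algebraMap ℂ (V →L[ℂ] V) z - a)
  · obtain ⟨u, hu⟩ := hu
    rw [resolvent, ← hu, Ring.inverse_unit]
    exact Commute.units_inv_right (by rwa [hu])
  · rw [resolvent, Ring.inverse_non_unit _ hu]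
    exact Commute.zero_right c

/-- Division of `S` by `x - z`. For `S = q` the left side vanishes, which exhibits the resolvent as
a polynomial in `a`. -/
theorem aeval_mul_resolvent (h : CyclicTriple a iota rho q) {z : ℂ} (hz : q.eval z ≠ 0)
    (S : Polynomial ℂ) : Polynomial.aeval a S * resolvent a z =
      S.eval z • resolvent a z - Polynomial.aeval a (S /ₘ (Polynomial.X - Polynomial.C z)) := by
  have h1 : S = (Polynomial.X - Polynomial.C z) * (S /ₘ (Polynomial.X - Polynomial.C z)) +
      Polynomial.C (S.eval z) := by
    rw [← Polynomial.modByMonic_X_sub_C_eq_C_eval, add_comm]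
    exact (Polynomial.modByMonic_add_div S (Polynomial.X - Polynomial.C z)).symm
  set S1 := S /ₘ (Polynomial.X - Polynomial.C z)
  have h2 : Polynomial.aeval a S = -(Polynomial.aeval a S1 * (z • (1 : V →L[ℂ] V) - a)) +
      S.eval z • (1 : V →L[ℂ] V) := by
    conv_lhs => rw [h1]
    rw [mul_comm, map_add, map_mul, map_sub, Polynomial.aeval_X, Polynomial.aeval_C,
      Polynomial.aeval_C, Algebra.algebraMap_eq_smul_one, Algebra.algebraMap_eq_smul_one,
      ← mul_neg, neg_sub]
  rw [h2, add_mul, neg_mul, mul_assoc, h.sub_mul_resolvent hz, mul_one, smul_mul_assoc, one_mul]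
  abel

theorem rho_resolvent (h : CyclicTriple a iota rho q) {z : ℂ} (hz : q.eval z ≠ 0) (v : F) :
    rho (resolvent a z (iota v)) = (q.eval z)⁻¹ • v := by
  have h1 := congrArg (fun T : V →L[ℂ] V => rho (T (iota v))) (h.aeval_mul_resolvent hz q)
  simp only [h.aeval_eq_zero, zero_mul, zero_apply, map_zero, sub_apply,
    smul_apply, map_sub, map_smul] at h1
  have hN := h.natDegree_pos
  have hdeg : (q /ₘ (Polynomial.X - Polynomial.C z)).natDegree = q.natDegree - 1 := by
    rw [Polynomial.natDegree_divByMonic _ (Polynomial.monic_X_sub_C z),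
      Polynomial.natDegree_X_sub_C]
  have hlead : (q /ₘ (Polynomial.X - Polynomial.C z)).coeff (q.natDegree - 1) = 1 := by
    rw [← hdeg, Polynomial.coeff_natDegree, Polynomial.leadingCoeff_divByMonic_of_monic
      (Polynomial.monic_X_sub_C z), h.monic.leadingCoeff]
    rw [Polynomial.degree_X_sub_C, Polynomial.degree_eq_natDegree h.monic.ne_zero]
    exact_mod_cast hN
  rw [h.moment, hlead, one_smul, eq_comm, sub_eq_zero] at h1
  · conv_rhs => rw [← h1]
    rw [smul_smul, inv_mul_cancel₀ hz, one_smul]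
  · refine lt_of_le_of_lt Polynomial.degree_le_natDegree ?_
    rw [hdeg]
    exact_mod_cast (by omega)

/-- The result is the part of `z ^ n / q(z)` that vanishes at infinity. For `n = deg q` the value
`1` at infinity has to be removed; this is the source of the term `Ω_∞` in `b α ψ`. -/
theorem rho_pow_resolvent (h : CyclicTriple a iota rho q) {z : ℂ} (hz : q.eval z ≠ 0) {n : ℕ}
    (hn : n ≤ q.natDegree) (v : F) : rho ((a ^ n) (resolvent a z (iota v))) =
      (z ^ n * (q.eval z)⁻¹ - if n = q.natDegree then 1 else 0) • v := by
  induction n with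
  | zero =>
    rw [if_neg h.natDegree_pos.ne, pow_zero, one_apply_eq_self, h.rho_resolvent hz]
    simp
  | succ n ih =>
    have h1 : a ^ (n + 1) * resolvent a z = z • (a ^ n * resolvent a z) - a ^ n := by
      have h2 := congrArg (fun T => a ^ n * T) (h.sub_mul_resolvent hz)
      simp only [sub_mul, mul_sub, mul_one, smul_mul_assoc, one_mul, mul_smul_comm] at h2
      rw [pow_succ, mul_assoc]
      exact eq_sub_of_add_eq (sub_eq_iff_eq_add'.1 h2).symm
    have h3 := congrArg (fun T : V →L[ℂ] V => rho (T (iota v))) h1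
    simp only [mul_apply_eq_comp, sub_apply, smul_apply, map_sub, map_smul] at h3
    rw [h3, ih (by omega), if_neg (by omega), h.rho_pow (by omega), sub_zero, smul_smul, sub_smul,
      pow_succ]
    congr 1
    · congr 1
      ring
    · split_ifs <;> simp

/-- From `a G = z G - 1` for the resolvent `G`, the hypothesis gives `T a G ι = -T ι`. The left side
tends to `0` at infinity, so `T ι = 0`, and then `T a` satisfies the same hypothesis. By iteration
`T a ^ n ι = 0` for all `n`. -/
theorem eq_zero_of_resolvent (h : CyclicTriple a iota rho q) [CompleteSpace V]
    {T : V →L[ℂ] V} (hT : ∀ z, q.eval z ≠ 0 → (T * resolvent a z).comp iota = 0) : T = 0 := by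
  have hne : ∀ᶠ z in Bornology.cobounded ℂ, q.eval z ≠ 0 := by
    have h1 := Polynomial.tendsto_norm_atTop q (by
      rw [Polynomial.degree_eq_natDegree h.monic.ne_zero]
      exact_mod_cast h.natDegree_pos) (tendsto_norm_cobounded_atTop (E := ℂ))
    filter_upwards [h1.eventually_gt_atTop 0] with z hz
    exact norm_pos_iff.1 hz
  have hlim : Filter.Tendsto (resolvent a) (Bornology.cobounded ℂ) (𝓝 0) :=
    spectrum.resolvent_tendsto_cobounded a
  have key : ∀ T : V →L[ℂ] V, (∀ z, q.eval z ≠ 0 → (T * resolvent a z).comp iota = 0) →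
      T.comp iota = 0 := by
    intro T hT
    have h1 : ∀ᶠ z in Bornology.cobounded ℂ, (T * (a * resolvent a z)).comp iota =
        - T.comp iota := by
      filter_upwards [hne] with z hz
      have h2 := h.sub_mul_resolvent hz
      rw [sub_mul, smul_mul_assoc, one_mul] at h2
      have h3 : a * resolvent a z = z • resolvent a z - 1 := by rw [← h2]; abel
      rw [h3, mul_sub, mul_smul_comm, mul_one, ContinuousLinearMap.sub_comp,
        ContinuousLinearMap.smul_comp, hT z hz, smul_zero, zero_sub]
    have h4 : Filter.Tendsto (fun z => (T * (a * resolvent a z)).comp iota)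
        (Bornology.cobounded ℂ) (𝓝 ((T * (a * 0)).comp iota)) := by
      have hc : Continuous fun g : V →L[ℂ] V => (T * (a * g)).comp iota := by fun_prop
      exact (hc.tendsto 0).comp hlim
    have h5 := tendsto_nhds_unique (h4.congr' h1) tendsto_const_nhds
    rw [mul_zero, mul_zero, ContinuousLinearMap.zero_comp, eq_comm, neg_eq_zero] at h5
    exact h5
  have hstep : ∀ n, ∀ z, q.eval z ≠ 0 → (T * a ^ n * resolvent a z).comp iota = 0 := by
    intro n
    induction n with
    | zero => simpa using hT
    | succ n ih =>
      intro z hz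
      have h2 := h.sub_mul_resolvent hz
      rw [sub_mul, smul_mul_assoc, one_mul] at h2
      have h3 : a * resolvent a z = z • resolvent a z - 1 := by rw [← h2]; abel
      rw [pow_succ, mul_assoc, mul_assoc, h3, mul_sub, mul_smul_comm, mul_sub, mul_smul_comm,
        ← mul_assoc, mul_one, ContinuousLinearMap.sub_comp,
        ContinuousLinearMap.smul_comp, ih z hz, key _ ih, smul_zero, sub_zero]
  exact h.span T fun n => key _ (hstep n)

end CyclicTriple

/-! ### Endomorphisms with distinct eigenvalues -/

section SimpleSpectrum

variable {F : Type*} [NormedAddCommGroup F] [NormedSpace ℂ F]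

theorem aeval_apply_of_eigenvector {Q : F →L[ℂ] F} {mu : ℂ} {v : F} (hv : Q v = mu • v)
    (f : Polynomial ℂ) : Polynomial.aeval Q f v = f.eval mu • v := by
  induction f using Polynomial.induction_on with
  | C c => simp [Algebra.algebraMap_eq_smul_one]
  | add f g hf hg => simp [hf, hg, add_smul]
  | monomial n c ih =>
    rw [pow_succ', ← mul_assoc, mul_comm _ Polynomial.X, mul_assoc, map_mul, Polynomial.aeval_X,
      mul_apply_eq_comp, ih, map_smul, hv, smul_smul, Polynomial.eval_mul (p := Polynomial.X),
      Polynomial.eval_X, mul_comm mu]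

variable [FiniteDimensional ℂ F]

/-- The endomorphisms that commute with an endomorphism with distinct eigenvalues are
the polynomials in it. -/
theorem exists_eq_aeval_of_commute {Q S : F →L[ℂ] F}
    (hQ : (LinearMap.charpoly Q.toLinearMap).roots.Nodup) (hS : Commute S Q) :
    ∃ f : Polynomial ℂ, S = Polynomial.aeval Q f := by
  classical
  set s := (LinearMap.charpoly Q.toLinearMap).roots.toFinset with hs
  have hcard : Fintype.card s = Module.finrank ℂ F := by
    rw [Fintype.card_coe, hs, Multiset.toFinset_card_of_nodup hQ, IsAlgClosed.card_roots_eq_natDegree,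
      LinearMap.charpoly_natDegree]
  have hev : ∀ mu : s, ∃ v, Module.End.HasEigenvector Q.toLinearMap (mu : ℂ) v := by
    intro mu
    refine Module.End.HasEigenvalue.exists_hasEigenvector ?_
    rw [Module.End.hasEigenvalue_iff_isRoot_charpoly]
    exact Polynomial.isRoot_of_mem_roots (Multiset.mem_toFinset.1 mu.2)
  choose v hv using hev
  have hli := Module.End.eigenvectors_linearIndependent' Q.toLinearMap
    (fun mu : s => (mu : ℂ)) Subtype.val_injective v hv
  let B := Module.Basis.mk hli (hli.span_eq_top_of_card_eq_finrank' hcard).ge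
  have hB : ∀ mu, B mu = v mu := fun mu => Module.Basis.mk_apply _ _ mu
  have hQv : ∀ mu, Q (v mu) = (mu : ℂ) • v mu := fun mu => (hv mu).apply_eq_smul
  have hSv : ∀ mu, S (v mu) = B.repr (S (v mu)) mu • v mu := by
    intro mu
    have h1 : Q (S (v mu)) = (mu : ℂ) • S (v mu) := by
      rw [← mul_apply_eq_comp, ← hS.eq, mul_apply_eq_comp, hQv, map_smul]
    have h2 : ∀ nu, nu ≠ mu → B.repr (S (v mu)) nu = 0 := by
      intro nu hne
      have h3 : ∀ w, B.repr (Q w) nu = (nu : ℂ) * B.repr w nu := by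
        intro w
        have h4 : (B.coord nu).comp Q.toLinearMap = (nu : ℂ) • B.coord nu := by
          refine B.ext fun xi => ?_
          simp only [LinearMap.comp_apply, ContinuousLinearMap.coe_coe, hB, hQv, LinearMap.smul_apply]
          rw [map_smul, ← hB]
          simp only [Module.Basis.coord_apply, Module.Basis.repr_self, smul_eq_mul]
          by_cases h : xi = nu
          · rw [h]
          · simp [Finsupp.single_eq_of_ne (Ne.symm h)]
        simpa using congrArg (fun l => l w) h4
      have h5 := h3 (S (v mu))
      rw [h1, map_smul, Finsupp.smul_apply, smul_eq_mul, ← sub_eq_zero, ← sub_mul] at h5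
      rcases mul_eq_zero.1 h5 with h6 | h6
      · exact absurd (Subtype.ext (sub_eq_zero.1 h6)).symm hne
      · exact h6
    conv_lhs => rw [← B.sum_repr (S (v mu))]
    rw [Finset.sum_eq_single mu, hB]
    · intro nu _ hne
      rw [h2 nu hne, zero_smul]
    · intro h
      exact absurd (Finset.mem_univ _) h
  -- `S` is diagonal in the eigenbasis of `Q`; the polynomial interpolates its diagonal entries at
  -- the distinct eigenvalues.
  refine ⟨Lagrange.interpolate Finset.univ (fun mu : s => (mu : ℂ))
    (fun mu => B.repr (S (v mu)) mu), ?_⟩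
  refine ContinuousLinearMap.coe_injective (B.ext fun mu => ?_)
  rw [hB, ContinuousLinearMap.coe_coe, ContinuousLinearMap.coe_coe,
    aeval_apply_of_eigenvector (hQv mu), hSv mu]
  congr 1
  exact (Lagrange.eval_interpolate_at_node (fun mu => B.repr (S (v mu)) mu)
    Subtype.val_injective.injOn (Finset.mem_univ mu)).symm

theorem isUnit_of_zero_notMem_roots {Q : F →L[ℂ] F}
    (hQ : 0 ∉ (LinearMap.charpoly Q.toLinearMap).roots) : IsUnit Q := by
  have : CompleteSpace F := FiniteDimensional.complete ℂ F
  rw [ContinuousLinearMap.isUnit_iff_bijective]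
  have h1 : Function.Injective Q.toLinearMap := by
    rw [← LinearMap.ker_eq_bot, ← not_not (a := _ = ⊥)]
    intro h
    obtain ⟨v, hv, hv0⟩ := (Submodule.ne_bot_iff _).1 h
    refine hQ ((Polynomial.mem_roots (LinearMap.charpoly_monic _).ne_zero).2 ?_)
    rw [← Module.End.hasEigenvalue_iff_isRoot_charpoly]
    refine Module.End.hasEigenvalue_of_hasEigenvector (x := v) ⟨?_, hv0⟩
    rw [Module.End.mem_eigenspace_iff, zero_smul]
    exact hv
  exact ⟨h1, LinearMap.injective_iff_surjective.1 h1⟩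

end SimpleSpectrum

/-! ### Power series that commute with a series with distinct leading eigenvalues -/

section CommutingSeries

variable {A : Type*} [Ring A]

theorem coeff_mul_eq_zero_of_left {D B : PowerSeries A} {n : ℕ}
    (hD : ∀ m < n, PowerSeries.coeff m D = 0) : ∀ m < n, PowerSeries.coeff m (D * B) = 0 := by
  intro m hm
  rw [PowerSeries.coeff_mul, Finset.sum_eq_zero]
  intro x hx
  rw [hD _ (lt_of_le_of_lt (Finset.HasAntidiagonal.antidiagonal.fst_le hx) hm), zero_mul]

theorem coeff_mul_eq_zero_of_right {D B : PowerSeries A} {n : ℕ}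
    (hD : ∀ m < n, PowerSeries.coeff m D = 0) : ∀ m < n, PowerSeries.coeff m (B * D) = 0 := by
  intro m hm
  rw [PowerSeries.coeff_mul, Finset.sum_eq_zero]
  intro x hx
  rw [hD _ (lt_of_le_of_lt (Finset.HasAntidiagonal.antidiagonal.snd_le hx) hm), mul_zero]

theorem coeff_mul_of_left {D B : PowerSeries A} {n : ℕ}
    (hD : ∀ m < n, PowerSeries.coeff m D = 0) :
    PowerSeries.coeff n (D * B) = PowerSeries.coeff n D * PowerSeries.coeff 0 B := by
  rw [PowerSeries.coeff_mul, Finset.sum_eq_single (n, 0)]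
  · rintro ⟨i, j⟩ hx hne
    rw [Finset.HasAntidiagonal.mem_antidiagonal] at hx
    rw [hD i, zero_mul]
    refine lt_of_le_of_ne (by simp only at hx; omega) ?_
    rintro rfl
    simp at hx
    exact hne (by rw [hx])
  · simp

theorem coeff_mul_of_right {D B : PowerSeries A} {n : ℕ}
    (hD : ∀ m < n, PowerSeries.coeff m D = 0) :
    PowerSeries.coeff n (B * D) = PowerSeries.coeff 0 B * PowerSeries.coeff n D := by
  rw [PowerSeries.coeff_mul, Finset.sum_eq_single (0, n)]
  · rintro ⟨i, j⟩ hx hne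
    rw [Finset.HasAntidiagonal.mem_antidiagonal] at hx
    rw [hD j, mul_zero]
    refine lt_of_le_of_ne (by simp only at hx; omega) ?_
    rintro rfl
    simp at hx
    exact hne (by rw [hx])
  · simp

variable [Algebra ℂ A]

theorem commute_aeval {R : Type*} [Ring R] [Algebra ℂ R] {B Q : R} (h : Commute B Q)
    (f : Polynomial ℂ) : Commute B (Polynomial.aeval Q f) := by
  rw [aeval_eq_sum]
  exact Commute.sum_right _ _ _ fun n _ => (h.pow_right n).smul_right _

theorem coeff_zero_aeval (Q : PowerSeries A) (f : Polynomial ℂ) :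
    PowerSeries.coeff 0 (Polynomial.aeval Q f) =
      Polynomial.aeval (PowerSeries.coeff 0 Q) f := by
  simp only [PowerSeries.coeff_zero_eq_constantCoeff_apply]
  induction f using Polynomial.induction_on with
  | C c =>
    rw [Polynomial.aeval_C, Polynomial.aeval_C, Algebra.algebraMap_eq_smul_one,
      Algebra.algebraMap_eq_smul_one, ← PowerSeries.coeff_zero_eq_constantCoeff_apply]
    change c • PowerSeries.coeff 0 (1 : PowerSeries A) = _
    rw [PowerSeries.coeff_zero_one]
  | add f g hf hg => simp only [map_add, hf, hg]
  | monomial n c ih =>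
    rw [pow_succ, ← mul_assoc, map_mul, map_mul, ih, Polynomial.aeval_X, map_mul _ _ Polynomial.X,
      Polynomial.aeval_X]

/-- `H` is corrected order by order: if `H - P` starts in degree `m`, its leading coefficient
commutes with that of `Q`, hence equals `f(Q₀)` for a polynomial `f`, and `X ^ m f(Q)` is added to
`P`. The result commutes with everything that commutes with `Q`. -/
theorem exists_approx_of_commute {Q H : PowerSeries A} {n : ℕ}
    (hQ : ∀ S, Commute S (PowerSeries.coeff 0 Q) →
      ∃ f : Polynomial ℂ, S = Polynomial.aeval (PowerSeries.coeff 0 Q) f)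
    (hH : ∀ m < n, PowerSeries.coeff m (H * Q - Q * H) = 0) :
    ∀ m ≤ n, ∃ P : PowerSeries A, (∀ B, Commute B Q → Commute B P) ∧
      ∀ j < m, PowerSeries.coeff j (H - P) = 0 := by
  intro m
  induction m with
  | zero => exact fun _ => ⟨0, fun B _ => Commute.zero_right B, fun j hj => absurd hj (by omega)⟩
  | succ m ih =>
    intro hm
    obtain ⟨P, hP, hPm⟩ := ih (by omega)
    have h1 : (H - P) * Q - Q * (H - P) = H * Q - Q * H := by
      have := (hP Q (Commute.refl Q)).eq
      rw [sub_mul, mul_sub, this]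
      abel
    have h2 := hH m (by omega)
    rw [← h1, map_sub, coeff_mul_of_left hPm, coeff_mul_of_right hPm, sub_eq_zero] at h2
    obtain ⟨f, hf⟩ := hQ _ h2
    refine ⟨P + PowerSeries.X ^ m * Polynomial.aeval Q f, fun B hB => ?_, fun j hj => ?_⟩
    · refine (hP B hB).add_right ((PowerSeries.commute_X_pow B m).mul_right ?_)
      exact commute_aeval hB f
    · rw [← sub_sub, map_sub, PowerSeries.coeff_X_pow_mul']
      rcases Nat.lt_succ_iff_lt_or_eq.1 hj with h | rfl
      · rw [hPm j h, if_neg (by omega), sub_zero]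
      · rw [if_pos le_rfl, Nat.sub_self, hf, coeff_zero_aeval, sub_self]

/-- Both series agree up to order `n` with elements of the bicommutant of `Q`, and these two
approximations commute exactly. -/
theorem coeff_commutator_eq_zero {Q H H' : PowerSeries A} {n : ℕ}
    (hQ : ∀ S, Commute S (PowerSeries.coeff 0 Q) →
      ∃ f : Polynomial ℂ, S = Polynomial.aeval (PowerSeries.coeff 0 Q) f)
    (hH : ∀ m < n, PowerSeries.coeff m (H * Q - Q * H) = 0)
    (hH' : ∀ m < n, PowerSeries.coeff m (H' * Q - Q * H') = 0) :
    ∀ m < n, PowerSeries.coeff m (H * H' - H' * H) = 0 := by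
  obtain ⟨P, hP, hPn⟩ := exists_approx_of_commute hQ hH n le_rfl
  obtain ⟨P', hP', hPn'⟩ := exists_approx_of_commute hQ hH' n le_rfl
  intro m hm
  have h1 : P * P' = P' * P := (hP' P (hP Q (Commute.refl Q)).symm).eq
  have h2 : H * H' - H' * H = (H - P) * H' + P * (H' - P') - (H' - P') * H - P' * (H - P) := by
    rw [sub_mul, mul_sub, sub_mul, mul_sub, h1]
    abel
  rw [h2, map_sub, map_sub, map_add, coeff_mul_eq_zero_of_left hPn m hm,
    coeff_mul_eq_zero_of_right hPn' m hm, coeff_mul_eq_zero_of_left hPn' m hm,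
    coeff_mul_eq_zero_of_right hPn m hm]
  simp

end CommutingSeries

/-! ### Jets as a module over the polynomials, and the multiplication operators. -/

section JetCyclic

variable {p : ℕ} {k : Fin p → ℕ} {F : Type*} [NormedAddCommGroup F] [NormedSpace ℂ F]
  {lam : Fin p → ℂ}

theorem qDeg_pos (hp : 0 < p) (hk : ∀ i, 0 < k i) : 0 < qDeg k :=
  Finset.sum_pos (fun i _ => hk i) ⟨⟨0, hp⟩, Finset.mem_univ _⟩

theorem commute_jetMap_jetX (g : F →L[ℂ] F) : Commute (jetMap k g) (jetX k F lam) := by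
  have h1 : jetMap k g = jetAct k F fun _ => PowerSeries.C g := by
    rw [← jetMul_const k 0 g, jetMul_eq_jetAct]
    simp only [taylorSeries_const]
  rw [h1, jetX_eq_jetAct, Commute, SemiconjBy, ← map_mul, ← map_mul]
  congr 1
  funext i
  simp only [Pi.mul_apply, mul_add, add_mul, ← map_mul, (PowerSeries.commute_X _).eq]
  simp

theorem commute_jetAct_jetX (H : Fin p → PowerSeries (F →L[ℂ] F)) :
    Commute (jetAct k F H) (jetX k F lam) := by
  rw [jetX_eq_jetAct, Commute, SemiconjBy, ← map_mul, ← map_mul]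
  congr 1
  funext i
  simp only [Pi.mul_apply, mul_add, add_mul, (PowerSeries.commute_X _).eq]
  congr 1
  ext n v
  simp [PowerSeries.coeff_mul_C, PowerSeries.coeff_C_mul]

theorem commute_jetMul_jetX (h : ℂ → F →L[ℂ] F) : Commute (jetMul k lam h) (jetX k F lam) := by
  rw [jetMul_eq_jetAct]
  exact commute_jetAct_jetX _

variable (k F) in
/-- Multiplication of the `i`-th component of a jet by the number `c i`. -/
def jetDiag (c : Fin p → ℂ) : Jet k F →L[ℂ] Jet k F :=
  jetAct k F fun i => PowerSeries.C (c i • (1 : F →L[ℂ] F))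

theorem commute_jetAct_jetDiag (H : Fin p → PowerSeries (F →L[ℂ] F)) (c : Fin p → ℂ) :
    Commute (jetAct k F H) (jetDiag k F c) := by
  rw [jetDiag, Commute, SemiconjBy, ← map_mul, ← map_mul]
  congr 1
  funext i
  ext n v
  simp [PowerSeries.coeff_mul_C, PowerSeries.coeff_C_mul]

theorem commute_jetMul_jetDiag (h : ℂ → F →L[ℂ] F) (c : Fin p → ℂ) :
    Commute (jetMul k lam h) (jetDiag k F c) := by
  rw [jetMul_eq_jetAct]
  exact commute_jetAct_jetDiag _ c

theorem commute_jetDiag_jetX (c : Fin p → ℂ) : Commute (jetDiag k F c) (jetX k F lam) :=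
  commute_jetAct_jetX _

theorem jetX_eq_add : jetX k F lam = jetX k F 0 + jetDiag k F lam := by
  rw [jetX_eq_jetAct, jetX_eq_jetAct, jetDiag, ← map_add]
  congr 1
  funext i
  simp only [Pi.zero_apply, zero_smul, map_zero, zero_add, Pi.add_apply]
  rw [add_comm]

theorem jetDiag_eq_sum (c : Fin p → ℂ) :
    jetDiag k F c = ∑ i, c i • jetDiag k F (Pi.single i 1) := by
  simp only [jetDiag, ← map_smul, ← map_sum]
  congr 1
  funext i
  rw [Finset.sum_apply, Finset.sum_eq_single i]
  · simp only [Pi.smul_apply, Pi.single_eq_same, one_smul]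
    ext n : 1
    change _ = c i • PowerSeries.coeff n (PowerSeries.C (1 : F →L[ℂ] F))
    rw [PowerSeries.coeff_C, PowerSeries.coeff_C]
    split_ifs <;> simp
  · intro j _ hj
    simp [Pi.single_eq_of_ne (Ne.symm hj)]
  · simp

/-- At `λᵢ` the derivative `q'` vanishes to order `kᵢ - 1` and `H i` to order at least one, so the
product is zero modulo `xᵢ ^ kᵢ`. -/
theorem aeval_derivative_mul_jetAct {H : Fin p → PowerSeries (F →L[ℂ] F)}
    (h : ∀ i, PowerSeries.coeff 0 (H i) = 0) :
    Polynomial.aeval (jetX k F lam) (Polynomial.derivative (qPolynomial k lam)) *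
      jetAct k F H = 0 := by
  rw [aeval_jetX, ← map_mul]
  refine jetAct_eq_zero k fun i m hm => ?_
  rw [Pi.mul_apply, PowerSeries.coeff_mul, Finset.sum_eq_zero]
  rintro ⟨r, s⟩ hx
  rw [Finset.HasAntidiagonal.mem_antidiagonal] at hx
  simp only at hx ⊢
  rcases Nat.eq_zero_or_pos s with rfl | hs
  · rw [h i, mul_zero]
  · rw [coeff_aeval_eq_zero_of_dvd (n := k i - 1), zero_mul]
    · exact Polynomial.pow_sub_one_dvd_derivative_of_pow_dvd
        (Finset.dvd_prod_of_mem _ (Finset.mem_univ i))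
    · omega

/-! ### Multiplication by `Q` and `R` -/

theorem finrank_jet [FiniteDimensional ℂ F] :
    Module.finrank ℂ (Jet k F) = qDeg k * Module.finrank ℂ F := by
  rw [Module.finrank_pi_fintype]
  rw [qDeg, Finset.sum_mul]
  refine Finset.sum_congr rfl fun i _ => ?_
  rw [Module.finrank_pi_fintype]
  simp

/-- The compatibility of `R` and `Q` at the poles says that `Q⁻¹ R` has the scalar value `dλᵢ` at
`λᵢ`. -/
theorem aeval_derivative_mul_alpha {d e : ℕ} {Qc : Fin d → F →L[ℂ] F} {Rc : Fin e → F →L[ℂ] F}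
    (hQ : ∀ i, IsUnit (polyEval Qc (lam i))) {dlam : Fin p → ℂ}
    (hR : ∀ i, polyEval Rc (lam i) = dlam i • polyEval Qc (lam i)) :
    Polynomial.aeval (jetX k F lam) (Polynomial.derivative (qPolynomial k lam)) *
      (jetMul k lam (fun x => Ring.inverse (polyEval Qc x) * polyEval Rc x) -
        jetDiag k F dlam) = 0 := by
  rw [jetMul_eq_jetAct, jetDiag, ← map_sub]
  refine aeval_derivative_mul_jetAct fun i => ?_
  rw [Pi.sub_apply, map_sub, coeff_taylorSeries, taylorCoeff, iteratedDeriv_zero, hR, mul_smul_comm]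
  simp [Ring.inverse_mul_cancel _ (hQ i)]

variable [CompleteSpace F]

/-- The multiplication of jets by the endomorphism-valued polynomial with coefficients `c`. -/
def jetPoly (lam : Fin p → ℂ) {d : ℕ} (c : Fin d → F →L[ℂ] F) : Jet k F →L[ℂ] Jet k F :=
  ∑ n : Fin d, jetMap k (c n) * jetX k F lam ^ (n : ℕ)

theorem jetMul_polyEval_eq {d : ℕ} (c : Fin d → F →L[ℂ] F) :
    jetMul k lam (polyEval c) = jetPoly lam c := jetMul_polyEval k lam c

theorem analyticAt_inverse_polyEval {d : ℕ} {Qc : Fin d → F →L[ℂ] F} {x : ℂ}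
    (hQ : IsUnit (polyEval Qc x)) : AnalyticAt ℂ (fun x => Ring.inverse (polyEval Qc x)) x := by
  obtain ⟨u, hu⟩ := hQ
  have h1 : AnalyticAt ℂ Ring.inverse (polyEval Qc x) := hu ▸ analyticAt_inverse u
  exact h1.comp (analyticAt_polyEval Qc x)

theorem eventually_isUnit_polyEval {d : ℕ} {Qc : Fin d → F →L[ℂ] F} {x : ℂ}
    (hQ : IsUnit (polyEval Qc x)) : ∀ᶠ y in 𝓝 x, IsUnit (polyEval Qc y) :=
  (analyticAt_polyEval Qc x).continuousAt.eventually (Units.isOpen.mem_nhds hQ)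

theorem isUnit_jetPoly {d : ℕ} {Qc : Fin d → F →L[ℂ] F}
    (hQ : ∀ i, IsUnit (polyEval Qc (lam i))) :
    IsUnit (jetPoly (k := k) lam Qc) := by
  have h1 : jetMul k lam (fun x => Ring.inverse (polyEval Qc x) * polyEval Qc x) = 1 := by
    rw [jetMul_congr k lam (g := fun _ => 1), jetMul_const]
    · rfl
    · intro i
      filter_upwards [eventually_isUnit_polyEval (hQ i)] with y hy
      exact Ring.inverse_mul_cancel _ hy
  have h2 : jetMul k lam (fun x => polyEval Qc x * Ring.inverse (polyEval Qc x)) = 1 := by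
    rw [jetMul_congr k lam (g := fun _ => 1), jetMul_const]
    · rfl
    · intro i
      filter_upwards [eventually_isUnit_polyEval (hQ i)] with y hy
      exact Ring.mul_inverse_cancel _ hy
  rw [jetMul_mul k lam (fun i => analyticAt_inverse_polyEval (hQ i))
    (fun i => analyticAt_polyEval Qc _), jetMul_polyEval_eq] at h1
  rw [jetMul_mul k lam (fun i => analyticAt_polyEval Qc _)
    (fun i => analyticAt_inverse_polyEval (hQ i)), jetMul_polyEval_eq] at h2
  exact ⟨⟨_, _, h2, h1⟩, rfl⟩

theorem jetPoly_mul_jetMul {d e : ℕ} {Qc : Fin d → F →L[ℂ] F} (Rc : Fin e → F →L[ℂ] F)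
    (hQ : ∀ i, IsUnit (polyEval Qc (lam i))) :
    jetPoly lam Qc * jetMul k lam (fun x => Ring.inverse (polyEval Qc x) * polyEval Rc x) =
      jetPoly lam Rc := by
  have hR : ∀ i, AnalyticAt ℂ (fun x => Ring.inverse (polyEval Qc x) * polyEval Rc x) (lam i) :=
    fun i => (analyticAt_inverse_polyEval (hQ i)).mul (analyticAt_polyEval Rc _)
  rw [← jetMul_polyEval_eq Qc, ← jetMul_mul k lam (fun i => analyticAt_polyEval Qc _) hR,
    ← jetMul_polyEval_eq Rc]
  refine jetMul_congr k lam fun i => ?_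
  filter_upwards [eventually_isUnit_polyEval (hQ i)] with y hy
  rw [← mul_assoc, Ring.mul_inverse_cancel _ hy, one_mul]

variable [FiniteDimensional ℂ F]

/-- Only here are the distinct eigenvalues of `Q(λᵢ)` needed: they make the commutant of the local
series of `Q` commutative up to the order of truncation. -/
theorem commute_of_commute_jetPoly {d : ℕ} {Qc : Fin d → F →L[ℂ] F}
    (hQ : ∀ i, (LinearMap.charpoly (polyEval Qc (lam i)).toLinearMap).roots.Nodup)
    {g h : ℂ → F →L[ℂ] F} (hg : Commute (jetMul k lam g) (jetPoly lam Qc))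
    (hh : Commute (jetMul k lam h) (jetPoly lam Qc)) :
    Commute (jetMul k lam g) (jetMul k lam h) := by
  rw [← jetMul_polyEval_eq] at hg hh
  simp only [jetMul_eq_jetAct, Commute, SemiconjBy, ← map_mul] at hg hh ⊢
  rw [← sub_eq_zero, ← map_sub] at hg hh ⊢
  refine jetAct_eq_zero k fun i => ?_
  have hcoeff : PowerSeries.coeff 0 (taylorSeries (polyEval Qc) (lam i)) = polyEval Qc (lam i) := by
    simp [taylorCoeff]
  refine coeff_commutator_eq_zero (Q := taylorSeries (polyEval Qc) (lam i)) ?_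
    (fun m hm => coeff_eq_zero_of_jetAct_eq_zero k hg i hm)
    (fun m hm => coeff_eq_zero_of_jetAct_eq_zero k hh i hm)
  rw [hcoeff]
  exact fun S hS => exists_eq_aeval_of_commute (hQ i) hS

/-! ### Jets as a cyclic module over the polynomials -/

/-- Multiplication by `x` on the space of truncated jets. -/
theorem cyclicTriple_jet (hp : 0 < p) (hk : ∀ i, 0 < k i) (hlam : Function.Injective lam) :
    CyclicTriple (jetX k F lam) (jetConst k) (jetRho k F lam) (qPolynomial k lam) := by
  have hmom : ∀ P : Polynomial ℂ, P.degree < (qPolynomial k lam).natDegree → ∀ v,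
      jetRho k F lam (Polynomial.aeval (jetX k F lam) P (jetConst k v)) =
        P.coeff ((qPolynomial k lam).natDegree - 1) • v := by
    rw [natDegree_qPolynomial]
    exact fun P hP v => jetRho_aeval_jetX k lam hk hlam hP v
  have hpow : ∀ n, n < qDeg k → ∀ v,
      jetRho k F lam ((jetX k F lam ^ n) (jetConst k v)) = if n + 1 = qDeg k then v else 0 := by
    intro n hn v
    have h1 := hmom (Polynomial.X ^ n) (by
      rw [Polynomial.degree_X_pow, natDegree_qPolynomial]; exact_mod_cast hn) v
    rw [map_pow, Polynomial.aeval_X, Polynomial.coeff_X_pow, natDegree_qPolynomial] at h1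
    rw [h1]
    by_cases h2 : n + 1 = qDeg k
    · rw [if_pos h2, if_pos (by omega), one_smul]
    · rw [if_neg h2, if_neg (by omega), zero_smul]
  refine ⟨qPolynomial_monic k lam, ?_, aeval_jetX_qPolynomial k lam, hmom, ?_⟩
  · rw [natDegree_qPolynomial]
    exact qDeg_pos hp hk
  · intro T hT
    -- The map `(cₙ) ↦ ∑ x ^ n cₙ` is injective because its moments form a triangular system, and it
    -- is onto by equality of dimensions.
    let Phi : (Fin (qDeg k) → F) →ₗ[ℂ] Jet k F :=
      ∑ n : Fin (qDeg k), ((jetX k F lam ^ (n : ℕ)).comp (jetConst k)).toLinearMap ∘ₗ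
        LinearMap.proj n
    have hPhi : ∀ c, Phi c = ∑ n : Fin (qDeg k), (jetX k F lam ^ (n : ℕ)) (jetConst k (c n)) := by
      intro c
      simp only [Phi, LinearMap.coe_sum, Finset.sum_apply, LinearMap.comp_apply,
        LinearMap.proj_apply, ContinuousLinearMap.coe_coe, ContinuousLinearMap.comp_apply]
    have hinj : Function.Injective Phi := by
      rw [← LinearMap.ker_eq_bot, LinearMap.ker_eq_bot']
      intro c hc
      -- Induction from the top coefficient downwards: multiplied by `x ^ m`, the lower coefficients
      -- stay below degree `deg q - 1`, and the higher ones are already zero.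
      have key : ∀ m, ∀ n : Fin (qDeg k), (n : ℕ) + m = qDeg k - 1 → c n = 0 := by
        intro m
        induction m using Nat.strong_induction_on with
        | _ m ih =>
          intro n hn
          have h1 : jetRho k F lam ((jetX k F lam ^ m) (Phi c)) = 0 := by
            rw [hc, map_zero, map_zero]
          rw [hPhi, map_sum, map_sum, Finset.sum_eq_single n] at h1
          · rw [← mul_apply_eq_comp, ← pow_add, hpow _ (by omega), if_pos (by omega)] at h1
            exact h1
          · intro r _ hr
            have hr' : (r : ℕ) ≠ n := fun h => hr (Fin.ext h)
            rcases lt_or_gt_of_ne hr' with h | h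
            · rw [← mul_apply_eq_comp, ← pow_add, hpow _ (by omega), if_neg (by omega)]
            · rw [ih (qDeg k - 1 - r) (by omega) r (by omega)]
              simp only [map_zero]
          · intro h
            exact absurd (Finset.mem_univ n) h
      funext n
      exact key (qDeg k - 1 - n) n (by omega)
    have hsurj : Function.Surjective Phi := by
      refine (LinearMap.injective_iff_surjective_of_finrank_eq_finrank ?_).1 hinj
      rw [finrank_jet, Module.finrank_pi_fintype]
      simp
    refine ContinuousLinearMap.ext fun w => ?_
    obtain ⟨c, rfl⟩ := hsurj w
    rw [hPhi, map_sum, zero_apply]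
    exact Finset.sum_eq_zero fun n _ => congrArg (fun S : F →L[ℂ] Jet k F => S (c n)) (hT n)

end JetCyclic

/-! ### The algebra of flatness at a point -/

section Flatness

variable {V F : Type*} [NormedAddCommGroup V] [NormedSpace ℂ V]
  [NormedAddCommGroup F] [NormedSpace ℂ F]

namespace CyclicTriple

variable {a : V →L[ℂ] V} {iota : F →L[ℂ] V} {rho : V →L[ℂ] F} {q : Polynomial ℂ}

/-- A value independent of `z` must equal its limit at infinity, where the resolvent tends to zero.
-/
theorem eq_zero_of_apply_resolvent (h : CyclicTriple a iota rho q) [CompleteSpace V]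
    {T : V →L[ℂ] V} {v : F} {w : V} (hT : ∀ z, q.eval z ≠ 0 → T (resolvent a z (iota v)) = w) :
    w = 0 := by
  have hne : ∀ᶠ z in Bornology.cobounded ℂ, q.eval z ≠ 0 := by
    have h1 := Polynomial.tendsto_norm_atTop q (by
      rw [Polynomial.degree_eq_natDegree h.monic.ne_zero]
      exact_mod_cast h.natDegree_pos) (tendsto_norm_cobounded_atTop (E := ℂ))
    filter_upwards [h1.eventually_gt_atTop 0] with z hz
    exact norm_pos_iff.1 hz
  have hc : Continuous fun g : V →L[ℂ] V => T (g (iota v)) := by fun_prop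
  have h1 := (hc.tendsto 0).comp (spectrum.resolvent_tendsto_cobounded a (𝕜 := ℂ))
  rw [zero_apply, map_zero] at h1
  refine tendsto_nhds_unique (tendsto_const_nhds.congr' ?_) h1
  filter_upwards [hne] with z hz
  exact (hT z hz).symm

end CyclicTriple

/-- The values and the first derivatives, at a point of the base, of the objects that are attached
to a `q`-connection and to a connection `d + β` on the bundle of jets. The primes indicate
derivatives in the direction of the first tangent vector. -/
structure PointData (a : V →L[ℂ] V) (iota : F →L[ℂ] V) (rho : V →L[ℂ] F) (q : Polynomial ℂ)
    (T : Type*) where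
  b : V →L[ℂ] V
  al : T → V →L[ℂ] V
  be : T → V →L[ℂ] V
  A : ℂ → F →L[ℂ] F
  Om : ℂ → T → F →L[ℂ] F
  O : T → F →L[ℂ] F
  a' : T → V →L[ℂ] V
  a'' : T → T → V →L[ℂ] V
  b' : T → V →L[ℂ] V
  al' : T → T → V →L[ℂ] V
  be' : T → T → V →L[ℂ] V
  A' : ℂ → T → F →L[ℂ] F
  Om' : ℂ → T → T → F →L[ℂ] F
  Omz : ℂ → T → F →L[ℂ] F
  O' : T → T → F →L[ℂ] F
  cyclic : CyclicTriple a iota rho q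
  eq_zero_of_b : ∀ w, (∀ n, b ((a ^ n) w) = 0) → w = 0
  b_psi : ∀ z, q.eval z ≠ 0 → ∀ v, b (resolvent a z (iota v)) = iota (A z v)
  b_al_psi : ∀ z, q.eval z ≠ 0 → ∀ X v,
    b (al X (resolvent a z (iota v))) = iota (Om z X v) - iota (O X v)
  b_al_psi' : ∀ z, q.eval z ≠ 0 → ∀ X v,
    b (al X (resolvent a z (resolvent a z (iota v)))) = -iota (Omz z X v)
  al_a : ∀ X, Commute (al X) a
  al_al : ∀ X Y, Commute (al X) (al Y)
  al_a' : ∀ X Y, Commute (al X) (a' Y)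
  be_a : ∀ X, be X * a - a * be X = b * al X - al X * b + al X - a' X
  be_iota : ∀ X v, be X (iota v) = iota (O X v)
  b'_psi : ∀ z, q.eval z ≠ 0 → ∀ X v, b' X (resolvent a z (iota v)) +
    b (resolvent a z (a' X (resolvent a z (iota v)))) = iota (A' z X v)
  b_al'_psi : ∀ z, q.eval z ≠ 0 → ∀ X Y v, b' X (al Y (resolvent a z (iota v))) +
    b (al' X Y (resolvent a z (iota v))) +
    b (al Y (resolvent a z (a' X (resolvent a z (iota v))))) =
      iota (Om' z X Y v) - iota (O' X Y v)
  be'_iota : ∀ X Y v, be' X Y (iota v) = iota (O' X Y v)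
  be'_a : ∀ X Y, be' X Y * a + be Y * a' X - (a' X * be Y + a * be' X Y) =
    (b' X * al Y + b * al' X Y) - (al' X Y * b + al Y * b' X) + al' X Y - a'' X Y
  a''_symm : ∀ X Y, a'' X Y = a'' Y X
  al'_a : ∀ X Y, al' X Y * a + al Y * a' X = a' X * al Y + a * al' X Y

namespace PointData

variable {a : V →L[ℂ] V} {iota : F →L[ℂ] V} {rho : V →L[ℂ] F} {q : Polynomial ℂ} {T : Type*}
  (P : PointData a iota rho q T)

/-- The component `dA + ∂Ω/∂x + [Ω, A]` of the curvature. -/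
def mixed (z : ℂ) (X : T) : F →L[ℂ] F :=
  P.A' z X + P.Omz z X + P.Om z X * P.A z - P.A z * P.Om z X

/-- The component `dΩ + Ω ∧ Ω` of the curvature. -/
def pure (z : ℂ) (X Y : T) : F →L[ℂ] F :=
  P.Om' z X Y - P.Om' z Y X + (P.Om z X * P.Om z Y - P.Om z Y * P.Om z X)

/-- The curvature at infinity. -/
def pureInf (X Y : T) : F →L[ℂ] F :=
  P.O' X Y - P.O' Y X + (P.O X * P.O Y - P.O Y * P.O X)

/-- The covariant derivative of `b`. -/
def Db (X : T) : V →L[ℂ] V := P.b' X + (P.be X * P.b - P.b * P.be X)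

/-- The covariant derivative of `α`, before the antisymmetrization. -/
def E (X Y : T) : V →L[ℂ] V := P.al' X Y + (P.be X * P.al Y - P.al Y * P.be X)

/-- The covariant exterior derivative of `α`. -/
def Dal (X Y : T) : V →L[ℂ] V := P.E X Y - P.E Y X

/-- The curvature of the connection on jets. -/
def curv (X Y : T) : V →L[ℂ] V :=
  P.be' X Y - P.be' Y X + (P.be X * P.be Y - P.be Y * P.be X)

/-- The left side is the covariant derivative of `ψ = (z - a)⁻¹ ι v` with `v` held constant. It is
computed by applying the relation for `[β, a]` to `ψ` and then the resolvent, which commutes with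
`α`. -/
theorem be_psi {z : ℂ} (hz : q.eval z ≠ 0) (X : T) (v : F) :
    P.be X (resolvent a z (iota v)) + resolvent a z (P.a' X (resolvent a z (iota v))) =
      resolvent a z (iota (P.Om z X v)) - P.al X (resolvent a z (iota (P.A z v))) +
        P.al X (resolvent a z (resolvent a z (iota v))) := by
  have hG := P.cyclic.resolvent_mul_sub hz
  have hG' := P.cyclic.sub_mul_resolvent hz
  set G := resolvent a z with hGdef
  have hGal : ∀ w, G (P.al X w) = P.al X (G w) := fun w =>
    (congrArg (fun S : V →L[ℂ] V => S w) (CyclicTriple.commute_resolvent (P.al_a X) z).eq).symm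
  have h1 : P.be X * a = a * P.be X + (P.b * P.al X - P.al X * P.b + P.al X - P.a' X) := by
    rw [← P.be_a X]; abel
  have h2 : ∀ w, P.be X (a w) = a (P.be X w) + (P.b (P.al X w) - P.al X (P.b w) + P.al X w -
      P.a' X w) := fun w => congrArg (fun S : V →L[ℂ] V => S w) h1
  have h3 : ∀ w, a (G w) = z • G w - w := by
    intro w
    have := congrArg (fun S : V →L[ℂ] V => S w) hG'
    simp only [mul_apply_eq_comp, sub_apply, smul_apply, one_apply_eq_self] at this
    exact eq_sub_of_add_eq (sub_eq_iff_eq_add'.1 this).symm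
  have h4 : ∀ w, G (a w) = z • G w - w := by
    intro w
    have := congrArg (fun S : V →L[ℂ] V => S w) hG
    simp only [mul_apply_eq_comp, sub_apply, smul_apply, one_apply_eq_self, map_sub, map_smul]
      at this
    exact eq_sub_of_add_eq (sub_eq_iff_eq_add'.1 this).symm
  have h5 := congrArg G (h2 (G (iota v)))
  rw [h3, P.b_al_psi z hz, P.b_psi z hz] at h5
  simp only [map_sub, map_add, map_smul, h4, hGal, P.be_iota] at h5
  linear_combination (norm := module) h5

/-- Differentiation of `b ψ = ι A v`: applying `b` to `be_psi` turns its three terms into `A Ω`, `(Ω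
- Ω_∞) A` and `∂Ω/∂x`, and `β ι = ι Ω_∞` removes the contribution of infinity. -/
theorem Db_psi {z : ℂ} (hz : q.eval z ≠ 0) (X : T) (v : F) :
    P.Db X (resolvent a z (iota v)) = iota (P.mixed z X v) := by
  have h1 := P.be_psi hz X v
  have h2 := congrArg P.b h1
  have h3 := P.b'_psi z hz X v
  simp only [map_sub, map_add, P.b_al_psi z hz, P.b_psi z hz, P.b_al_psi' z hz] at h2
  simp only [Db, mixed, add_apply, sub_apply, mul_apply_eq_comp, map_sub, map_add, P.b_psi z hz,
    P.be_iota]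
  rw [eq_sub_of_add_eq h2, eq_sub_of_add_eq h3]
  abel

/-- The hypothesis `Db = 0` allows `β` to be moved across `b`. The last two terms, quadratic in `α`,
have no expression through `A` and `Ω`, but are symmetric in `X` and `Y`. -/
theorem b_E_psi {z : ℂ} (hz : q.eval z ≠ 0) {X : T} (hX : P.Db X = 0) (Y : T) (v : F) :
    P.b (P.E X Y (resolvent a z (iota v))) =
      iota (P.Om' z X Y v) - iota (P.O' X Y v) + iota (P.O X (P.Om z Y v)) -
        iota (P.O X (P.O Y v)) - iota (P.Om z Y (P.Om z X v)) + iota (P.O Y (P.Om z X v)) +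
        P.b (P.al Y (P.al X (resolvent a z (iota (P.A z v))))) -
        P.b (P.al Y (P.al X (resolvent a z (resolvent a z (iota v))))) := by
  have h1 := P.be_psi hz X v
  have h2 := congrArg (fun w => P.b (P.al Y w)) h1
  have h3 := P.b_al'_psi z hz X Y v
  have h4 : P.b' X (P.al Y (resolvent a z (iota v))) + (P.be X (P.b (P.al Y (resolvent a z
      (iota v)))) - P.b (P.be X (P.al Y (resolvent a z (iota v))))) = 0 :=
    congrArg (fun S : V →L[ℂ] V => S (P.al Y (resolvent a z (iota v)))) hX
  simp only [map_sub, map_add, P.b_al_psi z hz, P.be_iota] at h2 h4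
  simp only [E, add_apply, sub_apply, mul_apply_eq_comp, map_sub, map_add]
  linear_combination (norm := module) h3 - h4 - h2

/-- Antisymmetrization of `b_E_psi`; the quadratic terms cancel since `α_X` and `α_Y` commute. -/
theorem b_Dal_psi {z : ℂ} (hz : q.eval z ≠ 0) (hD : ∀ X, P.Db X = 0) (X Y : T) (v : F) :
    P.b (P.Dal X Y (resolvent a z (iota v))) = iota (P.pure z X Y v) - iota (P.pureInf X Y v) := by
  have h1 : ∀ w, P.al X (P.al Y w) = P.al Y (P.al X w) := fun w =>
    congrArg (fun S : V →L[ℂ] V => S w) (P.al_al X Y).eq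
  simp only [Dal, pure, pureInf, sub_apply, add_apply, mul_apply_eq_comp, map_sub, map_add,
    P.b_E_psi hz (hD _), h1]
  abel

/-- Covariant differentiation of `[α_Y, a] = 0` gives `[E X Y, a] = [[b, α_X], α_Y]`, as `α_Y`
commutes with `α_X`. By the Jacobi identity and `[α_X, α_Y] = 0` this is symmetric in `X` and `Y`.
-/
theorem commute_Dal (X Y : T) : Commute (P.Dal X Y) a := by
  have h1 : ∀ X Y, P.E X Y * a - a * P.E X Y =
      (P.b * P.al X - P.al X * P.b) * P.al Y - P.al Y * (P.b * P.al X - P.al X * P.b) := by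
    intro X Y
    have h2 := sub_eq_zero.2 (P.al'_a X Y)
    have h3 := (P.al_a' Y X).eq
    have h4 := P.be_a X
    have h5 := (P.al_al X Y).eq
    have h6 := (P.al_a Y).eq
    have h7 : P.E X Y * a - a * P.E X Y = (P.al' X Y * a + P.al Y * P.a' X -
        (P.a' X * P.al Y + a * P.al' X Y)) - (P.al Y * P.a' X - P.a' X * P.al Y) +
        ((P.be X * a - a * P.be X) * P.al Y - P.al Y * (P.be X * a - a * P.be X)) +
        (P.be X * (P.al Y * a - a * P.al Y) - (P.al Y * a - a * P.al Y) * P.be X) := by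
      simp only [E]
      noncomm_ring
    rw [h7, h2, h4, h3, h6]
    simp only [add_mul, sub_mul, mul_sub, mul_add, h5, h3]
    noncomm_ring
  rw [Commute, SemiconjBy, ← sub_eq_zero]
  have h2 : P.Dal X Y * a - a * P.Dal X Y =
      (P.E X Y * a - a * P.E X Y) - (P.E Y X * a - a * P.E Y X) := by
    simp only [Dal]
    noncomm_ring
  have h3 : P.al X * P.al Y = P.al Y * P.al X := (P.al_al X Y).eq
  have h4 : P.b * (P.al X * P.al Y) = P.b * (P.al Y * P.al X) := by rw [h3]
  have h5 : P.al X * P.al Y * P.b = P.al Y * P.al X * P.b := by rw [h3]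
  rw [h2, h1, h1]
  simp only [mul_sub, sub_mul, mul_assoc] at h4 h5 ⊢
  rw [h4, h5]
  abel

theorem curv_iota (X Y : T) (v : F) : P.curv X Y (iota v) = iota (P.pureInf X Y v) := by
  simp only [curv, pureInf, sub_apply, add_apply, mul_apply_eq_comp, map_sub, map_add,
    P.be_iota, P.be'_iota]

/-- The second covariant derivative of `a` is its commutator with the curvature, and `D` applied to
`Da = [b, α] + α` gives the right side when `Db = 0`. -/
theorem curv_commutator (hD : ∀ X, P.Db X = 0) (X Y : T) :
    P.curv X Y * a - a * P.curv X Y =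
      P.b * P.Dal X Y - P.Dal X Y * P.b + P.Dal X Y := by
  have h1 := P.be'_a X Y
  have h2 := P.be'_a Y X
  have h3 := P.be_a X
  have h4 := P.be_a Y
  have hb : ∀ X, P.b' X = P.b * P.be X - P.be X * P.b := by
    intro X
    have := hD X
    rw [Db] at this
    rw [eq_neg_of_add_eq_zero_left this, neg_sub]
  have h5 : P.curv X Y * a - a * P.curv X Y =
      (P.be' X Y * a + P.be Y * P.a' X - (P.a' X * P.be Y + a * P.be' X Y)) -
      (P.be' Y X * a + P.be X * P.a' Y - (P.a' Y * P.be X + a * P.be' Y X)) +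
      (P.be X * (P.be Y * a - a * P.be Y) - (P.be Y * a - a * P.be Y) * P.be X) -
      (P.be Y * (P.be X * a - a * P.be X) - (P.be X * a - a * P.be X) * P.be Y) -
      (P.be Y * P.a' X - P.a' X * P.be Y) + (P.be X * P.a' Y - P.a' Y * P.be X) := by
    simp only [curv]
    noncomm_ring
  rw [h5, h1, h2, h3, h4, hb X, hb Y, P.a''_symm X Y]
  simp only [Dal, E]
  noncomm_ring

theorem flat_iff [CompleteSpace V] :
    (∀ z, q.eval z ≠ 0 → (∀ X, P.mixed z X = 0) ∧ ∀ X Y, P.pure z X Y = 0) ↔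
      (∀ X Y, P.curv X Y = 0) ∧ (∀ X, P.Db X = 0) ∧ ∀ X Y, P.Dal X Y = 0 := by
  have hinj := P.cyclic.iota_injective
  have hne : ∃ z, q.eval z ≠ 0 := by
    by_contra hz
    push Not at hz
    exact P.cyclic.monic.ne_zero (Polynomial.funext fun z => by rw [hz z, Polynomial.eval_zero])
  constructor
  · intro hflat
    have hD : ∀ X, P.Db X = 0 := by
      intro X
      refine P.cyclic.eq_zero_of_resolvent fun z hz => ?_
      ext1 v
      have := P.Db_psi hz X v
      rw [(hflat z hz).1 X, zero_apply, map_zero] at this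
      exact this
    -- Flatness at infinity is flatness for finite `z` in the limit: `b (Dα) ψ` equals minus the
    -- curvature at infinity for every `z`, while `ψ → 0`.
    have hinf : ∀ X Y, P.pureInf X Y = 0 := by
      intro X Y
      ext1 v
      refine hinj ?_
      rw [zero_apply, map_zero, ← neg_eq_zero]
      refine P.cyclic.eq_zero_of_apply_resolvent (T := P.b * P.Dal X Y) (v := v) fun z hz => ?_
      rw [mul_apply_eq_comp, P.b_Dal_psi hz hD, (hflat z hz).2 X Y, zero_apply, map_zero, zero_sub]
    -- `b` has a kernel, but `Dα` commutes with `a`, so `b Dα = 0` gives `b a ^ n Dα = 0` for all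
    -- `n`, and these maps are jointly injective.
    have hDal : ∀ X Y, P.Dal X Y = 0 := by
      intro X Y
      have h1 : P.b * P.Dal X Y = 0 := by
        refine P.cyclic.eq_zero_of_resolvent fun z hz => ?_
        ext1 v
        rw [ContinuousLinearMap.comp_apply, mul_apply_eq_comp, mul_apply_eq_comp,
          P.b_Dal_psi hz hD, (hflat z hz).2 X Y, hinf X Y, sub_self, zero_apply]
      ext1 w
      refine P.eq_zero_of_b _ fun n => ?_
      rw [← mul_apply_eq_comp (a ^ n), ← ((P.commute_Dal X Y).pow_right n).eq]
      exact congrArg (fun S : V →L[ℂ] V => S ((a ^ n) w)) h1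
    refine ⟨fun X Y => ?_, hD, hDal⟩
    refine P.cyclic.eq_of_commute ?_ ?_
    · rw [sub_zero, Commute, SemiconjBy, ← sub_eq_zero, P.curv_commutator hD, hDal]
      simp
    · ext1 v
      rw [ContinuousLinearMap.comp_apply, P.curv_iota, hinf]
      simp
  · rintro ⟨hK, hD, hDal⟩ z hz
    have hinf : ∀ X Y, P.pureInf X Y = 0 := by
      intro X Y
      ext1 v
      refine hinj ?_
      rw [← P.curv_iota, hK]
      simp
    refine ⟨fun X => ?_, fun X Y => ?_⟩
    · ext1 v
      refine hinj ?_
      rw [← P.Db_psi hz, hD]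
      simp
    · ext1 v
      refine hinj ?_
      have := P.b_Dal_psi hz hD X Y v
      rw [hDal, hinf, zero_apply, zero_apply, map_zero, map_zero, sub_zero] at this
      rw [← this]
      simp

end PointData

end Flatness

theorem polyEval_apply {S W : Type*} [AddCommGroup S] [Module ℂ S] [TopologicalSpace S]
    [NormedAddCommGroup W] [NormedSpace ℂ W] {d : ℕ} (c : Fin d → S →L[ℂ] W) (x : ℂ) (X : S) :
    polyEval c x X = polyEval (fun n => c n X) x := by
  simp [polyEval]

/-! ### Moments of the resolvent weighted by endomorphism-valued polynomials. -/

section Moments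

variable {p : ℕ} {k : Fin p → ℕ} {F : Type*} [NormedAddCommGroup F] [NormedSpace ℂ F]
  {lam : Fin p → ℂ} [CompleteSpace F] [FiniteDimensional ℂ F]

theorem jetRho_jetPoly_resolvent (hp : 0 < p) (hk : ∀ i, 0 < k i) (hlam : Function.Injective lam)
    {d : ℕ} (hd : d ≤ qDeg k + 1) (c : Fin d → F →L[ℂ] F) {z : ℂ}
    (hz : (qPolynomial k lam).eval z ≠ 0) (v : F) :
    jetRho k F lam (jetPoly lam c (resolvent (jetX k F lam) z (jetConst k v))) =
      (qPoly k lam z)⁻¹ • polyEval c z v -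
        ∑ n : Fin d, if (n : ℕ) = qDeg k then c n v else 0 := by
  have hcyc := cyclicTriple_jet (F := F) hp hk hlam
  simp only [jetPoly, _root_.sum_apply, mul_apply_eq_comp, map_sum, polyEval, Finset.smul_sum,
    smul_apply]
  rw [← Finset.sum_sub_distrib]
  refine Finset.sum_congr rfl fun n _ => ?_
  have h1 : ∀ w, jetRho k F lam (jetMap k (c n) w) = c n (jetRho k F lam w) := fun w =>
    congrArg (fun S : Jet k F →L[ℂ] F => S w) (jetRho_comp_jetMap k lam hlam (c n))
  rw [h1, hcyc.rho_pow_resolvent hz (by rw [natDegree_qPolynomial]; omega), map_smul, sub_smul,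
    smul_smul, eval_qPolynomial, natDegree_qPolynomial, mul_comm]
  split_ifs <;> simp

end Moments

namespace QConnection

variable {T : Type*} [NormedAddCommGroup T] [NormedSpace ℂ T]
  {M : Type*} [TopologicalSpace M] [ChartedSpace T M] {ℓ : ℕ} {ι : Type*}
  {E : VectorBundleCore ℂ M (Fin ℓ → ℂ) ι} {p : ℕ} {k : Fin p → ℕ} (C : QConnection T E k)

/-! ### The operators on the jets at a point of the base -/

theorem poles_injective (t : M) : Function.Injective (C.poles t) := C.lam_injective t

/-- Multiplication of jets by `Q`. -/
def Qhat (i : ι) (t : M) : Jet k (Fin ℓ → ℂ) →L[ℂ] Jet k (Fin ℓ → ℂ) :=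
  jetPoly (C.poles t) fun n => C.Qc i n t

/-- Multiplication of jets by `R`. -/
def Rhat (i : ι) (t : M) (X : TangentSpace 𝓘(ℂ, T) t) :
    Jet k (Fin ℓ → ℂ) →L[ℂ] Jet k (Fin ℓ → ℂ) :=
  jetPoly (C.poles t) fun n => C.Rc i n t X

/-- The functional `u ↦ ∑ⱼ (1 / 2πi) ∮ u / q dx` on jets. -/
def rho (t : M) : Jet k (Fin ℓ → ℂ) →L[ℂ] (Fin ℓ → ℂ) := jetRho k (Fin ℓ → ℂ) (C.poles t)

theorem cyclicTriple (hp : 0 < p) (hk : ∀ j, 0 < k j) (t : M) :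
    CyclicTriple (C.a t) (jetConst k) (C.rho t) (qPolynomial k (C.poles t)) :=
  cyclicTriple_jet hp hk (C.poles_injective t)

theorem isUnit_Q {i : ι} {t : M} (ht : t ∈ E.baseSet i) (j : Fin p) :
    IsUnit (polyEval (fun n => C.Qc i n t) (C.poles t j)) :=
  isUnit_of_zero_notMem_roots (C.eigenvalues i t ht j).2

theorem isUnit_Qhat {i : ι} {t : M} (ht : t ∈ E.baseSet i) : IsUnit (C.Qhat i t) :=
  isUnit_jetPoly (C.isUnit_Q ht)

theorem jetMul_Q (i : ι) (t : M) : jetMul k (C.poles t) (C.Q i t) = C.Qhat i t :=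
  jetMul_polyEval_eq _

theorem R_apply (i : ι) (x : ℂ) (t : M) (X : TangentSpace 𝓘(ℂ, T) t) :
    C.R i x t X = polyEval (fun n => C.Rc i n t X) x :=
  polyEval_apply _ x X

theorem alpha_eq_jetMul (i : ι) (t : M) (X : TangentSpace 𝓘(ℂ, T) t) :
    C.alpha i t X = jetMul k (C.poles t) fun x =>
      Ring.inverse (polyEval (fun n => C.Qc i n t) x) * polyEval (fun n => C.Rc i n t X) x := by
  simp only [alpha, R_apply, Q]

theorem Qhat_mul_alpha {i : ι} {t : M} (ht : t ∈ E.baseSet i) (X : TangentSpace 𝓘(ℂ, T) t) :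
    C.Qhat i t * C.alpha i t X = C.Rhat i t X := by
  rw [alpha_eq_jetMul]
  exact jetPoly_mul_jetMul _ (C.isUnit_Q ht)

theorem alpha_eq {i : ι} {t : M} (ht : t ∈ E.baseSet i) (X : TangentSpace 𝓘(ℂ, T) t) :
    C.alpha i t X = Ring.inverse (C.Qhat i t) * C.Rhat i t X := by
  rw [← C.Qhat_mul_alpha ht, ← mul_assoc, Ring.inverse_mul_cancel _ (C.isUnit_Qhat ht), one_mul]

theorem b_eq (hk : ∀ j, 0 < k j) (i : ι) (t : M) :
    C.b i t = (jetConst k).comp (C.rho t) * C.Qhat i t := by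
  rw [b, rho, ← jetMul_Q, ContinuousLinearMap.mul_def, ContinuousLinearMap.comp_assoc,
    ← jetResidue_eq_jetRho k (C.poles t) hk (C.poles_injective t)]
  · rfl
  · exact fun j => analyticAt_polyEval _ _

theorem commute_Qhat_a (i : ι) (t : M) : Commute (C.Qhat i t) (C.a t) := by
  rw [← jetMul_Q]
  exact commute_jetMul_jetX _

theorem commute_alpha_a (i : ι) (t : M) (X : TangentSpace 𝓘(ℂ, T) t) :
    Commute (C.alpha i t X) (C.a t) :=
  commute_jetMul_jetX _

theorem commute_alpha_jetDiag (i : ι) (t : M) (X : TangentSpace 𝓘(ℂ, T) t) (c : Fin p → ℂ) :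
    Commute (C.alpha i t X) (jetDiag k _ c) :=
  commute_jetMul_jetDiag _ c

theorem aeval_derivative_mul {i : ι} {t : M} (ht : t ∈ E.baseSet i)
    (X : TangentSpace 𝓘(ℂ, T) t) :
    Polynomial.aeval (C.a t) (Polynomial.derivative (qPolynomial k (C.poles t))) *
      (C.alpha i t X - jetDiag k _ fun j => diff (T := T) (C.lam j) t X) = 0 := by
  rw [alpha_eq_jetMul]
  exact aeval_derivative_mul_alpha (C.isUnit_Q ht) fun j => C.leading i t ht j X

theorem commute_alpha_alpha {i : ι} {t : M} (ht : t ∈ E.baseSet i)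
    {X Y : TangentSpace 𝓘(ℂ, T) t} (hX : Commute (C.alpha i t X) (C.Qhat i t))
    (hY : Commute (C.alpha i t Y) (C.Qhat i t)) :
    Commute (C.alpha i t X) (C.alpha i t Y) :=
  commute_of_commute_jetPoly (fun j => (C.eigenvalues i t ht j).1) hX hY

/-- The obstruction to the existence of the induced connection is the commutator of `Q` and `α`. -/
theorem polyDiff_eq (hp : 0 < p) (hk : ∀ j, 0 < k j) {i : ι} {t : M} (ht : t ∈ E.baseSet i)
    (X : TangentSpace 𝓘(ℂ, T) t) :
    polyDiff (C.a t) (qPolynomial k (C.poles t))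
      (C.b i t * C.alpha i t X - C.alpha i t X * C.b i t + C.alpha i t X -
        jetDiag k _ fun j => diff (T := T) (C.lam j) t X) =
      C.Qhat i t * C.alpha i t X - C.alpha i t X * C.Qhat i t := by
  rw [C.b_eq hk]
  exact (C.cyclicTriple hp hk t).polyDiff_commutator (C.commute_Qhat_a i t)
    (C.commute_alpha_a i t X) (commute_jetDiag_jetX _) (C.aeval_derivative_mul ht X)

theorem eq_zero_of_b (hp : 0 < p) (hk : ∀ j, 0 < k j) {i : ι} {t : M} (ht : t ∈ E.baseSet i)
    {w : Jet k (Fin ℓ → ℂ)} (hw : ∀ n, C.b i t ((C.a t ^ n) w) = 0) : w = 0 := by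
  have hc := C.cyclicTriple hp hk t
  have h1 : C.Qhat i t w = 0 := by
    refine hc.eq_zero_of_rho_pow fun n => hc.iota_injective ?_
    rw [← mul_apply_eq_comp, ← ((C.commute_Qhat_a i t).pow_right n).eq, map_zero, ← hw n,
      C.b_eq hk]
    rfl
  have h2 := congrArg (fun u => Ring.inverse (C.Qhat i t) u) h1
  rwa [← mul_apply_eq_comp, Ring.inverse_mul_cancel _ (C.isUnit_Qhat ht), one_apply_eq_self,
    map_zero] at h2

theorem q_eq (t : M) (z : ℂ) : C.q t z = (qPolynomial k (C.poles t)).eval z :=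
  (eval_qPolynomial _ _ _).symm

theorem b_psi (hp : 0 < p) (hk : ∀ j, 0 < k j) (i : ι) (t : M) {z : ℂ} (hz : C.q t z ≠ 0)
    (v : Fin ℓ → ℂ) :
    C.b i t (resolvent (C.a t) z (jetConst k v)) = jetConst k (C.A i t z v) := by
  rw [C.b_eq hk, mul_apply_eq_comp, ContinuousLinearMap.comp_apply]
  congr 1
  rw [q_eq] at hz
  refine (jetRho_jetPoly_resolvent hp hk (C.poles_injective t) (by omega) _ hz v).trans ?_
  rw [Finset.sum_eq_zero, sub_zero]
  · rfl
  -- The degree of `Q` is at most `deg q - 2`, so nothing has to be subtracted at infinity.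
  · intro n _
    rw [if_neg]
    have := n.2
    omega

/-- As `b α = ι ρ R̂`, this is `R/q` minus its value at infinity, the degree of `R` being allowed to
reach `deg q`. -/
theorem b_alpha_psi (hp : 0 < p) (hk : ∀ j, 0 < k j) {i : ι} {t : M} (ht : t ∈ E.baseSet i)
    (X : TangentSpace 𝓘(ℂ, T) t) {z : ℂ} (hz : C.q t z ≠ 0) (v : Fin ℓ → ℂ) :
    C.b i t (C.alpha i t X (resolvent (C.a t) z (jetConst k v))) =
      jetConst k (C.Omega i z t X v) - jetConst k (C.OmegaInf i t X v) := by
  rw [C.b_eq hk, ← mul_apply_eq_comp, mul_assoc, C.Qhat_mul_alpha ht, mul_apply_eq_comp,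
    ContinuousLinearMap.comp_apply, ← map_sub]
  congr 1
  rw [q_eq] at hz
  refine (jetRho_jetPoly_resolvent hp hk (C.poles_injective t) le_rfl _ hz v).trans ?_
  congr 1
  · rw [← R_apply]
    rfl
  · rw [Finset.sum_eq_single (Fin.last _)]
    · rw [if_pos (by simp)]
      rfl
    · intro n _ hn
      rw [if_neg]
      intro h
      exact hn (Fin.ext h)
    · intro h
      exact absurd (Finset.mem_univ _) h

end QConnection

/-! ### Derivatives of products and of resolvents -/

section Derivatives

variable {T : Type*} [NormedAddCommGroup T] [NormedSpace ℂ T]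

theorem fderiv_mul_apply {R : Type*} [NormedRing R] [NormedAlgebra ℂ R] {f g : T → R} {s : T}
    (hf : DifferentiableAt ℂ f s) (hg : DifferentiableAt ℂ g s) (X : T) :
    fderiv ℂ (fun s => f s * g s) s X = fderiv ℂ f s X * g s + f s * fderiv ℂ g s X := by
  have h : HasFDerivAt (fun s => f s * g s) _ s := hf.hasFDerivAt.mul' hg.hasFDerivAt
  rw [h.fderiv]
  simp [add_comm]

theorem fderiv_apply_const {V W : Type*} [NormedAddCommGroup V] [NormedSpace ℂ V]
    [NormedAddCommGroup W] [NormedSpace ℂ W] {f : T → V →L[ℂ] W} {s : T}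
    (hf : DifferentiableAt ℂ f s) (X : T) (v : V) :
    fderiv ℂ (fun s => f s v) s X = fderiv ℂ f s X v := by
  rw [(hf.hasFDerivAt.clm_apply (hasFDerivAt_const v s)).fderiv]
  simp

variable {V : Type*} [NormedAddCommGroup V] [NormedSpace ℂ V] [CompleteSpace V]

theorem hasFDerivAt_resolvent_comp {a : T → V →L[ℂ] V} {s : T} {z : ℂ}
    (ha : DifferentiableAt ℂ a s) (hz : z ∈ resolventSet ℂ (a s)) :
    DifferentiableAt ℂ (fun s => resolvent (a s) z) s ∧ ∀ X,
      fderiv ℂ (fun s => resolvent (a s) z) s X =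
        resolvent (a s) z * fderiv ℂ a s X * resolvent (a s) z := by
  obtain ⟨u, hu⟩ := hz
  have h1 : HasFDerivAt (fun s => algebraMap ℂ (V →L[ℂ] V) z - a s) (-fderiv ℂ a s) s :=
    ha.hasFDerivAt.const_sub _
  have h2 := hasFDerivAt_ringInverse (𝕜 := ℂ) u
  rw [hu] at h2
  have h3 := h2.comp s h1
  refine ⟨h3.differentiableAt, fun X => ?_⟩
  have h4 : (fun s => resolvent (a s) z) =
    Ring.inverse ∘ fun s => algebraMap ℂ (V →L[ℂ] V) z - a s := rfl
  rw [h4, h3.fderiv, resolvent, ← hu, Ring.inverse_unit]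
  simp

end Derivatives

/-! ### Holomorphy in charts -/

section JetMapL

variable {p : ℕ} (k : Fin p → ℕ) (F : Type*) [NormedAddCommGroup F] [NormedSpace ℂ F]

/-- `jetMap` as a continuous linear map. -/
def jetMapL : (F →L[ℂ] F) →L[ℂ] (Jet k F →L[ℂ] Jet k F) where
  toFun := jetMap k
  map_add' g h := by
    ext u i m
    simp [jetMap]
  map_smul' c g := by
    ext u i m
    simp [jetMap]
  cont := continuous_jetMap k

variable {T : Type*} [NormedAddCommGroup T] [NormedSpace ℂ T] {k} {F} {U : Set T}

theorem contDiffOn_jetX {lam : T → Fin p → ℂ} (h : ∀ j, ContDiffOn ℂ ω (fun s => lam s j) U) :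
    ContDiffOn ℂ ω (fun s => jetX k F (lam s)) U := by
  have h1 : (fun s => jetX k F (lam s)) = fun s =>
      jetX k F 0 + ∑ j, lam s j • jetDiag k F (Pi.single j 1) := by
    funext s
    rw [jetX_eq_add, jetDiag_eq_sum]
  rw [h1]
  exact contDiffOn_const.add (ContDiffOn.sum fun j _ => (h j).smul contDiffOn_const)

theorem fderiv_jetX {lam : T → Fin p → ℂ} {s : T}
    (h : ∀ j, DifferentiableAt ℂ (fun s => lam s j) s) (X : T) :
    fderiv ℂ (fun s => jetX k F (lam s)) s X =
      jetDiag k F fun j => fderiv ℂ (fun s => lam s j) s X := by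
  have h1 : (fun s => jetX k F (lam s)) = fun s =>
      jetX k F 0 + ∑ j, lam s j • jetDiag k F (Pi.single j 1) := by
    funext s
    rw [jetX_eq_add, jetDiag_eq_sum]
  have h2 : HasFDerivAt (fun s => jetX k F 0 + ∑ j, lam s j • jetDiag k F (Pi.single j 1))
      (∑ j, (fderiv ℂ (fun s => lam s j) s).smulRight (jetDiag k F (Pi.single j 1))) s :=
    (HasFDerivAt.fun_sum fun j _ => (h j).hasFDerivAt.smul_const _).const_add _
  rw [h1, h2.fderiv, jetDiag_eq_sum]
  simp

theorem contDiffOn_jetPoly {lam : T → Fin p → ℂ} (h : ∀ j, ContDiffOn ℂ ω (fun s => lam s j) U)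
    {d : ℕ} {c : T → Fin d → F →L[ℂ] F} (hc : ∀ n, ContDiffOn ℂ ω (fun s => c s n) U) :
    ContDiffOn ℂ ω (fun s => jetPoly (k := k) (lam s) (c s)) U :=
  ContDiffOn.sum fun n _ => ((jetMapL k F).contDiff.comp_contDiffOn (hc n)).mul
    ((contDiffOn_jetX h).pow _)

theorem contDiffOn_inverse {R : Type*} [NormedRing R] [NormedAlgebra ℂ R] [CompleteSpace R]
    {f : T → R} (hf : ContDiffOn ℂ ω f U) (hu : ∀ s ∈ U, IsUnit (f s)) :
    ContDiffOn ℂ ω (fun s => Ring.inverse (f s)) U := by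
  intro s hs
  obtain ⟨u, hu⟩ := hu s hs
  have h1 : ContDiffAt ℂ ω Ring.inverse (f s) := hu ▸ contDiffAt_ringInverse ℂ u
  exact h1.comp_contDiffWithinAt s (hf s hs)

variable (k F) in
/-- The sum of the last coefficients of the components of a jet. -/
def jetLast : Jet k F →L[ℂ] F :=
  ∑ i, if h : 0 < k i then jetProj k i ⟨k i - 1, Nat.sub_lt h one_pos⟩ else 0

/-- Multiplication of the `i`-th component of a jet by `q / (x - λᵢ) ^ kᵢ`. -/
def jetCofactor (k : Fin p → ℕ) (F : Type*) [NormedAddCommGroup F] [NormedSpace ℂ F]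
    (lam : Fin p → ℂ) : Jet k F →L[ℂ] Jet k F :=
  ∑ i, jetDiag k F (Pi.single i 1) * Polynomial.aeval (jetX k F lam) (qCofactor k lam i)

theorem jetCofactor_eq (lam : Fin p → ℂ) : jetCofactor k F lam = jetAct k F fun i =>
    Polynomial.aeval (PowerSeries.C (lam i • (1 : F →L[ℂ] F)) + PowerSeries.X)
      (qCofactor k lam i) := by
  simp only [jetCofactor, jetDiag, aeval_jetX, ← map_mul, ← map_sum]
  congr 1
  funext i
  rw [Finset.sum_apply, Finset.sum_eq_single i]
  · simp
  · intro j _ hj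
    simp [Pi.single_eq_of_ne (Ne.symm hj)]
  · simp

variable [CompleteSpace F]

/-- Multiplying by the cofactors clears all poles but that at `λᵢ`, leaving a functional independent
of the `λᵢ`. This displays `ρ` as holomorphic in the `λᵢ` without differentiating contour integrals.
-/
theorem jetRho_comp_jetCofactor {lam : Fin p → ℂ} (hk : ∀ i, 0 < k i)
    (hlam : Function.Injective lam) :
    (jetRho k F lam).comp (jetCofactor k F lam) = jetLast k F := by
  refine ContinuousLinearMap.ext fun u => ?_
  rw [ContinuousLinearMap.comp_apply, jetRho_apply k lam hlam, jetLast, _root_.sum_apply]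
  refine Finset.sum_congr rfl fun i _ => ?_
  rw [jetCofactor_eq, ← mul_apply_eq_comp, ← map_mul, dif_pos (hk i)]
  refine (jetExt_jetAct_congr k u (H' := 1) ?_ (Nat.sub_lt (hk i) one_pos)).trans ?_
  · exact taylorSeries_inv_qCofactor_mul (F := F) k lam hlam i
  rw [map_one, one_apply_eq_self, jetExt, dif_pos (Nat.sub_lt (hk i) one_pos)]
  rfl

theorem isUnit_jetCofactor [FiniteDimensional ℂ F] {lam : Fin p → ℂ}
    (hlam : Function.Injective lam) : IsUnit (jetCofactor k F lam) := by
  have h1 : jetAct k F (fun i => taylorSeries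
      (fun x => ((qCofactor k lam i).eval x)⁻¹ • (1 : F →L[ℂ] F)) (lam i)) *
        jetCofactor k F lam = 1 := by
    rw [jetCofactor_eq, ← map_mul, ← map_one (jetAct k F)]
    congr 1
    funext i
    exact taylorSeries_inv_qCofactor_mul k lam hlam i
  rw [ContinuousLinearMap.isUnit_iff_bijective]
  have h2 : Function.Injective (jetCofactor k F lam).toLinearMap := by
    refine Function.LeftInverse.injective (g := jetAct k F (fun i => taylorSeries
      (fun x => ((qCofactor k lam i).eval x)⁻¹ • (1 : F →L[ℂ] F)) (lam i))) fun u => ?_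
    exact congrArg (fun S : Jet k F →L[ℂ] Jet k F => S u) h1
  exact ⟨h2, LinearMap.injective_iff_surjective.1 h2⟩

theorem contDiffOn_jetRho [FiniteDimensional ℂ F] {lam : T → Fin p → ℂ} (hk : ∀ i, 0 < k i)
    (hlam : ∀ s, Function.Injective (lam s)) (h : ∀ j, ContDiffOn ℂ ω (fun s => lam s j) U) :
    ContDiffOn ℂ ω (fun s => jetRho k F (lam s)) U := by
  have h1 : (fun s => jetRho k F (lam s)) = fun s =>
      (jetLast k F).comp (Ring.inverse (jetCofactor k F (lam s))) := by
    funext s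
    rw [← jetRho_comp_jetCofactor hk (hlam s), ContinuousLinearMap.comp_assoc,
      ← ContinuousLinearMap.mul_def, Ring.mul_inverse_cancel _ (isUnit_jetCofactor (hlam s))]
    rfl
  rw [h1]
  refine contDiffOn_const.clm_comp (contDiffOn_inverse ?_ fun s _ => isUnit_jetCofactor (hlam s))
  refine ContDiffOn.sum fun i _ => contDiffOn_const.mul ?_
  -- The product is written over a list because the algebra of endomorphisms is not commutative.
  have h2 : (fun s => Polynomial.aeval (jetX k F (lam s)) (qCofactor k (lam s) i)) = fun s =>
      ((Finset.univ.erase i).toList.map fun j =>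
        (jetX k F (lam s) - lam s j • (1 : Jet k F →L[ℂ] Jet k F)) ^ k j).prod := by
    funext s
    rw [qCofactor, ← Finset.prod_map_toList, map_list_prod, List.map_map]
    congr 2
    funext j
    simp [Algebra.algebraMap_eq_smul_one]
  rw [h2]
  generalize (Finset.univ.erase i).toList = L
  induction L with
  | nil => simpa using contDiffOn_const
  | cons j L ih =>
    simp only [List.map_cons, List.prod_cons]
    exact (((contDiffOn_jetX (k := k) (F := F) h).sub ((h j).smul contDiffOn_const)).pow _).mul ih

end JetMapL

theorem isOpen_chartDom {T : Type*} [NormedAddCommGroup T] {M : Type*} [TopologicalSpace M]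
    {F : Type*} [NormedAddCommGroup F] [NormedSpace ℂ F] {ι : Type*}
    (E : VectorBundleCore ℂ M F ι) (φ : OpenPartialHomeomorph M T) (i : ι) :
    IsOpen (chartDom E φ i) :=
  φ.isOpen_inter_preimage_symm (E.isOpen_baseSet i)

theorem differentiableAt_of_mem_chartDom {T : Type*} [NormedAddCommGroup T]
    [NormedSpace ℂ T] {M : Type*} [TopologicalSpace M] {F : Type*} [NormedAddCommGroup F]
    [NormedSpace ℂ F] {ι : Type*} {E : VectorBundleCore ℂ M F ι} {φ : OpenPartialHomeomorph M T}
    {i : ι} {W : Type*} [NormedAddCommGroup W] [NormedSpace ℂ W] {f : T → W} {s : T}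
    (hf : ContDiffOn ℂ ω f (chartDom E φ i)) (hs : s ∈ chartDom E φ i) :
    DifferentiableAt ℂ f s :=
  (hf.contDiffAt ((isOpen_chartDom E φ i).mem_nhds hs)).differentiableAt (by simp)

theorem exists_chart_symm_eq {T : Type*} [TopologicalSpace T] {M : Type*} [TopologicalSpace M]
    [ChartedSpace T M] (t : M) : ∃ φ ∈ atlas T M, ∃ s ∈ φ.target, φ.symm s = t :=
  ⟨chartAt T t, chart_mem_atlas T t, chartAt T t t, mem_chart_target T t,
    (chartAt T t).left_inv (mem_chart_source T t)⟩

section Charts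

variable {T : Type*} [NormedAddCommGroup T] [NormedSpace ℂ T]
  {M : Type*} [TopologicalSpace M] [ChartedSpace T M]
  {W : Type*} [NormedAddCommGroup W] [NormedSpace ℂ W] {φ : OpenPartialHomeomorph M T} {s : T}

variable [IsManifold 𝓘(ℂ, T) ω M]

theorem contDiffOn_comp_symm (hφ : φ ∈ atlas T M) {f : M → W} {B : Set M}
    (hf : ContMDiffOn 𝓘(ℂ, T) 𝓘(ℂ, W) ω f B) :
    ContDiffOn ℂ ω (fun s => f (φ.symm s)) (φ.target ∩ φ.symm ⁻¹' B) := by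
  rw [← contMDiffOn_iff_contDiffOn]
  have h1 := contMDiffOn_symm_of_mem_maximalAtlas (I := 𝓘(ℂ, T)) (n := ω)
    (IsManifold.subset_maximalAtlas hφ)
  exact hf.comp (h1.mono Set.inter_subset_left) Set.inter_subset_right

theorem mdifferentiableAt_symm (hφ : φ ∈ atlas T M) (hs : s ∈ φ.target) :
    MDifferentiableAt 𝓘(ℂ, T) 𝓘(ℂ, T) φ.symm s :=
  mdifferentiableAt_atlas_symm hφ hs

theorem fderiv_comp_symm (hφ : φ ∈ atlas T M) (hs : s ∈ φ.target) {f : M → W}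
    (hf : MDifferentiableAt 𝓘(ℂ, T) 𝓘(ℂ, W) f (φ.symm s)) (X : T) :
    fderiv ℂ (fun s => f (φ.symm s)) s X =
      diff (T := T) f (φ.symm s) (mfderiv 𝓘(ℂ, T) 𝓘(ℂ, T) φ.symm s X) := by
  have h1 := mfderiv_comp s hf (mdifferentiableAt_symm hφ hs)
  rw [mfderiv_eq_fderiv] at h1
  exact congrArg (fun S : T →L[ℂ] W => S X) h1

theorem mfderiv_symm_surjective (hφ : φ ∈ atlas T M) (hs : s ∈ φ.target) :
    Function.Surjective (mfderiv 𝓘(ℂ, T) 𝓘(ℂ, T) φ.symm s) :=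
  (mdifferentiable_of_mem_atlas (I := 𝓘(ℂ, T)) hφ).symm.mfderiv_surjective hs

theorem fderiv_prod_apply {f : T × ℂ → W} {x : ℂ} (hf : DifferentiableAt ℂ f (s, x)) (X : T)
    (ξ : ℂ) : fderiv ℂ f (s, x) (X, ξ) =
      fderiv ℂ (fun s => f (s, x)) s X + ξ • deriv (fun x => f (s, x)) x := by
  have h1 : HasFDerivAt (fun s => f (s, x)) _ s :=
    hf.hasFDerivAt.comp s (hasFDerivAt_prodMk_left s x)
  have h2 : HasFDerivAt (fun x => f (s, x)) _ x :=
    hf.hasFDerivAt.comp x (hasFDerivAt_prodMk_right s x)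
  rw [h1.fderiv, h2.hasDerivAt.deriv]
  simp only [ContinuousLinearMap.comp_apply, ContinuousLinearMap.inl_apply,
    ContinuousLinearMap.inr_apply, ← map_smul, ← map_add]
  simp

theorem differentiableAt_prodMk {f : T × ℂ → W} {x : ℂ} (hf : DifferentiableAt ℂ f (s, x)) :
    DifferentiableAt ℂ (fun s => f (s, x)) s ∧ DifferentiableAt ℂ (fun x => f (s, x)) x :=
  ⟨hf.comp s (hasFDerivAt_prodMk_left s x).differentiableAt,
    hf.comp x (hasFDerivAt_prodMk_right s x).differentiableAt⟩

theorem differentiableAt_polyEval {d : ℕ} {c : T → Fin d → W} {s : T} (x : ℂ)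
    (hc : ∀ n, DifferentiableAt ℂ (fun s => c s n) s) :
    DifferentiableAt ℂ (fun z : T × ℂ => polyEval (c z.1) z.2) (s, x) := by
  refine DifferentiableAt.fun_sum fun n _ => ?_
  have h1 : DifferentiableAt ℂ (fun z : T × ℂ => c z.1 n) (s, x) :=
    DifferentiableAt.comp (g := fun s => c s n) (s, x) (hc n) differentiableAt_fst
  exact (differentiableAt_snd.fun_pow _).fun_smul h1

theorem differentiableAt_qPoly {p : ℕ} (k : Fin p → ℕ) {lam : T → Fin p → ℂ} {s : T} (x : ℂ)
    (h : ∀ j, DifferentiableAt ℂ (fun s => lam s j) s) :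
    DifferentiableAt ℂ (fun z : T × ℂ => qPoly k (lam z.1) z.2) (s, x) := by
  have h1 : ∀ j, DifferentiableAt ℂ (fun z : T × ℂ => (z.2 - lam z.1 j) ^ k j) (s, x) := by
    intro j
    have h2 : DifferentiableAt ℂ (fun z : T × ℂ => lam z.1 j) (s, x) :=
      DifferentiableAt.comp (g := fun s => lam s j) (s, x) (h j) differentiableAt_fst
    exact (differentiableAt_snd.fun_sub h2).fun_pow _
  exact (HasFDerivAt.finsetProd fun j _ => (h1 j).hasFDerivAt).differentiableAt

end Charts

/-! ### Holomorphy of `a`, `b`, `α`, `A` and `Ω` in a frame and a chart. -/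

namespace QConnection

variable {T : Type*} [NormedAddCommGroup T] [NormedSpace ℂ T]
  {M : Type*} [TopologicalSpace M] [ChartedSpace T M] {ℓ : ℕ} {ι : Type*}
  {E : VectorBundleCore ℂ M (Fin ℓ → ℂ) ι} {p : ℕ} {k : Fin p → ℕ} (C : QConnection T E k)
  {φ : OpenPartialHomeomorph M T} {s : T}

theorem contDiffOn_Rc (hφ : φ ∈ atlas T M) (i : ι) (n : Fin (qDeg k + 1)) (X : T) :
    ContDiffOn ℂ ω (fun s => pull φ (C.Rc i n) s X) (chartDom E φ i) :=
  (C.Rc_holomorphic i n φ hφ).clm_apply contDiffOn_const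

theorem contDiffOn_OmegaInf (hφ : φ ∈ atlas T M) (i : ι) (X : T) :
    ContDiffOn ℂ ω (fun s => pull φ (C.OmegaInf i) s X) (chartDom E φ i) :=
  C.contDiffOn_Rc hφ i _ X

theorem pull_Omega (i : ι) (x : ℂ) (s X : T) : pull φ (C.Omega i x) s X =
    (C.q (φ.symm s) x)⁻¹ • polyEval (fun n => pull φ (C.Rc i n) s X) x :=
  congrArg ((C.q (φ.symm s) x)⁻¹ • ·) (C.R_apply i x _ _)

variable [IsManifold 𝓘(ℂ, T) ω M]

theorem contDiffOn_lam (hφ : φ ∈ atlas T M) (i : ι) (j : Fin p) :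
    ContDiffOn ℂ ω (fun s => C.poles (φ.symm s) j) (chartDom E φ i) :=
  contDiffOn_comp_symm hφ (C.lam_holomorphic j).contMDiffOn

theorem contDiffOn_a (hφ : φ ∈ atlas T M) (i : ι) :
    ContDiffOn ℂ ω (fun s => C.a (φ.symm s)) (chartDom E φ i) :=
  contDiffOn_jetX (C.contDiffOn_lam hφ i)

theorem fderiv_a (hφ : φ ∈ atlas T M) (hs : s ∈ φ.target) (X : T) :
    fderiv ℂ (fun s => C.a (φ.symm s)) s X = jetDiag k _ fun j =>
      diff (T := T) (C.lam j) (φ.symm s) (mfderiv 𝓘(ℂ, T) 𝓘(ℂ, T) φ.symm s X) := by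
  have h1 : ∀ j, MDifferentiableAt 𝓘(ℂ, T) 𝓘(ℂ, ℂ) (C.lam j) (φ.symm s) := fun j =>
    (C.lam_holomorphic j).mdifferentiableAt (by simp)
  have h2 : ∀ j, DifferentiableAt ℂ (fun s => C.poles (φ.symm s) j) s := fun j =>
    mdifferentiableAt_iff_differentiableAt.1 ((h1 j).comp s (mdifferentiableAt_symm hφ hs))
  refine (fderiv_jetX h2 X).trans ?_
  congr 1
  funext j
  exact fderiv_comp_symm hφ hs (h1 j) X

theorem contDiffOn_Qc (hφ : φ ∈ atlas T M) (i : ι) (n : Fin (qDeg k - 1)) :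
    ContDiffOn ℂ ω (fun s => C.Qc i n (φ.symm s)) (chartDom E φ i) :=
  contDiffOn_comp_symm hφ (C.Qc_holomorphic i n)

theorem contDiffOn_Qhat (hφ : φ ∈ atlas T M) (i : ι) :
    ContDiffOn ℂ ω (fun s => C.Qhat i (φ.symm s)) (chartDom E φ i) :=
  contDiffOn_jetPoly (C.contDiffOn_lam hφ i) (C.contDiffOn_Qc hφ i)

theorem contDiffOn_Rhat (hφ : φ ∈ atlas T M) (i : ι) (X : T) :
    ContDiffOn ℂ ω (fun s => C.Rhat i (φ.symm s) (mfderiv 𝓘(ℂ, T) 𝓘(ℂ, T) φ.symm s X))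
      (chartDom E φ i) :=
  contDiffOn_jetPoly (C.contDiffOn_lam hφ i) fun n => C.contDiffOn_Rc hφ i n X

theorem contDiffOn_alphaLoc (hφ : φ ∈ atlas T M) (i : ι) (X : T) :
    ContDiffOn ℂ ω (fun s => C.alphaLoc φ i s X) (chartDom E φ i) :=
  ((contDiffOn_inverse (C.contDiffOn_Qhat hφ i) fun _ hs => C.isUnit_Qhat hs.2).mul
    (C.contDiffOn_Rhat hφ i X)).congr fun _ hs => C.alpha_eq hs.2 _

theorem contDiffOn_rho (hk : ∀ j, 0 < k j) (hφ : φ ∈ atlas T M) (i : ι) :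
    ContDiffOn ℂ ω (fun s => C.rho (φ.symm s)) (chartDom E φ i) :=
  contDiffOn_jetRho hk (fun _ => C.poles_injective _) (C.contDiffOn_lam hφ i)

theorem contDiffOn_b (hk : ∀ j, 0 < k j) (hφ : φ ∈ atlas T M) (i : ι) :
    ContDiffOn ℂ ω (fun s => C.b i (φ.symm s)) (chartDom E φ i) :=
  ((contDiffOn_const.clm_comp (C.contDiffOn_rho hk hφ i)).mul (C.contDiffOn_Qhat hφ i)).congr
    fun _ _ => C.b_eq hk _ _

theorem differentiableAt_q (hφ : φ ∈ atlas T M) {i : ι} (hs : s ∈ chartDom E φ i) (x : ℂ) :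
    DifferentiableAt ℂ (fun z : T × ℂ => C.q (φ.symm z.1) z.2) (s, x) :=
  differentiableAt_qPoly k x fun j => ((C.contDiffOn_lam hφ i j).contDiffAt
    ((isOpen_chartDom E φ i).mem_nhds hs)).differentiableAt (by simp)

theorem differentiableAt_A (hφ : φ ∈ atlas T M) {i : ι} (hs : s ∈ chartDom E φ i) {x : ℂ}
    (hx : C.q (φ.symm s) x ≠ 0) :
    DifferentiableAt ℂ (fun z : T × ℂ => C.A i (φ.symm z.1) z.2) (s, x) := by
  have h1 := differentiableAt_polyEval (c := fun s n => C.Qc i n (φ.symm s)) x fun n =>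
    ((C.contDiffOn_Qc hφ i n).contDiffAt
      ((isOpen_chartDom E φ i).mem_nhds hs)).differentiableAt (by simp)
  exact ((C.differentiableAt_q hφ hs x).fun_inv hx).fun_smul h1

theorem differentiableAt_Omega (hφ : φ ∈ atlas T M) {i : ι} (hs : s ∈ chartDom E φ i) {x : ℂ}
    (hx : C.q (φ.symm s) x ≠ 0) (X : T) :
    DifferentiableAt ℂ (fun z : T × ℂ => pull φ (C.Omega i z.2) z.1 X) (s, x) := by
  have h1 := differentiableAt_polyEval (c := fun s n => pull φ (C.Rc i n) s X) x fun n =>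
    ((C.contDiffOn_Rc hφ i n X).contDiffAt
      ((isOpen_chartDom E φ i).mem_nhds hs)).differentiableAt (by simp)
  simp only [pull_Omega]
  exact ((C.differentiableAt_q hφ hs x).fun_inv hx).fun_smul h1

end QConnection

/-! ### Derivatives of the generating identities for `b` and `b α`. -/

namespace QConnection

variable {T : Type*} [NormedAddCommGroup T] [NormedSpace ℂ T]
  {M : Type*} [TopologicalSpace M] [ChartedSpace T M] {ℓ : ℕ} {ι : Type*}
  {E : VectorBundleCore ℂ M (Fin ℓ → ℂ) ι} {p : ℕ} {k : Fin p → ℕ} (C : QConnection T E k)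
  {φ : OpenPartialHomeomorph M T} {s : T} {i : ι}

theorem contDiffOn_loc {D : HolConnection T (jetCore k E)} (hφ : φ ∈ atlas T M) (i : ι) (X : T) :
    ContDiffOn ℂ ω (fun s => D.loc φ i s X) (chartDom E φ i) :=
  ContDiffOn.clm_apply (D.holomorphic i φ hφ) contDiffOn_const

theorem mem_resolventSet (hp : 0 < p) (hk : ∀ j, 0 < k j) {t : M} {z : ℂ} (hz : C.q t z ≠ 0) :
    z ∈ resolventSet ℂ (C.a t) := by
  rw [q_eq] at hz
  exact (C.cyclicTriple hp hk t).mem_resolventSet hz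

theorem commute_alpha_alpha_of_alphaCommutes (hα : C.AlphaCommutes) {t : M}
    (ht : t ∈ E.baseSet i) (X Y : TangentSpace 𝓘(ℂ, T) t) :
    Commute (C.alpha i t X) (C.alpha i t Y) := by
  refine C.commute_alpha_alpha ht ?_ ?_ <;> rw [← jetMul_Q] <;> exact hα i t ht _

variable [IsManifold 𝓘(ℂ, T) ω M]

theorem eventually_q_ne_zero (hφ : φ ∈ atlas T M) (hs : s ∈ chartDom E φ i) {z : ℂ}
    (hz : C.q (φ.symm s) z ≠ 0) :
    (∀ᶠ s' in 𝓝 s, C.q (φ.symm s') z ≠ 0) ∧ ∀ᶠ z' in 𝓝 z, C.q (φ.symm s) z' ≠ 0 := by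
  have h1 := (C.differentiableAt_q hφ hs z).continuousAt.eventually_ne hz
  exact ⟨(Continuous.prodMk_left z).continuousAt.eventually h1,
    (Continuous.prodMk_right s).continuousAt.eventually h1⟩

theorem hasFDerivAt_resolvent_a (hp : 0 < p) (hk : ∀ j, 0 < k j) (hφ : φ ∈ atlas T M)
    (hs : s ∈ chartDom E φ i) {z : ℂ} (hz : C.q (φ.symm s) z ≠ 0) :
    DifferentiableAt ℂ (fun s => resolvent (C.a (φ.symm s)) z) s ∧ ∀ X,
      fderiv ℂ (fun s => resolvent (C.a (φ.symm s)) z) s X =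
        resolvent (C.a (φ.symm s)) z * fderiv ℂ (fun s => C.a (φ.symm s)) s X *
          resolvent (C.a (φ.symm s)) z :=
  hasFDerivAt_resolvent_comp (differentiableAt_of_mem_chartDom (C.contDiffOn_a hφ i) hs)
    (C.mem_resolventSet hp hk hz)

/-- The identity `b ψ = ι A v` holds for all nearby points of the base with `z` fixed, and the
derivative of the resolvent `G` is `G (da) G`. -/
theorem fderiv_b_psi (hp : 0 < p) (hk : ∀ j, 0 < k j) (hφ : φ ∈ atlas T M)
    (hs : s ∈ chartDom E φ i) {z : ℂ} (hz : C.q (φ.symm s) z ≠ 0) (X : T) (v : Fin ℓ → ℂ) :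
    fderiv ℂ (fun s => C.b i (φ.symm s)) s X (resolvent (C.a (φ.symm s)) z (jetConst k v)) +
      C.b i (φ.symm s) (resolvent (C.a (φ.symm s)) z (fderiv ℂ (fun s => C.a (φ.symm s)) s X
        (resolvent (C.a (φ.symm s)) z (jetConst k v)))) =
      jetConst k (fderiv ℂ (fun s => C.A i (φ.symm s) z) s X v) := by
  obtain ⟨hG, hG'⟩ := C.hasFDerivAt_resolvent_a hp hk hφ hs hz
  have hb := differentiableAt_of_mem_chartDom (C.contDiffOn_b hk hφ i) hs
  have hA := (differentiableAt_prodMk (C.differentiableAt_A hφ hs hz)).1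
  have h1 : (fun s => (C.b i (φ.symm s) * resolvent (C.a (φ.symm s)) z) (jetConst k v)) =ᶠ[𝓝 s]
      fun s => (jetConst k ∘L C.A i (φ.symm s) z) v :=
    (C.eventually_q_ne_zero hφ hs hz).1.mono fun s' hs' => C.b_psi hp hk i _ hs' v
  have h2 := congrArg (fun S : T →L[ℂ] _ => S X) h1.fderiv_eq
  have h3 : DifferentiableAt ℂ (fun s => jetConst k ∘L C.A i (φ.symm s) z) s :=
    (differentiableAt_const _).clm_comp hA
  have h4 := (hasFDerivAt_const (𝕜 := ℂ) (jetConst (F := Fin ℓ → ℂ) k) s).clm_comp hA.hasFDerivAt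
  rw [fderiv_apply_const (hb.fun_mul hG), fderiv_mul_apply hb hG, hG', fderiv_apply_const h3,
    h4.fderiv] at h2
  simpa [mul_apply_eq_comp] using h2

theorem fderiv_b_alpha_psi (hp : 0 < p) (hk : ∀ j, 0 < k j) (hφ : φ ∈ atlas T M)
    (hs : s ∈ chartDom E φ i) {z : ℂ} (hz : C.q (φ.symm s) z ≠ 0) (X Y : T) (v : Fin ℓ → ℂ) :
    fderiv ℂ (fun s => C.b i (φ.symm s)) s X
        (C.alphaLoc φ i s Y (resolvent (C.a (φ.symm s)) z (jetConst k v))) +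
      C.b i (φ.symm s) (fderiv ℂ (fun s => C.alphaLoc φ i s Y) s X
        (resolvent (C.a (φ.symm s)) z (jetConst k v))) +
      C.b i (φ.symm s) (C.alphaLoc φ i s Y (resolvent (C.a (φ.symm s)) z
        (fderiv ℂ (fun s => C.a (φ.symm s)) s X
          (resolvent (C.a (φ.symm s)) z (jetConst k v))))) =
      jetConst k (fderiv ℂ (fun s => pull φ (C.Omega i z) s Y) s X v) -
        jetConst k (fderiv ℂ (fun s => pull φ (C.OmegaInf i) s Y) s X v) := by
  obtain ⟨hG, hG'⟩ := C.hasFDerivAt_resolvent_a hp hk hφ hs hz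
  have hb := differentiableAt_of_mem_chartDom (C.contDiffOn_b hk hφ i) hs
  have hα := differentiableAt_of_mem_chartDom (C.contDiffOn_alphaLoc hφ i Y) hs
  have hΩ := (differentiableAt_prodMk (C.differentiableAt_Omega hφ hs hz Y)).1
  have hO := differentiableAt_of_mem_chartDom (C.contDiffOn_OmegaInf hφ i Y) hs
  have h1 : (fun s => (C.b i (φ.symm s) * C.alphaLoc φ i s Y * resolvent (C.a (φ.symm s)) z)
      (jetConst k v)) =ᶠ[𝓝 s]
      fun s => (jetConst k ∘L (pull φ (C.Omega i z) s Y - pull φ (C.OmegaInf i) s Y)) v := by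
    filter_upwards [(C.eventually_q_ne_zero hφ hs hz).1, (isOpen_chartDom E φ i).mem_nhds hs]
      with s' hs' hs''
    refine (C.b_alpha_psi hp hk hs''.2 _ hs' v).trans ?_
    rw [← map_sub]
    rfl
  have h2 := congrArg (fun S : T →L[ℂ] _ => S X) h1.fderiv_eq
  have h3 : DifferentiableAt ℂ
      (fun s => jetConst k ∘L (pull φ (C.Omega i z) s Y - pull φ (C.OmegaInf i) s Y)) s :=
    (differentiableAt_const _).clm_comp (hΩ.fun_sub hO)
  have h4 := (hasFDerivAt_const (𝕜 := ℂ) (jetConst (F := Fin ℓ → ℂ) k) s).clm_comp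
    (hΩ.hasFDerivAt.fun_sub hO.hasFDerivAt)
  rw [fderiv_apply_const ((hb.fun_mul hα).fun_mul hG), fderiv_mul_apply (hb.fun_mul hα) hG,
    fderiv_mul_apply hb hα, hG', fderiv_apply_const h3, h4.fderiv] at h2
  simpa [mul_apply_eq_comp] using h2

/-- The derivative of `b α ψ = ι (Ω - Ω_∞) v` in `z`, that of the resolvent being minus its square.
-/
theorem b_alpha_resolvent_psi (hp : 0 < p) (hk : ∀ j, 0 < k j) (hφ : φ ∈ atlas T M)
    (hs : s ∈ chartDom E φ i) {z : ℂ} (hz : C.q (φ.symm s) z ≠ 0) (X : T) (v : Fin ℓ → ℂ) :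
    C.b i (φ.symm s) (C.alphaLoc φ i s X (resolvent (C.a (φ.symm s)) z
      (resolvent (C.a (φ.symm s)) z (jetConst k v)))) =
      -jetConst k (deriv (fun z => pull φ (C.Omega i z) s X) z v) := by
  have hG := spectrum.hasDerivAt_resolvent_const_left (C.mem_resolventSet hp hk hz)
  have hΩ := (differentiableAt_prodMk (C.differentiableAt_Omega hφ hs hz X)).2.hasDerivAt
  have h1 : (fun z => (C.b i (φ.symm s) * C.alphaLoc φ i s X * resolvent (C.a (φ.symm s)) z)
      (jetConst k v)) =ᶠ[𝓝 z]
      fun z => (jetConst k ∘L (pull φ (C.Omega i z) s X - pull φ (C.OmegaInf i) s X)) v := by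
    filter_upwards [(C.eventually_q_ne_zero hφ hs hz).2] with z' hz'
    refine (C.b_alpha_psi hp hk hs.2 _ hz' v).trans ?_
    rw [← map_sub]
    rfl
  have h2 := h1.deriv_eq
  have h3 := (hG.const_mul (C.b i (φ.symm s) * C.alphaLoc φ i s X)).clm_apply
    (hasDerivAt_const z (jetConst k v))
  have h4 := ((hasDerivAt_const z (jetConst (F := Fin ℓ → ℂ) k)).clm_comp
    (hΩ.sub_const (pull φ (C.OmegaInf i) s X))).clm_apply (hasDerivAt_const z v)
  rw [h3.deriv, h4.deriv] at h2
  rw [eq_neg_iff_add_eq_zero, ← sub_eq_zero.2 h2.symm]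
  simp [mul_apply_eq_comp, pow_two, add_comm]

end QConnection

namespace QConnection

variable {T : Type*} [NormedAddCommGroup T] [NormedSpace ℂ T]
  {M : Type*} [TopologicalSpace M] [ChartedSpace T M] {ℓ : ℕ} {ι : Type*}
  {E : VectorBundleCore ℂ M (Fin ℓ → ℂ) ι} {p : ℕ} {k : Fin p → ℕ} {C : QConnection T E k}
  {D D' : HolConnection T (jetCore k E)}
  {φ : OpenPartialHomeomorph M T} {s : T} {i : ι}

theorem aeval_a_qPolynomial (C : QConnection T E k) (t : M) :
    Polynomial.aeval (C.a t) (qPolynomial k (C.poles t)) = 0 :=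
  aeval_jetX_qPolynomial k (C.poles t)

/-! ### Induced connections -/

theorem IsInduced.loc_a (hD : C.IsInduced D) (hφ : φ ∈ atlas T M) (hs : s ∈ chartDom E φ i)
    (X : T) : D.loc φ i s X * C.a (φ.symm s) - C.a (φ.symm s) * D.loc φ i s X =
      C.b i (φ.symm s) * C.alphaLoc φ i s X - C.alphaLoc φ i s X * C.b i (φ.symm s) +
        C.alphaLoc φ i s X - fderiv ℂ (fun s => C.a (φ.symm s)) s X :=
  eq_sub_of_add_eq ((add_comm _ _).trans (hD.2 φ hφ i s hs X))

variable [IsManifold 𝓘(ℂ, T) ω M]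

theorem IsInduced.form_a (hD : C.IsInduced D) {t : M} (ht : t ∈ E.baseSet i)
    (X : TangentSpace 𝓘(ℂ, T) t) : D.form i t X * C.a t - C.a t * D.form i t X =
      C.b i t * C.alpha i t X - C.alpha i t X * C.b i t + C.alpha i t X -
        jetDiag k _ fun j => diff (T := T) (C.lam j) t X := by
  obtain ⟨φ, hφ, s, hs, rfl⟩ := exists_chart_symm_eq (T := T) t
  obtain ⟨(Y : T), rfl⟩ := mfderiv_symm_surjective hφ hs X
  have h1 := hD.loc_a hφ ⟨hs, ht⟩ Y
  rw [C.fderiv_a hφ hs] at h1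
  exact h1

/-- The commutator of the connection form with `q(a) = 0` vanishes, and it is also the obstruction
`[Q̂, α]`. -/
theorem IsInduced.alphaCommutes (hp : 0 < p) (hk : ∀ j, 0 < k j) (hD : C.IsInduced D) :
    C.AlphaCommutes := by
  intro i t ht X
  have h1 := commutator_aeval _ (hD.form_a ht X) (qPolynomial k (C.poles t))
  rw [C.aeval_a_qPolynomial, C.polyDiff_eq hp hk ht, mul_zero, zero_mul, sub_zero] at h1
  rw [jetMul_Q]
  exact (sub_eq_zero.1 h1.symm).symm

theorem IsInduced.same (hp : 0 < p) (hk : ∀ j, 0 < k j) (hD : C.IsInduced D)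
    (hD' : C.IsInduced D') : D.Same D' := by
  intro i t ht
  ext1 X
  refine (C.cyclicTriple hp hk t).eq_of_commute ?_ ?_
  · have h1 := (hD.form_a ht X).trans (hD'.form_a ht X).symm
    rw [Commute, SemiconjBy, sub_mul, mul_sub, ← sub_eq_zero]
    rw [← sub_eq_zero] at h1
    rw [← h1]
    abel
  · ext1 v
    exact (hD.1 i t ht X v).trans (hD'.1 i t ht X v).symm

/-! ### The data at a point -/

/-- The values and the derivatives at a point of the objects attached to `C` and to the induced
connection. -/
def pointData (hp : 0 < p) (hk : ∀ j, 0 < k j) (hD : C.IsInduced D) (hφ : φ ∈ atlas T M)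
    (hs : s ∈ chartDom E φ i) : PointData (C.a (φ.symm s)) (jetConst k) (C.rho (φ.symm s))
      (qPolynomial k (C.poles (φ.symm s))) T where
  b := C.b i (φ.symm s)
  al := C.alphaLoc φ i s
  be := D.loc φ i s
  A := C.A i (φ.symm s)
  Om z X := pull φ (C.Omega i z) s X
  O X := pull φ (C.OmegaInf i) s X
  a' X := fderiv ℂ (fun s => C.a (φ.symm s)) s X
  a'' X Y := fderiv ℂ (fun s => fderiv ℂ (fun s => C.a (φ.symm s)) s Y) s X
  b' X := fderiv ℂ (fun s => C.b i (φ.symm s)) s X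
  al' X Y := fderiv ℂ (fun s => C.alphaLoc φ i s Y) s X
  be' X Y := fderiv ℂ (fun s => D.loc φ i s Y) s X
  A' z X := fderiv ℂ (fun s => C.A i (φ.symm s) z) s X
  Om' z X Y := fderiv ℂ (fun s => pull φ (C.Omega i z) s Y) s X
  Omz z X := deriv (fun z => pull φ (C.Omega i z) s X) z
  O' X Y := fderiv ℂ (fun s => pull φ (C.OmegaInf i) s Y) s X
  cyclic := C.cyclicTriple hp hk _
  eq_zero_of_b _ hw := C.eq_zero_of_b hp hk hs.2 hw
  b_psi z hz v := C.b_psi hp hk i _ (by rwa [q_eq]) v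
  b_al_psi z hz X v := C.b_alpha_psi hp hk hs.2 _ (by rwa [q_eq]) v
  b_al_psi' z hz X v := C.b_alpha_resolvent_psi hp hk hφ hs (by rwa [q_eq]) X v
  al_a X := C.commute_alpha_a i _ _
  al_al X Y := C.commute_alpha_alpha_of_alphaCommutes (hD.alphaCommutes hp hk) hs.2 _ _
  al_a' X Y := by
    rw [C.fderiv_a hφ hs.1]
    exact C.commute_alpha_jetDiag i _ _ _
  be_a X := hD.loc_a hφ hs X
  be_iota X v := hD.1 i _ hs.2 _ v
  b'_psi z hz X v := C.fderiv_b_psi hp hk hφ hs (by rwa [q_eq]) X v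
  b_al'_psi z hz X Y v := C.fderiv_b_alpha_psi hp hk hφ hs (by rwa [q_eq]) X Y v
  be'_iota X Y v := by
    have hβ := differentiableAt_of_mem_chartDom (contDiffOn_loc (D := D) hφ i Y) hs
    have hO := differentiableAt_of_mem_chartDom (C.contDiffOn_OmegaInf hφ i Y) hs
    have h1 : (fun s => D.loc φ i s Y (jetConst k v)) =ᶠ[𝓝 s]
        fun s => (jetConst k ∘L pull φ (C.OmegaInf i) s Y) v :=
      Filter.eventually_of_mem ((isOpen_chartDom E φ i).mem_nhds hs) fun s' hs' =>
        hD.1 i _ hs'.2 _ v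
    have h2 := congrArg (fun S : T →L[ℂ] _ => S X) h1.fderiv_eq
    have h4 := (hasFDerivAt_const (𝕜 := ℂ) (jetConst (F := Fin ℓ → ℂ) k) s).clm_comp
      hO.hasFDerivAt
    rw [fderiv_apply_const hβ, fderiv_apply_const h4.differentiableAt, h4.fderiv] at h2
    simpa using h2
  be'_a X Y := by
    have hβ := differentiableAt_of_mem_chartDom (contDiffOn_loc (D := D) hφ i Y) hs
    have ha := differentiableAt_of_mem_chartDom (C.contDiffOn_a hφ i) hs
    have hb := differentiableAt_of_mem_chartDom (C.contDiffOn_b hk hφ i) hs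
    have hα := differentiableAt_of_mem_chartDom (C.contDiffOn_alphaLoc hφ i Y) hs
    have ha' : DifferentiableAt ℂ (fun s => fderiv ℂ (fun s => C.a (φ.symm s)) s Y) s := by
      have h1 := ((C.contDiffOn_a hφ i).contDiffAt ((isOpen_chartDom E φ i).mem_nhds hs))
      exact ((h1.fderiv_right (m := 1) (by simp)).differentiableAt (by simp)).clm_apply
        (differentiableAt_const Y)
    have h1 : (fun s => D.loc φ i s Y * C.a (φ.symm s) - C.a (φ.symm s) * D.loc φ i s Y)
        =ᶠ[𝓝 s] fun s => C.b i (φ.symm s) * C.alphaLoc φ i s Y -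
          C.alphaLoc φ i s Y * C.b i (φ.symm s) + C.alphaLoc φ i s Y -
            fderiv ℂ (fun s => C.a (φ.symm s)) s Y :=
      Filter.eventually_of_mem ((isOpen_chartDom E φ i).mem_nhds hs) fun s' hs' =>
        hD.loc_a hφ hs' Y
    have h2 := congrArg (fun S : T →L[ℂ] _ => S X) h1.fderiv_eq
    rw [fderiv_fun_sub (hβ.fun_mul ha) (ha.fun_mul hβ), fderiv_fun_sub (((hb.fun_mul hα).fun_sub
      (hα.fun_mul hb)).fun_add hα) ha', fderiv_fun_add ((hb.fun_mul hα).fun_sub (hα.fun_mul hb)) hα,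
      fderiv_fun_sub (hb.fun_mul hα) (hα.fun_mul hb)] at h2
    simp only [sub_apply, add_apply] at h2
    rwa [fderiv_mul_apply hβ ha, fderiv_mul_apply ha hβ, fderiv_mul_apply hb hα,
      fderiv_mul_apply hα hb] at h2
  a''_symm X Y := by
    have h1 := ((C.contDiffOn_a hφ i).contDiffAt ((isOpen_chartDom E φ i).mem_nhds hs))
    have h2 := (h1.fderiv_right (m := 1) (by simp)).differentiableAt (by simp)
    rw [fderiv_apply_const h2, fderiv_apply_const h2]
    exact h1.isSymmSndFDerivAt_of_omega X Y
  al'_a X Y := by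
    have ha := differentiableAt_of_mem_chartDom (C.contDiffOn_a hφ i) hs
    have hα := differentiableAt_of_mem_chartDom (C.contDiffOn_alphaLoc hφ i Y) hs
    have h1 : (fun s => C.alphaLoc φ i s Y * C.a (φ.symm s)) =
        fun s => C.a (φ.symm s) * C.alphaLoc φ i s Y :=
      funext fun s => (C.commute_alpha_a i _ _).eq
    have h2 := congrArg (fun f => fderiv ℂ f s X) h1
    rwa [fderiv_mul_apply hα ha, fderiv_mul_apply ha hα] at h2

/-! ### Flatness -/

theorem fderiv_form (C : QConnection T E k) (hφ : φ ∈ atlas T M) (hs : s ∈ chartDom E φ i) {x : ℂ}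
    (hx : C.q (φ.symm s) x ≠ 0) (X Y : T) (ξ η : ℂ) :
    fderiv ℂ (fun z => C.form φ i z (Y, η)) (s, x) (X, ξ) =
      fderiv ℂ (fun s => pull φ (C.Omega i x) s Y) s X +
        ξ • deriv (fun x => pull φ (C.Omega i x) s Y) x -
        η • (fderiv ℂ (fun s => C.A i (φ.symm s) x) s X +
          ξ • deriv (fun x => C.A i (φ.symm s) x) x) := by
  have hA := C.differentiableAt_A hφ hs hx
  have hΩ := C.differentiableAt_Omega hφ hs hx Y
  simp only [form]
  rw [fderiv_fun_sub hΩ (hA.fun_const_smul η), sub_apply, fderiv_prod_apply hΩ,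
    fderiv_fun_const_smul hA, smul_apply, fderiv_prod_apply hA]

theorem curvature_form (hp : 0 < p) (hk : ∀ j, 0 < k j) (hD : C.IsInduced D) (hφ : φ ∈ atlas T M)
    (hs : s ∈ chartDom E φ i) {x : ℂ} (hx : C.q (φ.symm s) x ≠ 0) (X Y : T) (ξ η : ℂ) :
    curvature (C.form φ i) (s, x) (X, ξ) (Y, η) =
      (pointData hp hk hD hφ hs).pure x X Y - η • (pointData hp hk hD hφ hs).mixed x X +
        ξ • (pointData hp hk hD hφ hs).mixed x Y := by
  rw [curvature, extD, C.fderiv_form hφ hs hx, C.fderiv_form hφ hs hx]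
  simp only [wedge, form, PointData.pure, PointData.mixed, pointData, mul_sub, sub_mul,
    smul_mul_assoc, mul_smul_comm, smul_sub, smul_add]
  rw [smul_comm η ξ]
  module

theorem IsInduced.isSolution_iff (hp : 0 < p) (hk : ∀ j, 0 < k j) (hD : C.IsInduced D) :
    C.IsSolution ↔ D.IsFlat ∧ C.BParallel D ∧ C.AlphaClosed D := by
  have key : ∀ φ (hφ : φ ∈ atlas T M) i s (hs : s ∈ chartDom E φ i),
      (∀ x : ℂ, C.q (φ.symm s) x ≠ 0 → ∀ Z Z' : T × ℂ, curvature (C.form φ i) (s, x) Z Z' = 0) ↔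
      (∀ X Y : T, curvature (D.loc φ i) s X Y = 0) ∧ (∀ X, D.covDeriv φ i (C.b i) s X = 0) ∧
        ∀ X Y, D.covExtD φ i (C.alphaLoc φ i) s X Y = 0 := by
    intro φ hφ i s hs
    have h1 := (pointData hp hk hD hφ hs).flat_iff
    have h2 : ∀ X Y, (pointData hp hk hD hφ hs).curv X Y = curvature (D.loc φ i) s X Y :=
      fun X Y => rfl
    have h3 : ∀ X, (pointData hp hk hD hφ hs).Db X = D.covDeriv φ i (C.b i) s X := fun X => rfl
    have h4 : ∀ X Y, (pointData hp hk hD hφ hs).Dal X Y =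
        D.covExtD φ i (C.alphaLoc φ i) s X Y := by
      intro X Y
      simp only [PointData.Dal, PointData.E, pointData, HolConnection.covExtD, extD, wedge]
      abel
    simp only [h2, h3, h4] at h1
    rw [← h1]
    refine forall_congr' fun x => ?_
    rw [C.q_eq]
    refine imp_congr_right fun hx => ?_
    rw [← C.q_eq] at hx
    constructor
    · intro h
      refine ⟨fun X => ?_, fun X Y => ?_⟩
      · have h5 := h (0, 1) (X, 0)
        -- The point data do not record linearity in the tangent vector, so the vanishing of the
        -- component `pure` at `(0, X)` is also taken from flatness.
        have h6 := h (0, 0) (X, 0)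
        rw [curvature_form hp hk hD hφ hs hx] at h5 h6
        simp only [zero_smul, one_smul, sub_zero, add_zero] at h5 h6
        rwa [h6, zero_add] at h5
      · have h5 := h (X, 0) (Y, 0)
        rw [curvature_form hp hk hD hφ hs hx] at h5
        simpa using h5
    · rintro ⟨h5, h6⟩ ⟨X, ξ⟩ ⟨Y, η⟩
      rw [curvature_form hp hk hD hφ hs hx, h5, h5, h6]
      simp
  constructor
  · intro h
    refine ⟨fun φ hφ i s hs => ?_, fun φ hφ i s hs => ?_, fun φ hφ i s hs => ?_⟩
    · exact ((key φ hφ i s hs).1 fun x hx => h φ hφ i s hs x hx).1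
    · exact ((key φ hφ i s hs).1 fun x hx => h φ hφ i s hs x hx).2.1
    · exact ((key φ hφ i s hs).1 fun x hx => h φ hφ i s hs x hx).2.2
  · rintro ⟨h1, h2, h3⟩ φ hφ i s hs
    exact (key φ hφ i s hs).2 ⟨h1 φ hφ i s hs, h2 φ hφ i s hs, h3 φ hφ i s hs⟩

end QConnection

/-! ### Clearing denominators in the mixed component of the curvature. -/

section PolynomialIdentity

/-- The logarithmic derivative of `q`, in a form that serves both for the derivative along the base
and for that in `x`. -/
theorem hasFDerivAt_prod_pow {S : Type*} [NormedAddCommGroup S] [NormedSpace ℂ S] {p : ℕ}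
    (k : Fin p → ℕ) {f : Fin p → S → ℂ} {f' : Fin p → S →L[ℂ] ℂ} {s : S}
    (hf : ∀ j, HasFDerivAt (f j) (f' j) s) (h0 : ∀ j, f j s ≠ 0) :
    HasFDerivAt (fun s => ∏ j, f j s ^ k j)
      ((∏ j, f j s ^ k j) • ∑ j, (k j / f j s) • f' j) s := by
  have h1 : ∀ j, HasFDerivAt (fun s => f j s ^ k j)
      (((k j : ℂ) * f j s ^ (k j - 1)) • f' j) s := fun j =>
    (hasDerivAt_pow (k j) (f j s)).comp_hasFDerivAt s (hf j)
  refine (HasFDerivAt.finsetProd fun j (_ : j ∈ Finset.univ) => h1 j).congr_fderiv ?_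
  rw [Finset.smul_sum]
  refine Finset.sum_congr rfl fun j _ => ?_
  rw [smul_smul, smul_smul, ← Finset.mul_prod_erase Finset.univ (fun j => f j s ^ k j)
    (Finset.mem_univ j)]
  congr 1
  have h2 : (k j : ℂ) * f j s ^ (k j - 1) = f j s ^ k j * (k j / f j s) := by
    rcases Nat.eq_zero_or_pos (k j) with hk | hk
    · simp [hk]
    · rw [mul_div_left_comm, eq_comm, ← mul_div_assoc, div_eq_iff (h0 j), mul_assoc, ← pow_succ,
        Nat.sub_add_cancel hk]
  rw [h2]
  ring

theorem fderiv_inv_prod_pow_smul {S W : Type*} [NormedAddCommGroup S] [NormedSpace ℂ S]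
    [NormedAddCommGroup W] [NormedSpace ℂ W] {p : ℕ}
    (k : Fin p → ℕ) {f : Fin p → S → ℂ} {f' : Fin p → S →L[ℂ] ℂ} {g : S → W} {s : S}
    (hf : ∀ j, HasFDerivAt (f j) (f' j) s) (h0 : ∀ j, f j s ≠ 0) (hg : DifferentiableAt ℂ g s)
    (X : S) : fderiv ℂ (fun s => (∏ j, f j s ^ k j)⁻¹ • g s) s X =
      (∏ j, f j s ^ k j)⁻¹ • (fderiv ℂ g s X - (∑ j, (k j / f j s) * f' j X) • g s) := by
  have h1 := hasFDerivAt_prod_pow k hf h0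
  have h2 : (∏ j, f j s ^ k j) ≠ 0 := Finset.prod_ne_zero_iff.2 fun j _ => pow_ne_zero _ (h0 j)
  have h3 := ((hasDerivAt_inv h2).comp_hasFDerivAt s h1).fun_smul hg.hasFDerivAt
  simp only [Function.comp_apply] at h3
  rw [h3.fderiv]
  simp only [add_apply, smul_apply, ContinuousLinearMap.smulRight_apply, _root_.sum_apply,
    smul_smul, smul_eq_mul, sub_eq_add_neg, ← neg_smul]
  rw [smul_add, smul_smul]
  congr 2
  field_simp

theorem commutator_eq_of_mixed_eq_zero {𝓐 : Type*} [Ring 𝓐] [Algebra ℂ 𝓐] {p : ℕ} {k : Fin p → ℕ}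
    {y c : Fin p → ℂ} {q : ℂ} (hq : q ≠ 0) {Q Q' R R' : 𝓐}
    (h : q⁻¹ • (Q' - (∑ j, (k j / y j) * (-c j)) • Q) + q⁻¹ • (R' - (∑ j, (k j / y j) * 1) • R) +
      ((q⁻¹ • R) * (q⁻¹ • Q) - (q⁻¹ • Q) * (q⁻¹ • R)) = 0) :
    R * Q - Q * R = q • (∑ j, (k j : ℂ) • (y j)⁻¹ • (R - c j • Q) - Q' - R') := by
  have h2 : ∑ j, (k j : ℂ) • (y j)⁻¹ • (R - c j • Q) =
      (∑ j, (k j / y j) * 1) • R + (∑ j, (k j / y j) * (-c j)) • Q := by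
    rw [Finset.sum_smul, Finset.sum_smul, ← Finset.sum_add_distrib]
    refine Finset.sum_congr rfl fun j _ => ?_
    rw [div_eq_mul_inv]
    module
  rw [h2]
  generalize (∑ j, (k j / y j) * 1) = σ₁ at h ⊢
  generalize (∑ j, (k j / y j) * (-c j)) = σ₂ at h ⊢
  have h3 := congrArg (fun S => (q * q) • S) h
  simp only [smul_mul_assoc, mul_smul_comm, smul_add, smul_sub, smul_smul, smul_zero,
    mul_assoc, mul_inv_cancel₀ hq, mul_one, mul_inv_cancel_left₀ hq, one_smul] at h3
  linear_combination (norm := module) h3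

variable {F : Type*} [NormedAddCommGroup F] [NormedSpace ℂ F] [CompleteSpace F] {p : ℕ} {k : Fin p → ℕ}
  {lam : Fin p → ℂ}

theorem jetMul_eval_smul (P : Polynomial ℂ) :
    jetMul k lam (fun x => P.eval x • (1 : F →L[ℂ] F)) = Polynomial.aeval (jetX k F lam) P := by
  have h1 : (fun x => P.eval x • (1 : F →L[ℂ] F)) =
      polyEval fun n : Fin (P.natDegree + 1) => P.coeff n • (1 : F →L[ℂ] F) := by
    funext x
    rw [polyEval, Polynomial.eval_eq_sum_range, Finset.sum_smul,
      Fin.sum_univ_eq_sum_range (fun n => x ^ n • P.coeff n • (1 : F →L[ℂ] F))]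
    refine Finset.sum_congr rfl fun n _ => ?_
    rw [smul_smul, mul_comm]
  have h2 : ∀ c : ℂ, jetMap k (c • (1 : F →L[ℂ] F)) = c • 1 := by
    intro c
    ext u i m
    simp [jetMap, jetProj]
  rw [h1, jetMul_polyEval, Polynomial.aeval_eq_sum_range,
    Fin.sum_univ_eq_sum_range (fun n => jetMap k (P.coeff n • (1 : F →L[ℂ] F)) * jetX k F lam ^ n)]
  refine Finset.sum_congr rfl fun n _ => ?_
  rw [h2, smul_mul_assoc, one_mul]

/-- By density of the complement of the zeros of `q`, `f = q S` everywhere, and `q` acts on jets as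
`q(a) = 0`. -/
theorem jetMul_eq_zero_of_eq_smul {f S : ℂ → F →L[ℂ] F} (hf : Differentiable ℂ f)
    (hS : Differentiable ℂ S) (h : ∀ x, qPoly k lam x ≠ 0 → f x = qPoly k lam x • S x) :
    jetMul k lam f = 0 := by
  have hq : Differentiable ℂ fun x => qPoly k lam x := by
    simp only [← eval_qPolynomial]
    exact Polynomial.differentiable _
  have h1 : f = fun x => ((qPolynomial k lam).eval x • (1 : F →L[ℂ] F)) * S x := by
    have hd : Dense {x | qPoly k lam x ≠ 0} := by
      have h2 : {x | qPoly k lam x ≠ 0} = ({x | (qPolynomial k lam).IsRoot x})ᶜ := by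
        ext x
        simp [Polynomial.IsRoot, eval_qPolynomial]
      rw [h2]
      exact (Polynomial.finite_setOfPred_isRoot
        (qPolynomial_monic k lam).ne_zero).countable.dense_compl ℂ
    refine Continuous.ext_on hd hf.continuous ?_ fun x hx => ?_
    · simp only [eval_qPolynomial]
      exact ((hq.continuous.smul continuous_const).mul hS.continuous)
    · rw [eval_qPolynomial, smul_mul_assoc, one_mul]
      exact h x hx
  rw [h1, jetMul_mul, jetMul_eval_smul, aeval_jetX_qPolynomial, zero_mul]
  · intro i
    simp only [eval_qPolynomial]
    exact (hq.smul_const _).analyticAt _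
  · exact fun i => hS.analyticAt _

end PolynomialIdentity

/-! ### Flatness makes `α` commute with `Q`. -/

namespace QConnection

variable {T : Type*} [NormedAddCommGroup T] [NormedSpace ℂ T]
  {M : Type*} [TopologicalSpace M] [ChartedSpace T M] [IsManifold 𝓘(ℂ, T) ω M] {ℓ : ℕ} {ι : Type*}
  {E : VectorBundleCore ℂ M (Fin ℓ → ℂ) ι} {p : ℕ} {k : Fin p → ℕ} {C : QConnection T E k}
  {φ : OpenPartialHomeomorph M T} {s : T} {i : ι}

theorem IsSolution.mixed_eq_zero (hC : C.IsSolution) (hφ : φ ∈ atlas T M)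
    (hs : s ∈ chartDom E φ i) {x : ℂ} (hx : C.q (φ.symm s) x ≠ 0) (X : T) :
    fderiv ℂ (fun s => C.A i (φ.symm s) x) s X + deriv (fun x => pull φ (C.Omega i x) s X) x +
      (pull φ (C.Omega i x) s X * C.A i (φ.symm s) x -
        C.A i (φ.symm s) x * pull φ (C.Omega i x) s X) = 0 := by
  have h1 := hC φ hφ i s hs x hx (0, 1) (X, 0)
  rw [curvature, extD, C.fderiv_form hφ hs hx, C.fderiv_form hφ hs hx] at h1
  have h2 : ∀ S : (Fin ℓ → ℂ) →L[ℂ] (Fin ℓ → ℂ), (0 : ℂ) • S = 0 := fun S => zero_smul ℂ S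
  simp only [wedge, form, map_zero, fderiv_const_apply, h2, one_smul, zero_sub, sub_zero,
    zero_add, add_zero, sub_neg_eq_add, mul_neg, neg_mul, deriv_const, zero_apply] at h1
  rw [← h1]
  abel

theorem IsSolution.alphaCommutes (hk : ∀ j, 0 < k j) (hC : C.IsSolution) : C.AlphaCommutes := by
  intro i t ht X
  obtain ⟨φ, hφ, s, hs, rfl⟩ := exists_chart_symm_eq (T := T) t
  obtain ⟨(Y : T), rfl⟩ := mfderiv_symm_surjective hφ hs X
  have hs : s ∈ chartDom E φ i := ⟨hs, ht⟩
  have hQc : ∀ n, DifferentiableAt ℂ (fun s => C.Qc i n (φ.symm s)) s := fun n =>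
    differentiableAt_of_mem_chartDom (C.contDiffOn_Qc hφ i n) hs
  have hlam : ∀ j, DifferentiableAt ℂ (fun s => C.poles (φ.symm s) j) s := fun j =>
    differentiableAt_of_mem_chartDom (C.contDiffOn_lam hφ i j) hs
  set t := φ.symm s with ht_def
  set Z := mfderiv 𝓘(ℂ, T) 𝓘(ℂ, T) φ.symm s Y
  set Q : ℂ → (Fin ℓ → ℂ) →L[ℂ] (Fin ℓ → ℂ) := polyEval fun n => C.Qc i n t with hQ_def
  set R : ℂ → (Fin ℓ → ℂ) →L[ℂ] (Fin ℓ → ℂ) := polyEval fun n => C.Rc i n t Z with hR_def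
  set c : Fin p → ℂ := fun j => diff (T := T) (C.lam j) t Z with hc_def
  have hc : ∀ j, fderiv ℂ (fun s => C.poles (φ.symm s) j) s Y = c j := fun j =>
    fderiv_comp_symm hφ hs.1 ((C.lam_holomorphic j).mdifferentiableAt (by simp)) Y
  have hQ : Differentiable ℂ Q := fun x => (analyticAt_polyEval _ x).differentiableAt
  have hR : Differentiable ℂ R := fun x => (analyticAt_polyEval _ x).differentiableAt
  have hR' : Differentiable ℂ (deriv R) := fun x =>
    (analyticAt_polyEval _ x).deriv.differentiableAt
  set Q' : ℂ → (Fin ℓ → ℂ) →L[ℂ] (Fin ℓ → ℂ) :=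
    polyEval fun n => fderiv ℂ (fun s => C.Qc i n (φ.symm s)) s Y with hQ'_def
  have hQ' : Differentiable ℂ Q' := fun x => (analyticAt_polyEval _ x).differentiableAt
  -- Since `R - cⱼ Q` vanishes at `λⱼ`, these entire functions are the quotients by `x - λⱼ`; the
  -- poles of the logarithmic derivatives of `q` cancel.
  have hds : ∀ j, Differentiable ℂ (dslope (fun x => R x - c j • Q x) (C.poles t j)) := fun j =>
    differentiableOn_univ.1 ((Complex.differentiableOn_dslope Filter.univ_mem).2
      (hR.fun_sub (hQ.fun_const_smul (c j))).differentiableOn)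
  have key : jetMul k (C.poles t) (fun x => R x * Q x - Q x * R x) = 0 := by
    refine jetMul_eq_zero_of_eq_smul (S := fun x => ∑ j, (k j : ℂ) •
      dslope (fun x => R x - c j • Q x) (C.poles t j) x - Q' x - deriv R x)
      ((hR.fun_mul hQ).fun_sub (hQ.fun_mul hR)) (((Differentiable.fun_sum fun j _ =>
        (hds j).fun_const_smul _).fun_sub hQ').fun_sub hR') fun x hx => ?_
    have h0 : ∀ j, x - C.poles t j ≠ 0 := fun j h =>
      hx (Finset.prod_eq_zero (Finset.mem_univ j) (by rw [h, zero_pow (hk j).ne']))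
    have hA : fderiv ℂ (fun s => C.A i (φ.symm s) x) s Y = (qPoly k (C.poles t) x)⁻¹ •
        (Q' x - (∑ j, (k j / (x - C.poles t j)) * (-c j)) • Q x) := by
      have hg : HasFDerivAt (fun s => polyEval (fun n => C.Qc i n (φ.symm s)) x)
          (∑ n : Fin (qDeg k - 1), x ^ (n : ℕ) • fderiv ℂ (fun s => C.Qc i n (φ.symm s)) s) s :=
        HasFDerivAt.fun_sum fun n _ => (hQc n).hasFDerivAt.fun_const_smul (x ^ (n : ℕ))
      have h2 := fderiv_inv_prod_pow_smul k (f := fun j s => x - C.poles (φ.symm s) j)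
        (fun j => (hlam j).hasFDerivAt.const_sub x) h0 hg.differentiableAt Y
      rw [hg.fderiv] at h2
      simp only [neg_apply, hc, _root_.sum_apply, smul_apply] at h2
      exact h2
    have hΩ : deriv (fun x => pull φ (C.Omega i x) s Y) x = (qPoly k (C.poles t) x)⁻¹ •
        (deriv R x - (∑ j, (k j / (x - C.poles t j)) * 1) • R x) := by
      have h2 := fderiv_inv_prod_pow_smul k (f := fun j x => x - C.poles t j)
        (fun j => (hasFDerivAt_id (𝕜 := ℂ) x).sub_const (C.poles t j)) h0 (hR x) 1
      simp only [C.pull_Omega]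
      exact h2
    have hdS : ∀ j, dslope (fun x => R x - c j • Q x) (C.poles t j) x =
        (x - C.poles t j)⁻¹ • (R x - c j • Q x) := by
      intro j
      rw [dslope_of_ne _ (sub_ne_zero.1 (h0 j)), slope_def_module,
        show R (C.poles t j) - c j • Q (C.poles t j) = 0 from sub_eq_zero.2 (C.leading i t ht j Z),
        sub_zero]
    have h1 := hC.mixed_eq_zero hφ hs hx Y
    have hA0 : C.A i (φ.symm s) x = (qPoly k (C.poles t) x)⁻¹ • Q x := rfl
    have hΩ0 : pull φ (C.Omega i x) s Y = (qPoly k (C.poles t) x)⁻¹ • R x := C.pull_Omega i x s Y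
    rw [hA, hΩ, hA0, hΩ0] at h1
    simp only [hdS]
    exact commutator_eq_of_mixed_eq_zero hx h1
  have hRQ : jetMul k (C.poles t) (fun x => R x * Q x) =
      jetMul k (C.poles t) (fun x => Q x * R x) := by
    have h1 := jetMul_add k (C.poles t)
      (fun j => ((hR.fun_mul hQ).fun_sub (hQ.fun_mul hR)).analyticAt (C.poles t j))
      (fun j => (hQ.fun_mul hR).analyticAt (C.poles t j))
    simp only [sub_add_cancel] at h1
    rw [h1, key, zero_add]
  rw [jetMul_mul k _ (fun _ => hR.analyticAt _) (fun _ => hQ.analyticAt _),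
    jetMul_mul k _ (fun _ => hQ.analyticAt _) (fun _ => hR.analyticAt _), hQ_def, hR_def,
    jetMul_polyEval_eq, jetMul_polyEval_eq] at hRQ
  change C.Rhat i t Z * C.Qhat i t = C.Qhat i t * C.Rhat i t Z at hRQ
  rw [← C.Qhat_mul_alpha ht, mul_assoc] at hRQ
  rw [jetMul_Q]
  exact (C.isUnit_Qhat ht).mul_left_cancel hRQ

end QConnection

/-- Continuous functionals separate points, which reduces the claim to scalar polynomials. -/
theorem eq_zero_of_polyEval_eq_zero {W : Type*} [NormedAddCommGroup W] [NormedSpace ℂ W] {d : ℕ}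
    {c : Fin d → W} (h : ∀ x, polyEval c x = 0) (n : Fin d) : c n = 0 := by
  refine (SeparatingDual.eq_zero_iff_forall_dual_eq_zero (R := ℂ) _).2 fun f => ?_
  set P : Polynomial ℂ := ∑ m : Fin d, Polynomial.monomial (m : ℕ) (f (c m)) with hP
  have h1 : P = 0 := by
    refine Polynomial.funext fun x => ?_
    have h2 := congrArg f (h x)
    simp only [polyEval, map_sum, map_smul, smul_eq_mul, map_zero] at h2
    rw [hP, Polynomial.eval_finsetSum, Polynomial.eval_zero, ← h2]
    refine Finset.sum_congr rfl fun m _ => ?_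
    rw [Polynomial.eval_monomial, mul_comm]
  have h3 := congrArg (fun P => Polynomial.coeff P n) h1
  simp only [hP, Polynomial.finsetSum_coeff, Polynomial.coeff_monomial, Polynomial.coeff_zero,
    Fin.val_inj] at h3
  simpa using h3

/-! ### Jet multiplication under constant endomorphisms, and its linearity. -/

section Jets

variable {p : ℕ} {k : Fin p → ℕ} {F : Type*} [NormedAddCommGroup F] [NormedSpace ℂ F]
  {lam : Fin p → ℂ}

theorem jetMap_mul (g h : F →L[ℂ] F) : jetMap k (g * h) = jetMap k g * jetMap k h := rfl

theorem jetMap_eq_jetAct (g : F →L[ℂ] F) : jetMap k g = jetAct k F fun _ => PowerSeries.C g := by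
  rw [← jetMul_const k 0 g, jetMul_eq_jetAct]
  simp only [taylorSeries_const]

theorem commute_jetMap_jetDiag (g : F →L[ℂ] F) (c : Fin p → ℂ) :
    Commute (jetMap k g) (jetDiag k F c) := by
  rw [jetMap_eq_jetAct]
  exact commute_jetAct_jetDiag _ c

theorem jetPoly_add [CompleteSpace F] {d : ℕ} (c c' : Fin d → F →L[ℂ] F) :
    jetPoly (k := k) lam (c + c') = jetPoly lam c + jetPoly lam c' := by
  have h1 : ∀ g h : F →L[ℂ] F, jetMap k (g + h) = jetMap k g + jetMap k h :=
    (jetMapL k F).map_add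
  simp only [jetPoly, Pi.add_apply, h1, add_mul, Finset.sum_add_distrib]

theorem jetPoly_smul [CompleteSpace F] {d : ℕ} (r : ℂ) (c : Fin d → F →L[ℂ] F) :
    jetPoly (k := k) lam (r • c) = r • jetPoly lam c := by
  have h1 : ∀ g : F →L[ℂ] F, jetMap k (r • g) = r • jetMap k g := (jetMapL k F).map_smul r
  simp only [jetPoly, Pi.smul_apply, h1, smul_mul_assoc, Finset.smul_sum]

theorem jetPoly_mul_jetMap [CompleteSpace F] {d : ℕ} (c : Fin d → F →L[ℂ] F) (g : F →L[ℂ] F) :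
    jetPoly (k := k) lam c * jetMap k g = jetPoly lam fun n => c n * g := by
  rw [jetPoly, jetPoly, Finset.sum_mul]
  refine Finset.sum_congr rfl fun n _ => ?_
  rw [mul_assoc, ← ((commute_jetMap_jetX g).pow_right n).eq, ← mul_assoc, jetMap_mul]

theorem jetMap_mul_jetPoly [CompleteSpace F] {d : ℕ} (c : Fin d → F →L[ℂ] F) (g : F →L[ℂ] F) :
    jetMap k g * jetPoly (k := k) lam c = jetPoly lam fun n => g * c n := by
  rw [jetPoly, jetPoly, Finset.mul_sum]
  refine Finset.sum_congr rfl fun n _ => ?_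
  rw [← mul_assoc, jetMap_mul]

theorem jetPoly_qPolynomial [CompleteSpace F] (g : F →L[ℂ] F) :
    jetPoly (k := k) lam (fun n : Fin (qDeg k + 1) => (qPolynomial k lam).coeff n • g) = 0 := by
  have h1 : ∀ r : ℂ, jetMap k (r • g) = r • jetMap k g := fun r => (jetMapL k F).map_smul r g
  simp only [jetPoly, h1, smul_mul_assoc, ← mul_smul_comm]
  rw [← Finset.mul_sum, Fin.sum_univ_eq_sum_range
    (fun n => (qPolynomial k lam).coeff n • jetX k F lam ^ n), ← natDegree_qPolynomial k lam,
    ← Polynomial.aeval_eq_sum_range, aeval_jetX_qPolynomial, mul_zero]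

theorem jetDiag_add (c c' : Fin p → ℂ) :
    jetDiag k F (fun i => c i + c' i) = jetDiag k F c + jetDiag k F c' := by
  rw [jetDiag_eq_sum, jetDiag_eq_sum c, jetDiag_eq_sum c', ← Finset.sum_add_distrib]
  simp only [add_smul]

theorem jetDiag_smul (r : ℂ) (c : Fin p → ℂ) :
    jetDiag k F (fun i => r * c i) = r • jetDiag k F c := by
  rw [jetDiag_eq_sum, jetDiag_eq_sum c, Finset.smul_sum]
  simp only [mul_smul]

end Jets

/-! ### Linearity and holomorphy of the explicit extension. -/

section Extend

variable {V F : Type*} [NormedAddCommGroup V] [NormedSpace ℂ V]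
  [NormedAddCommGroup F] [NormedSpace ℂ F]
  (a : V →L[ℂ] V) (iota : F →L[ℂ] V) (rho : V →L[ℂ] F) (q : Polynomial ℂ)

theorem powDiff_smul (r : ℂ) (K : V →L[ℂ] V) (n : ℕ) : powDiff a (r • K) n = r • powDiff a K n := by
  simp only [powDiff, mul_smul_comm, smul_mul_assoc, Finset.smul_sum]

theorem extend_add (O O' : F →L[ℂ] F) (K K' : V →L[ℂ] V) :
    CyclicTriple.extend a iota rho q (O + O') (K + K') =
      CyclicTriple.extend a iota rho q O K + CyclicTriple.extend a iota rho q O' K' := by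
  simp only [CyclicTriple.extend, powDiff_add, ← Finset.sum_add_distrib, ← smul_add]
  refine Finset.sum_congr rfl fun n _ => congrArg _ (Finset.sum_congr rfl fun r _ => ?_)
  simp only [ContinuousLinearMap.comp_add, ContinuousLinearMap.add_comp]
  abel

theorem extend_smul (r : ℂ) (O : F →L[ℂ] F) (K : V →L[ℂ] V) :
    CyclicTriple.extend a iota rho q (r • O) (r • K) =
      r • CyclicTriple.extend a iota rho q O K := by
  simp only [CyclicTriple.extend, powDiff_smul, Finset.smul_sum]
  refine Finset.sum_congr rfl fun n _ => Finset.sum_congr rfl fun m _ => ?_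
  simp only [ContinuousLinearMap.comp_smul, ContinuousLinearMap.smul_comp, ← smul_add]
  rw [smul_comm]

variable {S : Type*} [NormedAddCommGroup S] [NormedSpace ℂ S] {U : Set S}

theorem contDiffOn_powDiff {a K : S → V →L[ℂ] V} (ha : ContDiffOn ℂ ω a U)
    (hK : ContDiffOn ℂ ω K U) (n : ℕ) : ContDiffOn ℂ ω (fun s => powDiff (a s) (K s) n) U :=
  ContDiffOn.sum fun r _ => ((ha.pow r).mul hK).mul (ha.pow (n - 1 - r))

theorem contDiffOn_extend {a K : S → V →L[ℂ] V} {O : S → F →L[ℂ] F} {rho : S → V →L[ℂ] F}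
    {q : S → Polynomial ℂ} {N : ℕ} (hN : ∀ s, (q s).natDegree = N)
    (hq : ∀ n, ContDiffOn ℂ ω (fun s => (q s).coeff n) U) (ha : ContDiffOn ℂ ω a U)
    (hK : ContDiffOn ℂ ω K U) (hO : ContDiffOn ℂ ω O U) (hrho : ContDiffOn ℂ ω rho U) :
    ContDiffOn ℂ ω (fun s => CyclicTriple.extend (a s) iota (rho s) (q s) (O s) (K s)) U := by
  simp only [CyclicTriple.extend, hN]
  refine ContDiffOn.sum fun n _ => (hq n).smul (ContDiffOn.sum fun r _ => ?_)
  exact (((ha.pow r).clm_comp (contDiffOn_const.clm_comp hO)).add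
    ((contDiffOn_powDiff ha hK r).clm_comp contDiffOn_const)).clm_comp
      (hrho.clm_comp (ha.pow _))

theorem contDiffOn_coeff_mul {P Q : S → Polynomial ℂ}
    (hP : ∀ n, ContDiffOn ℂ ω (fun s => (P s).coeff n) U)
    (hQ : ∀ n, ContDiffOn ℂ ω (fun s => (Q s).coeff n) U) (n : ℕ) :
    ContDiffOn ℂ ω (fun s => (P s * Q s).coeff n) U := by
  simp only [Polynomial.coeff_mul]
  exact ContDiffOn.sum fun x _ => (hP x.1).mul (hQ x.2)

theorem contDiffOn_coeff_qPolynomial {p : ℕ} (k : Fin p → ℕ) {lam : S → Fin p → ℂ}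
    (h : ∀ j, ContDiffOn ℂ ω (fun s => lam s j) U) (n : ℕ) :
    ContDiffOn ℂ ω (fun s => (qPolynomial k (lam s)).coeff n) U := by
  have h1 : ∀ j m n, ContDiffOn ℂ ω
      (fun s => ((Polynomial.X - Polynomial.C (lam s j)) ^ m).coeff n) U := by
    intro j m
    induction m with
    | zero =>
      intro n
      simp only [pow_zero]
      exact contDiffOn_const
    | succ m ih =>
      intro n
      simp only [pow_succ]
      refine contDiffOn_coeff_mul ih (fun n => ?_) n
      simp only [Polynomial.coeff_sub, Polynomial.coeff_C]
      refine contDiffOn_const.sub ?_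
      split_ifs
      · exact h j
      · exact contDiffOn_const
  have h2 : ∀ (J : Finset (Fin p)) n, ContDiffOn ℂ ω
      (fun s => (∏ j ∈ J, (Polynomial.X - Polynomial.C (lam s j)) ^ k j).coeff n) U := by
    intro J
    induction J using Finset.induction with
    | empty =>
      intro n
      simp only [Finset.prod_empty]
      exact contDiffOn_const
    | insert j J hj ih =>
      intro n
      simp only [Finset.prod_insert hj]
      exact contDiffOn_coeff_mul (h1 j (k j)) ih n
  exact h2 Finset.univ n

end Extend

/-- The defect of the gauge law `x g = g y - d` commutes with `a` once the commutators of `x` and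
`y` with `a` are intertwined by `g`. -/
theorem commute_of_commutator_mul_eq {𝓐 : Type*} [Ring 𝓐] {a g x y d : 𝓐} (hg : g * a = a * g)
    (hd : Commute d a) (h : (x * a - a * x) * g = g * (y * a - a * y)) :
    Commute (x * g - (g * y - d)) a := by
  have h1 : x * g * a = x * a * g := by rw [mul_assoc, hg, mul_assoc]
  have h2 : a * (g * y) = g * (a * y) := by rw [← mul_assoc, ← hg, mul_assoc]
  have h3 : (x * g - (g * y - d)) * a - a * (x * g - (g * y - d)) =
      (x * g * a - x * a * g) + (a * (g * y) - g * (a * y)) + (d * a - a * d) +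
        ((x * a - a * x) * g - g * (y * a - a * y)) := by
    noncomm_ring
  rw [h1, h2, hd.eq, h, sub_self, sub_self, sub_self, sub_self, add_zero, add_zero, add_zero] at h3
  exact sub_eq_zero.1 h3

namespace QConnection

variable {T : Type*} [NormedAddCommGroup T] [NormedSpace ℂ T]
  {M : Type*} [TopologicalSpace M] [ChartedSpace T M] {ℓ : ℕ} {ι : Type*}
  {E : VectorBundleCore ℂ M (Fin ℓ → ℂ) ι} {p : ℕ} {k : Fin p → ℕ} (C : QConnection T E k)

/-! ### Changes of frame -/

section Gauge

variable {i j : ι} {t : M}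

theorem Rc_gauge (ht : t ∈ E.baseSet i ∩ E.baseSet j) (X : TangentSpace 𝓘(ℂ, T) t)
    (n : Fin (qDeg k + 1)) : C.Rc j n t X * E.coordChange i j t =
      E.coordChange i j t * C.Rc i n t X -
        (qPolynomial k (C.poles t)).coeff n • diff (T := T) (E.coordChange i j) t X := by
  rw [← sub_eq_zero]
  refine eq_zero_of_polyEval_eq_zero (c := fun n => C.Rc j n t X * E.coordChange i j t -
    (E.coordChange i j t * C.Rc i n t X -
      (qPolynomial k (C.poles t)).coeff n • diff (T := T) (E.coordChange i j) t X)) (fun x => ?_) n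
  have h1 : qPoly k (C.poles t) x = ∑ n : Fin (qDeg k + 1),
      x ^ (n : ℕ) * (qPolynomial k (C.poles t)).coeff n := by
    rw [← eval_qPolynomial, Polynomial.eval_eq_sum_range, natDegree_qPolynomial,
      Fin.sum_univ_eq_sum_range (fun n => x ^ n * (qPolynomial k (C.poles t)).coeff n)]
    exact Finset.sum_congr rfl fun n _ => mul_comm _ _
  have h2 := sub_eq_zero.2 (C.R_gauge i j t ht X x)
  rw [← h2, show qPoly k (fun j => C.lam j t) x = _ from h1]
  ext1 v
  simp only [polyEval, _root_.sum_apply, smul_apply, sub_apply, mul_apply_eq_comp, smul_sub,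
    Finset.sum_sub_distrib, map_sum, map_smul, Finset.sum_smul, smul_smul]

theorem OmegaInf_gauge (ht : t ∈ E.baseSet i ∩ E.baseSet j) (X : TangentSpace 𝓘(ℂ, T) t) :
    C.OmegaInf j t X * E.coordChange i j t =
      E.coordChange i j t * C.OmegaInf i t X - diff (T := T) (E.coordChange i j) t X := by
  have h1 := C.Rc_gauge ht X (Fin.last _)
  have h2 := (qPolynomial_monic k (C.poles t)).coeff_natDegree
  rw [natDegree_qPolynomial] at h2
  have h3 : ∀ S : (Fin ℓ → ℂ) →L[ℂ] (Fin ℓ → ℂ), (1 : ℂ) • S = S := fun S => one_smul ℂ S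
  rw [Fin.val_last, h2, h3] at h1
  exact h1

theorem Qhat_gauge (ht : t ∈ E.baseSet i ∩ E.baseSet j) :
    C.Qhat j t * jetMap k (E.coordChange i j t) = jetMap k (E.coordChange i j t) * C.Qhat i t := by
  rw [Qhat, Qhat, jetPoly_mul_jetMap, jetMap_mul_jetPoly]
  congr 1
  funext n
  exact C.Q_gauge i j t ht n

/-- The inhomogeneous term of the gauge law for `R` is a multiple of `q`, so it acts as zero on
jets. Hence `α` is a genuine form with values in the endomorphisms of the jet bundle. -/
theorem Rhat_gauge (ht : t ∈ E.baseSet i ∩ E.baseSet j) (X : TangentSpace 𝓘(ℂ, T) t) :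
    C.Rhat j t X * jetMap k (E.coordChange i j t) =
      jetMap k (E.coordChange i j t) * C.Rhat i t X := by
  have h1 := jetPoly_add (k := k) (lam := C.poles t)
    (fun n => C.Rc j n t X * E.coordChange i j t) (fun n : Fin (qDeg k + 1) =>
      (qPolynomial k (C.poles t)).coeff n • diff (T := T) (E.coordChange i j) t X)
  rw [jetPoly_qPolynomial, add_zero] at h1
  rw [Rhat, Rhat, jetPoly_mul_jetMap, jetMap_mul_jetPoly, ← h1]
  congr 1
  funext n
  exact add_eq_of_eq_sub (C.Rc_gauge ht X n)

theorem alpha_gauge (ht : t ∈ E.baseSet i ∩ E.baseSet j) (X : TangentSpace 𝓘(ℂ, T) t) :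
    C.alpha j t X * jetMap k (E.coordChange i j t) =
      jetMap k (E.coordChange i j t) * C.alpha i t X := by
  refine (C.isUnit_Qhat ht.2).mul_left_cancel ?_
  rw [← mul_assoc, C.Qhat_mul_alpha ht.2, C.Rhat_gauge ht, ← C.Qhat_mul_alpha ht.1, ← mul_assoc,
    ← mul_assoc, C.Qhat_gauge ht]

theorem b_gauge (hk : ∀ j, 0 < k j) (ht : t ∈ E.baseSet i ∩ E.baseSet j) :
    C.b j t * jetMap k (E.coordChange i j t) = jetMap k (E.coordChange i j t) * C.b i t := by
  have h1 : (jetConst k).comp (C.rho t) * jetMap k (E.coordChange i j t) =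
      jetMap k (E.coordChange i j t) * (jetConst k).comp (C.rho t) := by
    rw [ContinuousLinearMap.mul_def, ContinuousLinearMap.mul_def, ContinuousLinearMap.comp_assoc,
      rho, jetRho_comp_jetMap k _ (C.poles_injective t), ← ContinuousLinearMap.comp_assoc,
      ← jetMap_comp_jetConst, ContinuousLinearMap.comp_assoc]
  rw [C.b_eq hk, C.b_eq hk, mul_assoc, C.Qhat_gauge ht, ← mul_assoc, h1, mul_assoc]

end Gauge

/-! ### The construction of the induced connection -/

/-- The commutator of the form of the induced connection with `a`. -/
def defect (i : ι) (t : M) (X : TangentSpace 𝓘(ℂ, T) t) :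
    Jet k (Fin ℓ → ℂ) →L[ℂ] Jet k (Fin ℓ → ℂ) :=
  C.b i t * (Ring.inverse (C.Qhat i t) * C.Rhat i t X) -
    (Ring.inverse (C.Qhat i t) * C.Rhat i t X) * C.b i t +
    Ring.inverse (C.Qhat i t) * C.Rhat i t X - jetDiag k _ fun j => diff (T := T) (C.lam j) t X

/-- In `defect`, `α` appears as `Q̂⁻¹ R̂`, which is visibly linear in `X` at every point, also
outside the domain of the frame, where a connection form still has to be linear. -/
theorem defect_eq {i : ι} {t : M} (ht : t ∈ E.baseSet i) (X : TangentSpace 𝓘(ℂ, T) t) :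
    C.defect i t X = C.b i t * C.alpha i t X - C.alpha i t X * C.b i t + C.alpha i t X -
      jetDiag k _ fun j => diff (T := T) (C.lam j) t X := by
  rw [defect, C.alpha_eq ht]

theorem defect_add (i : ι) (t : M) (X Y : TangentSpace 𝓘(ℂ, T) t) :
    C.defect i t (X + Y) = C.defect i t X + C.defect i t Y := by
  have h1 : C.Rhat i t (X + Y) = C.Rhat i t X + C.Rhat i t Y := by
    rw [Rhat, Rhat, Rhat, ← jetPoly_add]
    congr 1
    funext n
    exact map_add _ _ _
  simp only [defect, h1, map_add, jetDiag_add, mul_add, add_mul]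
  abel

theorem defect_smul (i : ι) (t : M) (r : ℂ) (X : TangentSpace 𝓘(ℂ, T) t) :
    C.defect i t (r • X) = r • C.defect i t X := by
  have h1 : C.Rhat i t (r • X) = r • C.Rhat i t X := by
    rw [Rhat, Rhat, ← jetPoly_smul]
    congr 1
    funext n
    exact map_smul _ _ _
  have h2 : ∀ {𝓐 : Type _} [Ring 𝓐] [Algebra ℂ 𝓐] (b q y d : 𝓐),
      b * (q * r • y) - q * r • y * b + q * r • y - r • d =
        r • (b * (q * y) - q * y * b + q * y - d) := by
    intro 𝓐 _ _ b q y d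
    simp only [mul_smul_comm, smul_mul_assoc, smul_sub, smul_add]
  simp only [defect, h1, map_smul, smul_eq_mul, jetDiag_smul]
  exact h2 _ _ _ _

theorem polyDiff_defect (hp : 0 < p) (hk : ∀ j, 0 < k j) (hα : C.AlphaCommutes) {i : ι} {t : M}
    (ht : t ∈ E.baseSet i) (X : TangentSpace 𝓘(ℂ, T) t) :
    polyDiff (C.a t) (qPolynomial k (C.poles t)) (C.defect i t X) = 0 := by
  rw [C.defect_eq ht, C.polyDiff_eq hp hk ht, sub_eq_zero, ← jetMul_Q]
  exact (hα i t ht X).eq.symm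

theorem diff_jetMap_coordChange [IsManifold 𝓘(ℂ, T) ω M] [E.IsContMDiff 𝓘(ℂ, T) ω] {i j : ι} {t : M} (ht : t ∈ E.baseSet i ∩ E.baseSet j)
    (X : TangentSpace 𝓘(ℂ, T) t) :
    diff (T := T) (fun t => jetMap k (E.coordChange i j t)) t X =
      jetMap k (diff (T := T) (E.coordChange i j) t X) := by
  obtain ⟨φ, hφ, s, hs, rfl⟩ := exists_chart_symm_eq (T := T) t
  obtain ⟨(Y : T), rfl⟩ := mfderiv_symm_surjective hφ hs X
  have h1 : MDifferentiableAt 𝓘(ℂ, T) 𝓘(ℂ, (Fin ℓ → ℂ) →L[ℂ] (Fin ℓ → ℂ)) (E.coordChange i j)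
      (φ.symm s) :=
    ((E.contMDiffOn_coordChange (n := ω) 𝓘(ℂ, T) i j).contMDiffAt
      (((E.isOpen_baseSet i).inter (E.isOpen_baseSet j)).mem_nhds ht)).mdifferentiableAt (by simp)
  have h2 : DifferentiableAt ℂ (fun s => E.coordChange i j (φ.symm s)) s :=
    mdifferentiableAt_iff_differentiableAt.1 (h1.comp s (mdifferentiableAt_symm hφ hs))
  have h3 : MDifferentiableAt 𝓘(ℂ, T) 𝓘(ℂ, Jet k (Fin ℓ → ℂ) →L[ℂ] Jet k (Fin ℓ → ℂ))
      (fun t => jetMap k (E.coordChange i j t)) (φ.symm s) :=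
    ((jetMapL k (Fin ℓ → ℂ)).mdifferentiable _).comp (φ.symm s) h1
  rw [← fderiv_comp_symm hφ hs h1, ← fderiv_comp_symm hφ hs h3]
  have h4 := ((jetMapL k (Fin ℓ → ℂ)).hasFDerivAt.comp s h2.hasFDerivAt).fderiv
  exact congrArg (fun S : T →L[ℂ] _ => S Y) h4

section Construction

variable [FiniteDimensional ℂ T]

/-- The form of the induced connection. -/
def inducedForm (i : ι) (t : M) : TangentSpace 𝓘(ℂ, T) t →L[ℂ]
    (Jet k (Fin ℓ → ℂ) →L[ℂ] Jet k (Fin ℓ → ℂ)) where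
  toFun X := CyclicTriple.extend (C.a t) (jetConst k) (C.rho t) (qPolynomial k (C.poles t))
    (C.OmegaInf i t X) (C.defect i t X)
  map_add' X Y := by rw [← extend_add, ← C.defect_add, ← map_add]
  map_smul' r X := by rw [RingHom.id_apply, ← extend_smul, ← C.defect_smul, ← map_smul]
  cont := by
    have h1 : ∀ f : T →ₗ[ℂ] (Jet k (Fin ℓ → ℂ) →L[ℂ] Jet k (Fin ℓ → ℂ)), Continuous f :=
      fun f => f.continuous_of_finiteDimensional
    exact h1
      { toFun := fun X : TangentSpace 𝓘(ℂ, T) t => CyclicTriple.extend (C.a t) (jetConst k)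
          (C.rho t) (qPolynomial k (C.poles t)) (C.OmegaInf i t X) (C.defect i t X)
        map_add' := fun X Y : TangentSpace 𝓘(ℂ, T) t =>
          (congrArg₂ _ (map_add (C.OmegaInf i t) X Y) (C.defect_add i t X Y)).trans
            (extend_add _ _ _ _ _ _ _ _)
        map_smul' := fun r (X : TangentSpace 𝓘(ℂ, T) t) =>
          (congrArg₂ _ (map_smul (C.OmegaInf i t) r X) (C.defect_smul i t r X)).trans
            (extend_smul _ _ _ _ _ _ _) }

theorem inducedForm_jetConst (hp : 0 < p) (hk : ∀ j, 0 < k j) (i : ι) (t : M)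
    (X : TangentSpace 𝓘(ℂ, T) t) :
    (C.inducedForm i t X).comp (jetConst k) = (jetConst k).comp (C.OmegaInf i t X) :=
  (C.cyclicTriple hp hk t).extend_comp_iota _ _

theorem inducedForm_a (hp : 0 < p) (hk : ∀ j, 0 < k j) (hα : C.AlphaCommutes) {i : ι} {t : M}
    (ht : t ∈ E.baseSet i) (X : TangentSpace 𝓘(ℂ, T) t) :
    C.inducedForm i t X * C.a t - C.a t * C.inducedForm i t X = C.defect i t X :=
  (C.cyclicTriple hp hk t).extend_commutator _ (C.polyDiff_defect hp hk hα ht X)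

/-- By `eq_of_commute`, two checks suffice. The difference of the two sides commutes with `a`
because `a`, `b`, `α` and `da` are compatible with the change of frame; on constant jets the law is
that of `Ω_∞`. -/
theorem inducedForm_gauge (hp : 0 < p) (hk : ∀ j, 0 < k j) (hα : C.AlphaCommutes) {i j : ι} {t : M}
    (ht : t ∈ E.baseSet i ∩ E.baseSet j) (X : TangentSpace 𝓘(ℂ, T) t) :
    C.inducedForm j t X * jetMap k (E.coordChange i j t) =
      jetMap k (E.coordChange i j t) * C.inducedForm i t X -
        jetMap k (diff (T := T) (E.coordChange i j) t X) := by
  set g := jetMap k (E.coordChange i j t) with hg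
  have hga : g * C.a t = C.a t * g := (commute_jetMap_jetX _).eq
  refine (C.cyclicTriple hp hk t).eq_of_commute ?_ ?_
  · have h1 := C.inducedForm_a hp hk hα ht.1 X
    have h2 := C.inducedForm_a hp hk hα ht.2 X
    have h3 : C.defect j t X * g = g * C.defect i t X := by
      have hα' : C.alpha j t X * g = g * C.alpha i t X := C.alpha_gauge ht X
      have hb : C.b j t * g = g * C.b i t := C.b_gauge hk ht
      have hd : jetDiag k _ (fun j => diff (T := T) (C.lam j) t X) * g =
          g * jetDiag k _ fun j => diff (T := T) (C.lam j) t X :=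
        (commute_jetMap_jetDiag _ _).eq.symm
      rw [C.defect_eq ht.1, C.defect_eq ht.2, sub_mul, add_mul, sub_mul, mul_assoc, mul_assoc, hα',
        hb, hd, ← mul_assoc, ← mul_assoc, hα', hb, mul_sub, mul_add, mul_sub, mul_assoc, mul_assoc]
    have h4 : Commute (jetMap k (diff (T := T) (E.coordChange i j) t X)) (C.a t) :=
      commute_jetMap_jetX _
    rw [← h1, ← h2] at h3
    exact commute_of_commutator_mul_eq hga h4 h3
  · have h1 := C.inducedForm_jetConst hp hk i t X
    have h2 := C.inducedForm_jetConst hp hk j t X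
    have h3 := C.OmegaInf_gauge ht X
    rw [ContinuousLinearMap.sub_comp, ContinuousLinearMap.mul_def, ContinuousLinearMap.mul_def,
      ContinuousLinearMap.comp_assoc, ContinuousLinearMap.comp_assoc, h1, hg, jetMap_comp_jetConst,
      jetMap_comp_jetConst, ← ContinuousLinearMap.comp_assoc, ← ContinuousLinearMap.comp_assoc, h2,
      jetMap_comp_jetConst, ContinuousLinearMap.comp_assoc, ContinuousLinearMap.comp_assoc,
      ← ContinuousLinearMap.comp_sub]
    exact congrArg _ h3

variable [IsManifold 𝓘(ℂ, T) ω M]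

theorem holomorphicForm_inducedForm (hk : ∀ j, 0 < k j) (i : ι) :
    HolomorphicForm (T := T) (C.inducedForm i) (E.baseSet i) := by
  intro φ hφ
  refine contDiffOn_clm_apply.2 fun X => ?_
  have ha : ContDiffOn ℂ ω (fun s => C.a (φ.symm s)) (chartDom E φ i) := C.contDiffOn_a hφ i
  have hb := C.contDiffOn_b hk hφ i
  have hγ := (contDiffOn_inverse (C.contDiffOn_Qhat hφ i) fun _ hs => C.isUnit_Qhat hs.2).mul
    (C.contDiffOn_Rhat hφ i X)
  have ha' : ContDiffOn ℂ ω (fun s => jetDiag k (Fin ℓ → ℂ) fun j =>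
      diff (T := T) (C.lam j) (φ.symm s) (mfderiv 𝓘(ℂ, T) 𝓘(ℂ, T) φ.symm s X))
      (chartDom E φ i) := by
    have h1 := (ha.fderiv_of_isOpen (m := ω) (isOpen_chartDom E φ i) (by simp)).clm_apply
      (contDiffOn_const (c := X))
    exact h1.congr fun s hs => (C.fderiv_a hφ hs.1 X).symm
  have h1 := contDiffOn_extend (jetConst k) (fun s => natDegree_qPolynomial k _)
    (contDiffOn_coeff_qPolynomial k (C.contDiffOn_lam hφ i)) ha
    ((((hb.mul hγ).sub (hγ.mul hb)).add hγ).sub ha') (C.contDiffOn_OmegaInf hφ i X)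
    (C.contDiffOn_rho hk hφ i)
  exact h1

variable [E.IsContMDiff 𝓘(ℂ, T) ω]

/-- The induced connection. -/
def inducedConnection (hp : 0 < p) (hk : ∀ j, 0 < k j) (hα : C.AlphaCommutes) :
    HolConnection T (jetCore k E) where
  form := C.inducedForm
  holomorphic := C.holomorphicForm_inducedForm hk
  gauge i j t ht X := by
    refine (C.inducedForm_gauge hp hk hα ht X).trans ?_
    rw [← diff_jetMap_coordChange ht]
    rfl

theorem isInduced_inducedConnection (hp : 0 < p) (hk : ∀ j, 0 < k j) (hα : C.AlphaCommutes) :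
    C.IsInduced (C.inducedConnection hp hk hα) := by
  refine ⟨fun i t _ X v => ?_, fun φ hφ i s hs X => ?_⟩
  · exact congrArg (fun S : (Fin ℓ → ℂ) →L[ℂ] _ => S v) (C.inducedForm_jetConst hp hk i t X)
  · have h1 := C.inducedForm_a hp hk hα hs.2 (mfderiv 𝓘(ℂ, T) 𝓘(ℂ, T) φ.symm s X)
    rw [C.defect_eq hs.2] at h1
    rw [HolConnection.covDeriv, C.fderiv_a hφ hs.1]
    exact (add_comm _ _).trans (add_eq_of_eq_sub h1)

end Construction

end QConnection

end Isomonodromy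

end

/-! ### The main theorem. -/

theorem mainTheorem1
    {T : Type*} [NormedAddCommGroup T] [NormedSpace ℂ T] [FiniteDimensional ℂ T]
    {M : Type*} [TopologicalSpace M] [ChartedSpace T M] [IsManifold 𝓘(ℂ, T) ω M]
    {ι : Type*} {ℓ : ℕ} (E : VectorBundleCore ℂ M (Fin ℓ → ℂ) ι) [E.IsContMDiff 𝓘(ℂ, T) ω]
    {p : ℕ} (hp : 0 < p) (k : Fin p → ℕ) (hk : ∀ j, 0 < k j)
    (C : Isomonodromy.QConnection T E k) :
    -- the induced connection `D` is unique, and it exists if and only if `α` commutes with `Q`;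
    -- in particular it exists if `C` is a solution of the deformation problem
    (∀ D D' : Isomonodromy.HolConnection T (Isomonodromy.jetCore k E),
      C.IsInduced D → C.IsInduced D' → D.Same D') ∧
    ((∃ D : Isomonodromy.HolConnection T (Isomonodromy.jetCore k E), C.IsInduced D) ↔
      C.AlphaCommutes) ∧
    (C.IsSolution → C.AlphaCommutes) ∧
    -- `C` is a solution of the deformation problem iff `D² = 0`, `D b = 0` and `D α = 0`
    ∀ D : Isomonodromy.HolConnection T (Isomonodromy.jetCore k E), C.IsInduced D →
      (C.IsSolution ↔ D.IsFlat ∧ C.BParallel D ∧ C.AlphaClosed D) := by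
  refine ⟨fun D D' hD hD' => hD.same hp hk hD', ⟨?_, fun hα => ?_⟩, fun hC => hC.alphaCommutes hk,
    fun D hD => hD.isSolution_iff hp hk⟩
  · rintro ⟨D, hD⟩
    exact hD.alphaCommutes hp hk
  · exact ⟨_, C.isInduced_inducedConnection hp hk hα⟩
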